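/- Let $V:\mathbb R\to\mathbb R\cup\{+\infty\}$ be symmetric and uniformly strictly convex (there is $\gamma>0$ such that $x\mapsto V(x)-\gamma x^2/2$ is convex), finite exactly on an interval $(-A,A)$ with $0<A\le+\infty$, with $V(x)\to+\infty$ as $x\to\pm A$, and normalized by $\int_{\mathbb R}e^{-V(x)}\,dx=1$. Put $\sigma^2:=\int_{\mathbb R}x^2e^{-V(x)}\,dx$. Let $(X_i)_{i\ge1}$ be i.i.d. with law $e^{-V(x)}dx$ and, for $a,b\in\mathbb R$, let $\mathbf P^{(a,b)}$ be the law under which $Y_0=a$, $Y_n=a+X_1+\dots+X_n$, $Z_0=b$, $Z_n=b+Y_1+\dots+Y_n$. Denote by $Y_{\langle Nt\rangle}$, $Z_{\langle Nt\rangle}$, $t\in[0,1]$, the linear interpolations of these sequences, that is, $w_{\langle u\rangle}:=w_{\lfloor u\rfloor}+(u-\lfloor u\rfloor)(w_{\lfloor u\rfloor+1}-w_{\lfloor u\rfloor})$. Let $(B_t)_{t\in[0,1]}$ be a standard Brownian motion, $I_t:=\int_0^tB_s\,ds$, and let $(\widehat B,\widehat I)$ be the process $(B,I)$ conditioned on $(B_1,I_1)=(0,0)$.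 All conditional laws given a point are the values at that point of a regular conditional distribution that is weakly continuous there, the point being in the support of the law of the conditioning variable; such a value is unique. Then the law of $(\widehat B,\widehat I)$ on $C([0,1])\times C([0,1])$ exists, and, for every compact $K\subset\mathbb R^2$, the conditional laws $\mathbf P^{(-a,0)}(\,\cdot\mid(Y_N,Z_N)=(-c,0))$ of the processes below exist for all $(a,c)\in K$ once $N$ is large enough (depending on $K$), and, as $N\to\infty$, $$\Big\{\Big(\frac{Y_{\langle Nt\rangle}}{\sigma\sqrt N},\frac{Z_{\langle Nt\rangle}}{\sigma N^{3/2}}\Big)\Big\}_{t\in[0,1]}\ \text{ under }\ \mathbf P^{(-a,0)}(\,\cdot\mid(Y_N,Z_N)=(-c,0))\ \xrightarrow{\ d\ }\ \{(\widehat B_t,\widehat I_t)\}_{t\in[0,1]}$$ in distribution on $C([0,1])\times C([0,1])$ (with the topology of uniform convergence), uniformly for $(a,c)\in K$: for every bounded continuous $g:C([0,1])\times C([0,1])\to\mathbb R$ the expectations of $g$ converge, uniformly for $(a,c)\in K$. -/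

import Mathlib

open MeasureTheory ProbabilityTheory Filter Topology
open scoped unitInterval BoundedContinuousFunction

noncomputable section

namespace IntegratedWalk

/-! ### The potential and the step law -/

/-- An admissible potential `V : ℝ → ℝ ∪ {+∞}`: symmetric, uniformly strictly convex, finite
exactly on an open symmetric interval `(-A, A)`, `0 < A ≤ +∞`, with `V(x) → +∞` as `x → ±A`,
and normalized so that `∫ exp (-V) = 1`. -/
structure IsPotential (V : ℝ → EReal) : Prop where
  ne_bot : ∀ x, V x ≠ ⊥
  symm : ∀ x, V (-x) = V x
  /-- For some `γ > 0`, the function `x ↦ V x - γ x² / 2` is convex (with values in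
  `ℝ ∪ {+∞}`). -/
  uniformly_convex : ∃ γ : ℝ, 0 < γ ∧ ∀ x y s t : ℝ, 0 < s → 0 < t → s + t = 1 →
    V (s * x + t * y) - ((γ * (s * x + t * y) ^ 2 / 2 : ℝ) : EReal) ≤
      (s : EReal) * (V x - ((γ * x ^ 2 / 2 : ℝ) : EReal)) +
        (t : EReal) * (V y - ((γ * y ^ 2 / 2 : ℝ) : EReal))
  regular : ∃ A : EReal, 0 < A ∧ (∀ x : ℝ, V x ≠ ⊤ ↔ -A < (x : EReal) ∧ (x : EReal) < A) ∧
    Tendsto V (comap Real.toEReal (𝓝[<] A)) (𝓝 ⊤) ∧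
    Tendsto V (comap Real.toEReal (𝓝[>] (-A))) (𝓝 ⊤)
  normalized : ∫⁻ x, EReal.exp (-(V x)) = 1

/-- The step law `exp (-V x) dx`. -/
def stepLaw (V : ℝ → EReal) : Measure ℝ :=
  volume.withDensity fun x => EReal.exp (-(V x))

/-- The standard deviation `σ` of the (centred) step law, `σ² = ∫ x² exp (-V x) dx`. -/
def stepSigma (V : ℝ → EReal) : ℝ :=
  √(∫ x, x ^ 2 ∂(stepLaw V))

/-! ### The random walk and the integrated random walk -/

/-- The partial sums `Y_n = a + X_1 + ⋯ + X_n`; here `X_i` is written `x (i - 1)`. -/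
def walk (a : ℝ) (x : ℕ → ℝ) (n : ℕ) : ℝ :=
  a + ∑ i ∈ Finset.range n, x i

/-- The integrated walk `Z_n = b + Y_1 + ⋯ + Y_n`. -/
def integratedWalk (a b : ℝ) (x : ℕ → ℝ) (n : ℕ) : ℝ :=
  b + ∑ k ∈ Finset.range n, walk a x (k + 1)

/-! ### Linear interpolation -/

/-- Value at the real time `u ≥ 0` of the linear interpolation of the sequence `w`. -/
def interpolate (w : ℕ → ℝ) (u : ℝ) : ℝ :=
  w ⌊u⌋₊ + (u - ⌊u⌋₊) * (w (⌊u⌋₊ + 1) - w ⌊u⌋₊)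

lemma interpolate_eq_sum (w : ℕ → ℝ) (M : ℕ) (u : ℝ) (hu : 0 ≤ u) (hM : u ≤ M) :
    interpolate w u =
      w 0 + ∑ k ∈ Finset.range M, (w (k + 1) - w k) * max 0 (min 1 (u - k)) := by
  induction M with
  | zero =>
    have h0 : u = 0 := le_antisymm (by simpa using hM) hu
    simp [interpolate, h0]
  | succ M ih =>
    rw [Finset.sum_range_succ]
    rcases le_or_gt u M with h | h
    · rw [ih h, max_eq_left ((min_le_right _ _).trans (by linarith))]
      ring
    · push_cast at hM
      have hs : ∑ k ∈ Finset.range M, (w (k + 1) - w k) * max 0 (min 1 (u - k)) =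
          w M - w 0 := by
        rw [← Finset.sum_range_sub]
        refine Finset.sum_congr rfl fun k hk => ?_
        have hk' : (k : ℝ) + 1 ≤ M := by exact_mod_cast Finset.mem_range.1 hk
        rw [min_eq_left (by linarith), max_eq_right zero_le_one, mul_one]
      rw [hs, min_eq_right (by linarith), max_eq_right (by linarith)]
      rcases hM.lt_or_eq with h1 | h1
      · have hf : ⌊u⌋₊ = M := (Nat.floor_eq_iff hu).2 ⟨h.le, h1⟩
        simp only [interpolate, hf]
        ring
      · have hf : ⌊u⌋₊ = M + 1 := by
          rw [h1]; exact_mod_cast Nat.floor_natCast (R := ℝ) (M + 1)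
        simp only [interpolate, hf]
        rw [h1]; push_cast; ring

/-- The linearly interpolated path `t ↦ w_{⟨N t⟩}`, `t ∈ [0, 1]`, as an element of
`C([0, 1])`. -/
def interpolatedPath (w : ℕ → ℝ) (N : ℕ) : C(I, ℝ) where
  toFun t := interpolate w (N * (t : ℝ))
  continuous_toFun := by
    have h : (fun t : I => interpolate w (N * (t : ℝ))) = fun t : I =>
        w 0 + ∑ k ∈ Finset.range N, (w (k + 1) - w k) * max 0 (min 1 (N * (t : ℝ) - k)) := by
      funext t
      exact interpolate_eq_sum w N _ (mul_nonneg N.cast_nonneg t.2.1)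
        (mul_le_of_le_one_right N.cast_nonneg t.2.2)
    rw [h]
    fun_prop

/-- The rescaled pair `(Y_{⟨N t⟩} / (σ √N), Z_{⟨N t⟩} / (σ N^{3/2}))`, `t ∈ [0, 1]`, of the walk
with starting point `(Y_0, Z_0) = (a, b)` and steps `x`, where `σ` is written `sd`. -/
def rescaledPair (sd a b : ℝ) (N : ℕ) (x : ℕ → ℝ) : C(I, ℝ) × C(I, ℝ) :=
  ((sd * √(N : ℝ))⁻¹ • interpolatedPath (walk a x) N,
    (sd * (N : ℝ) ^ (3 / 2 : ℝ))⁻¹ • interpolatedPath (integratedWalk a b x) N)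

/-! ### Brownian motion on `[0, 1]` and its integral -/

/-- `C([0, 1])`, with the topology of uniform convergence, carries its Borel σ-algebra. -/
instance : MeasurableSpace C(I, ℝ) := borel _

instance : BorelSpace C(I, ℝ) := ⟨rfl⟩

/-- `B` is a standard Brownian motion on `[0, 1]` with continuous paths: a centred Gaussian process
with covariance `min s t`. -/
structure IsBrownianMotion {Ω : Type*} [MeasurableSpace Ω] (B : Ω → C(I, ℝ)) (P : Measure Ω) :
    Prop where
  gaussian : IsGaussianProcess (fun (t : I) ω => B ω t) P
  mean : ∀ t : I, ∫ ω, B ω t ∂P = 0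
  covariance : ∀ s t : I, cov[fun ω => B ω s, fun ω => B ω t; P] = min (s : ℝ) (t : ℝ)

/-- The path `t ↦ ∫_0^t f(s) ds`. -/
def integralPath (f : C(I, ℝ)) : C(I, ℝ) where
  toFun t := ∫ s in (0 : ℝ)..t, f (Set.projIcc 0 1 zero_le_one s)
  continuous_toFun := by
    have h : Continuous fun s : ℝ => f (Set.projIcc 0 1 zero_le_one s) := by fun_prop
    exact (intervalIntegral.continuous_primitive
      (fun a b => h.intervalIntegrable a b) 0).comp continuous_subtype_val

/-! ### Conditioning on an event of probability zero -/

section Conditioning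

variable {Ω E F : Type*} [MeasurableSpace Ω]
  [TopologicalSpace E] [MeasurableSpace E] [TopologicalSpace F] [MeasurableSpace F]

/-- `μ` is the conditional law of `X` given `T = t₀` under `P`: the value at `t₀` of a regular
conditional distribution of `X` given `T` that is weakly continuous at `t₀`, where `t₀` belongs to
the support of the law of `T`. These requirements determine `μ`, see `IsCondLaw.unique`. -/
def IsCondLaw (P : Measure Ω) (X : Ω → E) (T : Ω → F) (t₀ : F) (μ : Measure E) : Prop :=
  t₀ ∈ (P.map T).support ∧
    ∃ κ : Kernel F E, IsMarkovKernel κ ∧ HasCondDistrib X T κ P ∧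
      (∀ g : E →ᵇ ℝ, ContinuousAt (fun t => ∫ x, g x ∂(κ t)) t₀) ∧ κ t₀ = μ

lemma IsCondLaw.unique [HasOuterApproxClosed E] [BorelSpace E] [MeasurableSpace.CountablyGenerated E]
    {P : Measure Ω} [IsProbabilityMeasure P] {X : Ω → E} {T : Ω → F} {t₀ : F} {μ ν : Measure E}
    (hμ : IsCondLaw P X T t₀ μ) (hν : IsCondLaw P X T t₀ ν) : μ = ν := by
  obtain ⟨hs, κ, _, hκ, hκc, rfl⟩ := hμ
  obtain ⟨-, η, _, hη, hηc, rfl⟩ := hν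
  have hae : κ =ᵐ[P.map T] η :=
    Kernel.ae_eq_of_compProd_eq (hκ.map_eq.symm.trans hη.map_eq)
  have hfr : ∃ᶠ t in 𝓝 t₀, κ t = η t := by
    rw [Filter.Frequently, Filter.Eventually]
    intro hU
    have := (Measure.mem_support_iff_forall t₀).1 hs _ hU
    exact this.ne' (ae_iff.1 hae)
  refine ext_of_forall_integral_eq_of_IsFiniteMeasure fun g => ?_
  by_contra hne
  obtain ⟨t, ht, ht'⟩ := (hfr.and_eventually
    (((hκc g).prodMk (hηc g)).eventually
      ((isClosed_diagonal (X := ℝ)).isOpen_compl.mem_nhds hne))).exists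
  exact ht' (by simp [ht])

open Classical in
/-- The conditional law of `X` given `T = t₀` under `P` (the zero measure if it does not exist). -/
def condLaw (P : Measure Ω) (X : Ω → E) (T : Ω → F) (t₀ : F) : Measure E :=
  if h : ∃ μ, IsCondLaw P X T t₀ μ then h.choose else 0

end Conditioning

/-- The law of the rescaled pair under `𝐏^{(a, b)}( · | (Y_N, Z_N) = (y, z))`, where `X` is the
sequence of steps and `sd` their standard deviation. -/
def walkBridgeLaw {Ω : Type*} [MeasurableSpace Ω] (P : Measure Ω) (X : ℕ → Ω → ℝ)
    (sd a b : ℝ) (N : ℕ) (y z : ℝ) : Measure (C(I, ℝ) × C(I, ℝ)) :=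
  condLaw P (fun ω => rescaledPair sd a b N fun i => X i ω)
    (fun ω => (walk a (fun i => X i ω) N, integratedWalk a b (fun i => X i ω) N)) (y, z)

/-- The law of `(B̂, Î)`: the law of `(B, I)`, `I_t = ∫_0^t B_s ds`, conditionally on
`(B_1, I_1) = (0, 0)`. -/
def brownianBridgeLaw {Ω : Type*} [MeasurableSpace Ω] (P : Measure Ω) (B : Ω → C(I, ℝ)) :
    Measure (C(I, ℝ) × C(I, ℝ)) :=
  condLaw P (fun ω => (B ω, integralPath (B ω))) (fun ω => (B ω 1, integralPath (B ω) 1)) (0, 0)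

end IntegratedWalk

end

/-!
The proof passes through characteristic functions and a local limit theorem for the weighted
densities of the terminal value `(Y_N, Z_N)`.

Symmetry and uniform convexity of `V` turn the step law into a law with a continuous, even, unimodal
density `f` with Gaussian tails (`IsPotential.exists_density`). Its characteristic function `φ` has
norm at most `(1 + u ^ 2) ^ (-κ)` for some `κ > 0` (`IsStepDensity.norm_charFun_le_exp_log`), by
comparison with a uniform law for bounded `u` and by unimodality for large `u`. Products of `φ` over
a positive fraction of the steps are therefore dominated, after rescaling, by an integrable function
that does not depend on `N` (`IsStepDensity.exists_prod_charFun_le`).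

The last two steps of the walk are determined by the terminal value and the other steps. This gives
an explicit regular conditional distribution of the steps given `(Y_N, Z_N)`, which is weakly
continuous wherever the density of `(Y_N, Z_N)` is positive, and Fourier inversion writes the
conditional mean of a functional `G` as the quotient of the Fourier integrals `weightedInt` with
weights `G` and `1` (`exists_isCondLaw_weightedInt`). Three choices of `G` suffice:

* For `G` the exponential of a linear functional of the path, the central limit theorem and dominated
  convergence identify the limit (`tendsto_weightedInt_expFunctional`). For `G = 1` the limit is
  positive, so that the conditional laws exist for large `N`.
* For `G` the truncated fourth power of the increment over `[s, t]`, the Fourier integral is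
  `O((t - s) ^ 2)` (`exists_norm_weightedChar_increment_le`), because a short time interval leaves a
  positive fraction of the steps free to provide the integrable bound. This is tightness.
* The second coordinate of the rescaled walk is within `3 / N` times the norm of the first of its
  integral, and this closed condition passes to the conditional law.

For Brownian motion, the `bridge`, which is the path minus its regression on `(B_1, I_1)`, is
independent of `(B_1, I_1)`, so that its law together with its integral is the conditional law
(`IsBrownianLaw.isCondLaw`). The Gaussian integral of `tendsto_weightedInt_expFunctional` splits
accordingly (`integral_exp_neg_profileVar`), and the quotient of the limits is the characteristic
functional of the bridge.

Weak convergence follows from the convergence of the finite-dimensional distributions and from the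
moment bound by dyadic chaining (`tendsto_integral_of_increments`). All this holds along arbitrary
sequences of lengths and bounded endpoints (`tendsto_integral_of_isCondLaw`), which is uniformity on
compact sets.
-/

namespace IntegratedWalk

/-! ### The density of the step law -/

/-- A probability density on `ℝ` that is continuous, even, nonincreasing on `[0, ∞)` and has
Gaussian tails. -/
structure IsStepDensity (f : ℝ → ℝ) : Prop where
  continuous : Continuous f
  nonneg : ∀ x, 0 ≤ f x
  even : ∀ x, f (-x) = f x
  antitone : AntitoneOn f (Set.Ici 0)
  zero_pos : 0 < f 0
  le_gaussian : ∃ γ : ℝ, 0 < γ ∧ ∀ x, f x ≤ f 0 * Real.exp (-(γ / 2) * x ^ 2)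
  integral_eq_one : ∫ x, f x = 1

/-- The law with density `f`. -/
noncomputable def densityLaw (f : ℝ → ℝ) : Measure ℝ :=
  volume.withDensity fun x => ENNReal.ofReal (f x)

section Potential

variable {V : ℝ → EReal}

/-- An admissible potential in real terms: on the open symmetric interval `S` where it is finite, it
is convex even after subtraction of `γ x ^ 2 / 2`. -/
lemma IsPotential.exists_convexOn (hV : IsPotential V) :
    ∃ γ : ℝ, 0 < γ ∧ ∃ S : Set ℝ, IsOpen S ∧ (0 : ℝ) ∈ S ∧ S.OrdConnected ∧ (∀ x, -x ∈ S ↔ x ∈ S) ∧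
      (∀ x, V x ≠ ⊤ ↔ x ∈ S) ∧ ConvexOn ℝ S (fun x => (V x).toReal - γ * x ^ 2 / 2) := by
  obtain ⟨γ, hγ, hc⟩ := hV.uniformly_convex
  obtain ⟨A, hA, hfin, -, -⟩ := hV.regular
  have hcoe : ∀ x, V x ≠ ⊤ → V x = (((V x).toReal : ℝ) : EReal) := fun x hx =>
    (EReal.coe_toReal hx (hV.ne_bot x)).symm
  have hS : {x : ℝ | -A < (x : EReal) ∧ (x : EReal) < A} =
      Real.toEReal ⁻¹' (Set.Ioo (-A) A) := rfl
  have hord : {x : ℝ | -A < (x : EReal) ∧ (x : EReal) < A}.OrdConnected := by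
    refine ⟨fun x hx y hy z hz => ⟨?_, ?_⟩⟩
    · exact hx.1.trans_le (EReal.coe_le_coe_iff.2 hz.1)
    · exact (EReal.coe_le_coe_iff.2 hz.2).trans_lt hy.2
  refine ⟨γ, hγ, {x : ℝ | -A < (x : EReal) ∧ (x : EReal) < A}, ?_, ?_, hord, ?_, hfin, ?_⟩
  · rw [hS]
    exact isOpen_Ioo.preimage continuous_coe_real_ereal
  · refine ⟨?_, by simpa using hA⟩
    simpa using hA
  · intro x
    rw [Set.mem_ofPred_eq, ← hfin, Set.mem_ofPred_eq, ← hfin, hV.symm]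
  · rw [convexOn_iff_forall_pos]
    refine ⟨hord.convex, fun x hx y hy s t hs ht hst => ?_⟩
    have hz := hord.convex hx hy hs.le ht.le hst
    have h := hc x y s t hs ht hst
    rw [smul_eq_mul, smul_eq_mul] at *
    rw [hcoe _ ((hfin _).2 hx), hcoe _ ((hfin _).2 hy), hcoe _ ((hfin _).2 hz)] at h
    exact_mod_cast h

/-- By symmetry and convexity `V x - γ x ^ 2 / 2` is nondecreasing in `|x|`, which gives monotonicity
and Gaussian tails of the density; continuity at the ends of the interval is the hypothesis that `V`
tends to `+∞` there. -/
lemma IsPotential.exists_density (hV : IsPotential V) :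
    ∃ f : ℝ → ℝ, IsStepDensity f ∧ stepLaw V = densityLaw f := by
  obtain ⟨γ, hγ, S, hSo, h0, hord, hneg, hfin, hconv⟩ := hV.exists_convexOn
  set U : ℝ → ℝ := fun x => (V x).toReal with hU
  set f : ℝ → ℝ := fun x => (EReal.exp (-(V x))).toReal with hf
  have hcoe : ∀ x ∈ S, V x = ((U x : ℝ) : EReal) := fun x hx =>
    (EReal.coe_toReal ((hfin x).2 hx) (hV.ne_bot x)).symm
  have hfS : ∀ x ∈ S, f x = Real.exp (-U x) := by
    intro x hx
    simp only [hf]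
    rw [hcoe x hx, ← EReal.coe_neg, EReal.exp_coe, ENNReal.toReal_ofReal (Real.exp_pos _).le]
  have hfS' : ∀ x, x ∉ S → f x = 0 := by
    intro x hx
    have : V x = ⊤ := by
      by_contra h
      exact hx ((hfin x).1 h)
    simp [hf, this]
  have hnn : ∀ x, 0 ≤ f x := fun x => ENNReal.toReal_nonneg
  have hUeven : ∀ x, U (-x) = U x := fun x => by simp [hU, hV.symm]
  have hkey : ∀ y ∈ S, ∀ x, |x| ≤ |y| → U x - γ * x ^ 2 / 2 ≤ U y - γ * y ^ 2 / 2 := by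
    intro y hy x hxy
    have hseg : x ∈ segment ℝ (-|y|) |y| := by
      rw [segment_eq_Icc (by linarith [abs_nonneg y])]
      exact abs_le.1 hxy
    have hyabs : |y| ∈ S := by
      rcases abs_choice y with h | h <;> rw [h]
      · exact hy
      · exact (hneg y).2 hy
    have hyU : U |y| = U y := by
      rcases abs_choice y with h | h <;> rw [h]
      exact hUeven y
    have := hconv.le_on_segment ((hneg _).2 hyabs) hyabs hseg
    have hyU' : (V |y|).toReal = (V y).toReal := hyU
    simpa [hyU', sq_abs, hU, hV.symm] using this
  have hcU : ContinuousOn U S := by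
    have h1 := hconv.continuousOn hSo
    have h2 : ContinuousOn (fun x : ℝ => γ * x ^ 2 / 2) S := by fun_prop
    have := h1.add h2
    refine this.congr fun x _ => ?_
    simp [hU]
  have hmem : ∀ x y, y ∈ S → |x| ≤ |y| → x ∈ S := by
    intro x y hy hxy
    have hyabs : |y| ∈ S := by
      rcases abs_choice y with h | h <;> rw [h]
      · exact hy
      · exact (hneg y).2 hy
    exact hord.out ((hneg _).2 hyabs) hyabs (abs_le.1 hxy)
  have hanti : ∀ x y, |x| ≤ |y| → f y ≤ f x := by
    intro x y hxy
    by_cases hy : y ∈ S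
    · rw [hfS y hy, hfS x (hmem x y hy hxy), Real.exp_le_exp, neg_le_neg_iff]
      have h1 := hkey y hy x hxy
      have h2 : γ * x ^ 2 ≤ γ * y ^ 2 := by
        have := sq_le_sq.2 hxy
        gcongr
      linarith
    · rw [hfS' y hy]
      exact hnn x
  have hcont : Continuous f := by
    rw [continuous_iff_continuousAt]
    intro x
    by_cases hx : x ∈ S
    · have h1 : ContinuousAt (fun x => Real.exp (-U x)) x :=
        ((hcU.continuousAt (hSo.mem_nhds hx)).neg).rexp
      refine h1.congr ?_
      filter_upwards [hSo.mem_nhds hx] with y hy using (hfS y hy).symm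
    · obtain ⟨A, hA, hfinA, htop, -⟩ := hV.regular
      induction A with
      | bot => simp at hA
      | top => exact absurd ((hfin x).1 ((hfinA x).2 ⟨by simp, by simp⟩)) hx
      | coe r =>
        have hr : (0 : ℝ) < r := by exact_mod_cast hA
        have hxr : r ≤ |x| := by
          by_contra hlt
          push Not at hlt
          obtain ⟨h1, h2⟩ := abs_lt.1 hlt
          exact hx ((hfin x).1 ((hfinA x).2 ⟨by exact_mod_cast h1, by exact_mod_cast h2⟩))
        have hV' : Tendsto V (𝓝[<] r) (𝓝 ⊤) := by
          refine htop.mono_left ?_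
          rw [← Filter.map_le_iff_le_comap]
          refine tendsto_nhdsWithin_iff.2 ⟨?_, ?_⟩
          · exact (continuous_coe_real_ereal.tendsto r).mono_left nhdsWithin_le_nhds
          · filter_upwards [self_mem_nhdsWithin] with y hy
            exact EReal.coe_lt_coe_iff.2 hy
        have hf0 : Tendsto f (𝓝[<] r) (𝓝 0) := by
          have h1 : Tendsto (fun y => EReal.exp (-(V y))) (𝓝[<] r) (𝓝 (EReal.exp (-⊤))) :=
            (ENNReal.continuous_exp.tendsto _).comp ((continuous_neg.tendsto _).comp hV')
          have h2 := (ENNReal.tendsto_toReal (a := EReal.exp (-⊤)) (by simp)).comp h1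
          simpa [Function.comp_def] using h2
        rw [ContinuousAt, hfS' x hx, Metric.tendsto_nhds]
        intro ε hε
        have h3 := (hf0.eventually (gt_mem_nhds hε)).and
          (Ioo_mem_nhdsLT hr : Set.Ioo 0 r ∈ 𝓝[<] r)
        obtain ⟨y0, hy0, hy1, hy2⟩ := h3.exists
        have h4 : ∀ᶠ y in 𝓝 x, y0 < |y| :=
          continuous_abs.continuousAt.eventually (lt_mem_nhds (hy2.trans_le hxr))
        filter_upwards [h4] with y hy
        rw [Real.dist_eq, sub_zero, abs_of_nonneg (hnn y)]
        refine (hanti y0 y ?_).trans_lt hy0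
        rw [abs_of_pos hy1]
        exact hy.le
  have hlaw : stepLaw V = densityLaw f := by
    unfold stepLaw densityLaw
    congr 1
    funext x
    simp only [hf]
    rw [ENNReal.ofReal_toReal]
    intro h
    by_cases hx : x ∈ S
    · rw [hcoe x hx, ← EReal.coe_neg, EReal.exp_coe] at h
      exact ENNReal.ofReal_ne_top h
    · have : V x = ⊤ := by
        by_contra h'
        exact hx ((hfin x).1 h')
      simp [this] at h
  refine ⟨f, ⟨hcont, hnn, ?_, ?_, ?_, ⟨γ, hγ, ?_⟩, ?_⟩, hlaw⟩
  · intro x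
    simp [hf, hV.symm]
  · intro x hx y hy hxy
    exact hanti x y (abs_le_abs_of_nonneg hx hxy)
  · rw [hfS 0 h0]
    exact Real.exp_pos _
  · intro x
    by_cases hx : x ∈ S
    · rw [hfS x hx, hfS 0 h0, ← Real.exp_add, Real.exp_le_exp]
      have := hkey x hx 0 (by simp)
      simp only [ne_eq, OfNat.ofNat_ne_zero, not_false_eq_true, zero_pow, mul_zero, zero_div,
        sub_zero] at this
      linarith
    · rw [hfS' x hx]
      exact mul_nonneg (hnn 0) (Real.exp_pos _).le
  · rw [integral_eq_lintegral_of_nonneg_ae (Eventually.of_forall hnn)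
      hcont.aestronglyMeasurable]
    have h1 : stepLaw V Set.univ = 1 := by
      rw [stepLaw, withDensity_apply _ MeasurableSet.univ, Measure.restrict_univ, hV.normalized]
    rw [hlaw, densityLaw, withDensity_apply _ MeasurableSet.univ, Measure.restrict_univ] at h1
    rw [h1]
    simp

end Potential

namespace IsStepDensity

variable {f : ℝ → ℝ}

lemma integrable (hf : IsStepDensity f) : Integrable f := by
  by_contra h
  have := hf.integral_eq_one
  rw [integral_undef h] at this
  exact zero_ne_one this

lemma le_zero (hf : IsStepDensity f) (x : ℝ) : f x ≤ f 0 := by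
  obtain ⟨γ, hγ, h⟩ := hf.le_gaussian
  refine (h x).trans (mul_le_of_le_one_right hf.zero_pos.le ?_)
  rw [Real.exp_le_one_iff]
  nlinarith [sq_nonneg x]

lemma le_of_abs_le (hf : IsStepDensity f) {x y : ℝ} (h : |x| ≤ |y|) : f y ≤ f x := by
  have habs : ∀ z, f |z| = f z := fun z => by
    rcases abs_choice z with h | h <;> rw [h]
    exact hf.even z
  rw [← habs x, ← habs y]
  exact hf.antitone (abs_nonneg x) (abs_nonneg y) h

lemma isProbabilityMeasure (hf : IsStepDensity f) : IsProbabilityMeasure (densityLaw f) := by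
  constructor
  rw [densityLaw, withDensity_apply _ MeasurableSet.univ, Measure.restrict_univ,
    ← ofReal_integral_eq_lintegral_ofReal hf.integrable (Eventually.of_forall hf.nonneg),
    hf.integral_eq_one, ENNReal.ofReal_one]

lemma integral_densityLaw (hf : IsStepDensity f) {E : Type*} [NormedAddCommGroup E]
    [NormedSpace ℝ E] (g : ℝ → E) : ∫ x, g x ∂(densityLaw f) = ∫ x, f x • g x := by
  rw [densityLaw, integral_withDensity_eq_integral_toReal_smul
    hf.continuous.measurable.ennreal_ofReal (by simp)]
  refine integral_congr_ae (Eventually.of_forall fun x => ?_)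
  simp [ENNReal.toReal_ofReal (hf.nonneg x)]

lemma integrable_pow (hf : IsStepDensity f) (n : ℕ) :
    Integrable (fun x => x ^ n) (densityLaw f) := by
  rw [densityLaw, integrable_withDensity_iff_integrable_smul'
    hf.continuous.measurable.ennreal_ofReal (by simp)]
  obtain ⟨γ, hγ, h⟩ := hf.le_gaussian
  have h1 : Integrable fun x : ℝ => f 0 * (x ^ n * Real.exp (-(γ / 2) * x ^ 2)) := by
    have := integrable_rpow_mul_exp_neg_mul_sq (b := γ / 2) (by positivity) (s := n)
      (by have : (0 : ℝ) ≤ n := n.cast_nonneg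
          linarith)
    simp only [Real.rpow_natCast] at this
    exact this.const_mul _
  refine h1.mono (Continuous.aestronglyMeasurable ?_) (Eventually.of_forall fun x => ?_)
  · simp only [ENNReal.toReal_ofReal (hf.nonneg _)]
    exact hf.continuous.smul (by fun_prop)
  · simp only [ENNReal.toReal_ofReal (hf.nonneg _), smul_eq_mul, norm_mul, Real.norm_eq_abs,
      abs_of_nonneg (hf.nonneg _), Real.abs_exp]
    have := mul_le_mul_of_nonneg_right (h x) (abs_nonneg (x ^ n))
    linarith

lemma integral_odd (hf : IsStepDensity f) {g : ℝ → ℝ} (hg : ∀ x, g (-x) = -g x) :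
    ∫ x, g x ∂(densityLaw f) = 0 := by
  rw [hf.integral_densityLaw]
  have h1 : ∫ x, f (-x) • g (-x) = ∫ x, f x • g x := integral_neg_eq_self (fun x => f x • g x) _
  simp only [hf.even, hg, smul_neg, integral_neg] at h1
  linarith

/-- The density is bounded below by a positive constant near the origin. -/
lemma exists_lower_bound (hf : IsStepDensity f) :
    ∃ m r : ℝ, 0 < m ∧ 0 < r ∧ ∀ x ∈ Set.Icc (-r) r, m ≤ f x := by
  have h := hf.continuous.continuousAt.eventually (lt_mem_nhds (half_lt_self hf.zero_pos))
  obtain ⟨r, hr, hr'⟩ := Metric.eventually_nhds_iff.1 h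
  refine ⟨f 0 / 2, r / 2, half_pos hf.zero_pos, half_pos hr, fun x hx => (hr' ?_).le⟩
  rw [Real.dist_eq, sub_zero]
  exact (abs_le.2 hx).trans_lt (half_lt_self hr)

lemma integral_sq_pos (hf : IsStepDensity f) : 0 < ∫ x, x ^ 2 ∂(densityLaw f) := by
  rw [integral_pos_iff_support_of_nonneg (fun x => sq_nonneg x) (hf.integrable_pow 2)]
  obtain ⟨m, r, hm, hr, h⟩ := hf.exists_lower_bound
  have hs : Set.Ioc 0 r ⊆ Function.support fun x : ℝ => x ^ 2 := by
    intro x hx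
    simp [hx.1.ne']
  refine lt_of_lt_of_le ?_ (measure_mono hs)
  rw [densityLaw, withDensity_apply _ measurableSet_Ioc]
  have h1 : ∫⁻ x in Set.Ioc 0 r, ENNReal.ofReal m ≤
      ∫⁻ x in Set.Ioc 0 r, ENNReal.ofReal (f x) := by
    refine setLIntegral_mono hf.continuous.measurable.ennreal_ofReal fun x hx => ?_
    exact ENNReal.ofReal_le_ofReal (h x ⟨by linarith [hx.1], hx.2⟩)
  refine lt_of_lt_of_le ?_ h1
  simp [hm, hr]

lemma charFun_eq (hf : IsStepDensity f) (u : ℝ) :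
    charFun (densityLaw f) u = ∫ x, (f x : ℂ) * Complex.exp (u * x * Complex.I) := by
  rw [charFun_apply_real, hf.integral_densityLaw]
  simp

/-! ### Bounds for the characteristic function of a step density -/

/-- The law dominates a multiple of a uniform law on an interval, whose characteristic function is
explicit. -/
lemma exists_norm_charFun_le_one_sub (hf : IsStepDensity f) :
    ∃ c : ℝ, 0 < c ∧ c < 1 ∧ ∀ u : ℝ, (|u| ≤ 1 → ‖charFun (densityLaw f) u‖ ≤ 1 - c * u ^ 2) ∧
      (1 ≤ |u| → ‖charFun (densityLaw f) u‖ ≤ 1 - c) := by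
  obtain ⟨m, r₀, hm, hr₀, hlow₀⟩ := hf.exists_lower_bound
  -- shrink the interval so that its radius is at most one
  set r := min r₀ 1 with hrdef
  have hr : 0 < r := lt_min hr₀ one_pos
  have hr1 : r ≤ 1 := min_le_right _ _
  have hlow : ∀ x ∈ Set.Ioc (-r) r, m ≤ f x := fun x hx =>
    hlow₀ x ⟨by linarith [hx.1, min_le_left r₀ 1], hx.2.trans (min_le_left _ _)⟩
  have hind : Integrable ((Set.Ioc (-r) r).indicator fun _ => m) :=
    (integrable_indicator_iff measurableSet_Ioc).2 (integrableOn_const (by simp))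
  have hindle : ∀ x, (Set.Ioc (-r) r).indicator (fun _ => m) x ≤ f x := by
    intro x
    by_cases hx : x ∈ Set.Ioc (-r) r
    · simpa [Set.indicator_of_mem hx] using hlow x hx
    · simpa [Set.indicator_of_notMem hx] using hf.nonneg x
  have hmass : ∫ x, (Set.Ioc (-r) r).indicator (fun _ => m) x = 2 * r * m := by
    rw [integral_indicator measurableSet_Ioc]
    simp [hr.le]
    left; ring
  have hmass1 : 2 * r * m ≤ 1 := by
    rw [← hmass, ← hf.integral_eq_one]
    exact integral_mono hind hf.integrable hindle
  have hexp : ∀ u x : ℝ, ‖Complex.exp (u * x * Complex.I)‖ = 1 := fun u x => by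
    rw [← Complex.ofReal_mul, Complex.norm_exp_ofReal_mul_I]
  have hmeas : ∀ u : ℝ, AEStronglyMeasurable (fun x : ℝ => Complex.exp (u * x * Complex.I)) :=
    fun u => (by fun_prop : Continuous fun x : ℝ =>
      Complex.exp (u * x * Complex.I)).aestronglyMeasurable
  have hsplit : ∀ u : ℝ, ‖charFun (densityLaw f) u‖ ≤
      (1 - 2 * r * m) + m * ‖∫ x in (-r)..r, Complex.exp (u * x * Complex.I)‖ := by
    intro u
    set g := (Set.Ioc (-r) r).indicator fun _ : ℝ => m with hg
    have i1 : Integrable fun x : ℝ => ((f x - g x : ℝ) : ℂ) * Complex.exp (u * x * Complex.I) :=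
      (hf.integrable.sub hind).ofReal.mul_bdd (c := 1) (hmeas u)
        (Eventually.of_forall fun x => (hexp u x).le)
    have i2 : Integrable fun x : ℝ => ((g x : ℝ) : ℂ) * Complex.exp (u * x * Complex.I) :=
      hind.ofReal.mul_bdd (c := 1) (hmeas u) (Eventually.of_forall fun x => (hexp u x).le)
    have e1 : charFun (densityLaw f) u =
        (∫ x : ℝ, ((f x - g x : ℝ) : ℂ) * Complex.exp (u * x * Complex.I)) +
          ∫ x : ℝ, ((g x : ℝ) : ℂ) * Complex.exp (u * x * Complex.I) := by
      rw [hf.charFun_eq, ← integral_add i1 i2]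
      refine integral_congr_ae (Eventually.of_forall fun x => ?_)
      simp only [Complex.ofReal_sub]
      ring
    have e2 : ∫ x : ℝ, ((g x : ℝ) : ℂ) * Complex.exp (u * x * Complex.I) =
        m * ∫ x in (-r)..r, Complex.exp (u * x * Complex.I) := by
      rw [intervalIntegral.integral_of_le (by linarith), ← integral_const_mul,
        ← integral_indicator measurableSet_Ioc]
      refine integral_congr_ae (Eventually.of_forall fun x => ?_)
      by_cases hx : x ∈ Set.Ioc (-r) r
      · simp [hg, Set.indicator_of_mem hx]
      · simp [hg, Set.indicator_of_notMem hx]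
    rw [e1]
    refine (norm_add_le _ _).trans (add_le_add ?_ ?_)
    · refine (norm_integral_le_integral_norm _).trans (le_of_eq ?_)
      rw [← hmass, ← hf.integral_eq_one, ← integral_sub hf.integrable hind]
      refine integral_congr_ae (Eventually.of_forall fun x => ?_)
      simp only [norm_mul, hexp, mul_one, Complex.norm_real, Real.norm_eq_abs]
      exact abs_of_nonneg (sub_nonneg.2 (hindle x))
    · rw [e2, norm_mul, Complex.norm_real, Real.norm_eq_abs, abs_of_pos hm]
  have hsinc : ∀ u : ℝ, u ≠ 0 → ‖∫ x in (-r)..r, Complex.exp (u * x * Complex.I)‖ =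
      2 * |Real.sin (r * u)| / |u| := by
    intro u hu
    have hc : (u * Complex.I : ℂ) ≠ 0 := by simp [hu]
    have h1 : ∀ x : ℝ, Complex.exp (u * x * Complex.I) = Complex.exp (u * Complex.I * x) :=
      fun x => by ring_nf
    simp_rw [h1]
    rw [integral_exp_mul_complex hc, norm_div]
    have h2 : Complex.exp (u * Complex.I * (r : ℝ)) - Complex.exp (u * Complex.I * ((-r : ℝ) : ℂ)) =
        ((2 * Real.sin (r * u) : ℝ) : ℂ) * Complex.I := by
      rw [show (u * Complex.I * (r : ℝ) : ℂ) = ((r * u : ℝ) : ℂ) * Complex.I by push_cast; ring,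
        show (u * Complex.I * ((-r : ℝ) : ℂ) : ℂ) = ((-(r * u) : ℝ) : ℂ) * Complex.I by
          push_cast; ring, Complex.exp_mul_I, Complex.exp_mul_I]
      push_cast
      rw [Complex.cos_neg, Complex.sin_neg]
      ring
    rw [h2, norm_mul, norm_mul, Complex.norm_real, Complex.norm_real]
    simp
  -- `|sin v| ≤ |v| (1 - v² / 20)` for `|v| ≤ 1`, `|sin v| ≤ |v| (1 - 1 / 20)` for `|v| ≥ 1`
  have hsin1 : ∀ v : ℝ, |v| ≤ Real.pi → |Real.sin v| ≤ |v| * (1 - v ^ 2 / 20) := by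
    intro v hv
    have hpi2 : Real.pi ^ 2 ≤ 10 := by nlinarith [Real.pi_lt_d2, Real.pi_pos]
    have h1 : Real.sin v = 2 * Real.sin (v / 2) * Real.cos (v / 2) := by
      rw [← Real.sin_two_mul]; ring_nf
    have h2 : |Real.sin (v / 2)| ≤ |v / 2| := Real.abs_sin_le_abs
    have hv2 : |v / 2| ≤ Real.pi / 2 := by
      rw [abs_div, abs_two]; linarith
    have h3 : 0 ≤ Real.cos (v / 2) := Real.cos_nonneg_of_mem_Icc (abs_le.1 hv2)
    have h4 := Real.cos_le_one_sub_mul_cos_sq (x := v / 2) (by linarith [Real.pi_pos])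
    have h5 : v ^ 2 / 20 ≤ 2 / Real.pi ^ 2 * (v / 2) ^ 2 := by
      rw [div_mul_eq_mul_div, le_div_iff₀ (by positivity)]
      nlinarith [sq_nonneg v]
    rw [h1, abs_mul, abs_mul, abs_two, abs_of_nonneg h3]
    rw [abs_div, abs_two] at h2
    have h6 : 2 * |Real.sin (v / 2)| ≤ |v| := by linarith
    exact mul_le_mul h6 (by linarith) h3 (abs_nonneg v)
  have hsin2 : ∀ v b : ℝ, 0 ≤ b → b ≤ 1 → b ≤ v ^ 2 → |Real.sin v| ≤ |v| * (1 - b / 20) := by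
    intro v b hb0 hb1 hbv
    rcases le_total |v| Real.pi with h | h
    · refine (hsin1 v h).trans (mul_le_mul_of_nonneg_left ?_ (abs_nonneg v))
      linarith
    · have h1 := Real.abs_sin_le_one v
      have h2 : 3 ≤ |v| := Real.pi_gt_three.le.trans h
      nlinarith
  have hmain : ∀ u b : ℝ, u ≠ 0 → 0 ≤ b → b ≤ 1 → b ≤ (r * u) ^ 2 →
      ‖charFun (densityLaw f) u‖ ≤ 1 - 2 * r * m / 20 * b := by
    intro u b hu h0 h1 hb
    refine (hsplit u).trans ?_
    rw [hsinc u hu]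
    have h2 := hsin2 (r * u) b h0 h1 hb
    rw [abs_mul, abs_of_pos hr] at h2
    have hu' : 0 < |u| := abs_pos.2 hu
    have h3 : 2 * |Real.sin (r * u)| / |u| ≤ 2 * r * (1 - b / 20) := by
      rw [div_le_iff₀ hu']
      nlinarith
    have := mul_le_mul_of_nonneg_left h3 hm.le
    linarith
  have hrm : 0 < 2 * r * m := by positivity
  have hprob := hf.isProbabilityMeasure
  have hr2 : r ^ 2 ≤ 1 := by nlinarith
  refine ⟨2 * r * m / 20 * r ^ 2, by positivity, by nlinarith, fun u => ⟨fun hu => ?_, fun hu => ?_⟩⟩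
  · rcases eq_or_ne u 0 with rfl | hu0
    · simp
    · have hu2 : u ^ 2 ≤ 1 := by rw [← sq_abs]; nlinarith [abs_nonneg u]
      have := hmain u ((r * u) ^ 2) hu0 (sq_nonneg _) (by nlinarith [sq_nonneg r]) le_rfl
      nlinarith
  · have hu2 : 1 ≤ u ^ 2 := by rw [← sq_abs]; nlinarith [abs_nonneg u]
    have hu0 : u ≠ 0 := by rintro rfl; simp at hu; linarith
    exact hmain u (r ^ 2) hu0 (sq_nonneg _) hr2 (by nlinarith [sq_nonneg r])

/-- Translation by `h` changes a unimodal density by `O(h)` in `L¹`: away from the mode the difference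
has constant sign on each side and its integral telescopes. -/
lemma integral_abs_sub_translate_le (hf : IsStepDensity f) {h : ℝ} (hh : 0 < h) :
    ∫ x, |f x - f (x + h)| ≤ 3 * (h * f 0) := by
  have hi : Integrable f := hf.integrable
  have hi' : Integrable fun x => f (x + h) := hi.comp_add_right h
  have hd : Integrable fun x => |f x - f (x + h)| := (hi.sub hi').abs
  have hbd : ∀ a b : ℝ, a ≤ b → ∫ x in Set.Ioc a b, f x ≤ (b - a) * f 0 := by
    intro a b hab
    have : ∫ x in Set.Ioc a b, f x ≤ ∫ x in Set.Ioc a b, f 0 :=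
      setIntegral_mono_on hi.integrableOn (integrableOn_const (by simp)) measurableSet_Ioc
        fun x _ => hf.le_zero x
    simpa [hab] using this
  have h1 : ∫ x in Set.Ioi 0, |f x - f (x + h)| ≤ h * f 0 := by
    have e1 : ∫ x in Set.Ioi 0, |f x - f (x + h)| = ∫ x in Set.Ioi 0, (f x - f (x + h)) := by
      refine setIntegral_congr_fun measurableSet_Ioi fun x hx => abs_of_nonneg (sub_nonneg.2 ?_)
      have hx' : (0 : ℝ) < x := hx
      exact hf.antitone hx'.le (by simp; linarith) (by linarith)
    have e2 : ∫ x in Set.Ioi 0, f (x + h) = ∫ x in Set.Ioi h, f x := by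
      have := (measurePreserving_add_right (volume : Measure ℝ) h).setIntegral_preimage_emb
        (measurableEmbedding_addRight h) f (Set.Ioi h)
      simpa using this
    rw [e1, integral_sub hi.integrableOn hi'.integrableOn, e2,
      intervalIntegral.integral_Ioi_sub_Ioi' hi.integrableOn hi.integrableOn,
      intervalIntegral.integral_of_le hh.le]
    simpa using hbd 0 h hh.le
  have h2 : ∫ x in Set.Iic (-h), |f x - f (x + h)| ≤ h * f 0 := by
    have e1 : ∫ x in Set.Iic (-h), |f x - f (x + h)| = ∫ x in Set.Iic (-h), (f (x + h) - f x) := by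
      refine setIntegral_congr_fun measurableSet_Iic fun x hx => ?_
      have hx' : x ≤ -h := hx
      rw [abs_sub_comm]
      refine abs_of_nonneg (sub_nonneg.2 (hf.le_of_abs_le ?_))
      rw [abs_of_nonpos (by linarith), abs_of_nonpos (by linarith)]
      linarith
    have e2 : ∫ x in Set.Iic (-h), f (x + h) = ∫ x in Set.Iic 0, f x := by
      have := (measurePreserving_add_right (volume : Measure ℝ) h).setIntegral_preimage_emb
        (measurableEmbedding_addRight h) f (Set.Iic 0)
      simpa using this
    rw [e1, integral_sub hi'.integrableOn hi.integrableOn, e2,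
      intervalIntegral.integral_Iic_sub_Iic hi.integrableOn hi.integrableOn,
      intervalIntegral.integral_of_le (by linarith)]
    simpa using hbd (-h) 0 (by linarith)
  have h3 : ∫ x in Set.Ioc (-h) 0, |f x - f (x + h)| ≤ h * f 0 := by
    have : ∫ x in Set.Ioc (-h) 0, |f x - f (x + h)| ≤ ∫ x in Set.Ioc (-h) 0, f 0 :=
      setIntegral_mono_on hd.integrableOn (integrableOn_const (by simp)) measurableSet_Ioc
        fun x _ => abs_le.2 ⟨by linarith [hf.le_zero (x + h), hf.nonneg x],
          by linarith [hf.le_zero x, hf.nonneg (x + h)]⟩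
    simpa [hh.le] using this
  have hsum : ∫ x, |f x - f (x + h)| = (∫ x in Set.Iic (-h), |f x - f (x + h)|) +
      (∫ x in Set.Ioc (-h) 0, |f x - f (x + h)|) + ∫ x in Set.Ioi 0, |f x - f (x + h)| := by
    rw [← setIntegral_union (by rw [Set.disjoint_left]; intro x hx hx'; exact absurd hx'.1 (not_lt.2 hx))
      measurableSet_Ioc hd.integrableOn hd.integrableOn, Set.Iic_union_Ioc_eq_Iic (by linarith),
      ← integral_add_compl measurableSet_Iic hd, Set.compl_Iic]
  linarith

/-- Unimodality makes the characteristic function decay like `1 / |u|`: shifting by half a period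
changes the sign of the exponential, and a shift by `h` changes `f` by `O(h)` in `L¹`. -/
lemma norm_charFun_le_div (hf : IsStepDensity f) {u : ℝ} (hu : u ≠ 0) :
    ‖charFun (densityLaw f) u‖ ≤ 3 * Real.pi * f 0 / |u| := by
  wlog hpos : 0 < u generalizing u
  · have := this (u := -u) (by simpa using hu) (by
      rcases lt_or_gt_of_ne hu with h | h
      · linarith
      · exact absurd h hpos)
    rwa [charFun_neg, RCLike.norm_conj, abs_neg] at this
  set h := Real.pi / u with hh
  have hhpos : 0 < h := div_pos Real.pi_pos hpos
  have hexp : ∀ u x : ℝ, ‖Complex.exp (u * x * Complex.I)‖ = 1 := fun u x => by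
    rw [← Complex.ofReal_mul, Complex.norm_exp_ofReal_mul_I]
  have hmeas : AEStronglyMeasurable (fun x : ℝ => Complex.exp (u * x * Complex.I)) :=
    (by fun_prop : Continuous fun x : ℝ => Complex.exp (u * x * Complex.I)).aestronglyMeasurable
  have hi : Integrable f := hf.integrable
  have hi' : Integrable fun x => f (x + h) := hi.comp_add_right h
  have i1 : Integrable fun x : ℝ => (f x : ℂ) * Complex.exp (u * x * Complex.I) :=
    hi.ofReal.mul_bdd (c := 1) hmeas (Eventually.of_forall fun x => (hexp u x).le)
  have i2 : Integrable fun x : ℝ => (f (x + h) : ℂ) * Complex.exp (u * x * Complex.I) :=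
    hi'.ofReal.mul_bdd (c := 1) hmeas (Eventually.of_forall fun x => (hexp u x).le)
  have e1 : charFun (densityLaw f) u = -∫ x : ℝ, (f (x + h) : ℂ) * Complex.exp (u * x * Complex.I) := by
    rw [hf.charFun_eq, ← integral_neg,
      ← integral_add_right_eq_self (fun x : ℝ => (f x : ℂ) * Complex.exp (u * x * Complex.I)) h]
    refine integral_congr_ae (Eventually.of_forall fun x => ?_)
    have : (u * ((x + h : ℝ) : ℂ) * Complex.I : ℂ) = u * x * Complex.I + Real.pi * Complex.I := by
      have hu' : (u : ℂ) ≠ 0 := by exact_mod_cast hu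
      rw [hh]
      push_cast
      field_simp
    simp only [this, Complex.exp_add, Complex.exp_pi_mul_I]
    ring
  have e2 : (2 : ℂ) * charFun (densityLaw f) u =
      ∫ x : ℝ, ((f x - f (x + h) : ℝ) : ℂ) * Complex.exp (u * x * Complex.I) := by
    rw [two_mul]
    nth_rewrite 2 [e1]
    rw [hf.charFun_eq, ← sub_eq_add_neg, ← integral_sub i1 i2]
    refine integral_congr_ae (Eventually.of_forall fun x => ?_)
    simp only [Complex.ofReal_sub]
    ring
  have e3 : 2 * ‖charFun (densityLaw f) u‖ ≤ 3 * (h * f 0) := by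
    have : 2 * ‖charFun (densityLaw f) u‖ = ‖(2 : ℂ) * charFun (densityLaw f) u‖ := by simp
    rw [this, e2]
    refine (norm_integral_le_integral_norm _).trans ?_
    simp only [norm_mul, hexp, mul_one, Complex.norm_real, Real.norm_eq_abs]
    exact hf.integral_abs_sub_translate_le hhpos
  rw [abs_of_pos hpos]
  have e4 : 3 * Real.pi * f 0 / u = 3 * (h * f 0) := by rw [hh]; ring
  rw [e4]
  have := norm_nonneg (charFun (densityLaw f) u)
  linarith

/-- A bound that holds at all frequencies at once and is stable under taking products. -/
lemma norm_charFun_le_exp_log (hf : IsStepDensity f) :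
    ∃ κ : ℝ, 0 < κ ∧ ∀ u : ℝ, ‖charFun (densityLaw f) u‖ ≤ Real.exp (-κ * Real.log (1 + u ^ 2)) := by
  obtain ⟨c, hc0, hc1, hc⟩ := hf.exists_norm_charFun_le_one_sub
  set C := 3 * Real.pi * f 0 with hC
  have hCpos : 0 < C := by have := hf.zero_pos; positivity
  set b := max (C ^ 2) 2 with hb
  have hb2 : 2 ≤ b := le_max_right _ _
  have hlogb : 0 < Real.log (1 + b ^ 2) := Real.log_pos (by nlinarith)
  refine ⟨min c (min (1 / 8) (c / Real.log (1 + b ^ 2))), by positivity, fun u => ?_⟩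
  set κ := min c (min (1 / 8) (c / Real.log (1 + b ^ 2))) with hκ
  have k1 : κ ≤ c := min_le_left _ _
  have k2 : κ ≤ 1 / 8 := (min_le_right _ _).trans (min_le_left _ _)
  have k3 : κ ≤ c / Real.log (1 + b ^ 2) := (min_le_right _ _).trans (min_le_right _ _)
  have hlog0 : 0 ≤ Real.log (1 + u ^ 2) := Real.log_nonneg (by nlinarith [sq_nonneg u])
  rcases le_total |u| 1 with h1 | h1
  · refine ((hc u).1 h1).trans ?_
    have h2 : Real.log (1 + u ^ 2) ≤ u ^ 2 := by
      have := Real.log_le_sub_one_of_pos (x := 1 + u ^ 2) (by positivity)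
      linarith
    have h3 := Real.add_one_le_exp (-κ * Real.log (1 + u ^ 2))
    have h4 : κ * Real.log (1 + u ^ 2) ≤ c * u ^ 2 := mul_le_mul k1 h2 hlog0 hc0.le
    linarith
  · rcases le_total |u| b with h2 | h2
    · refine ((hc u).2 h1).trans ?_
      have h3 := Real.add_one_le_exp (-κ * Real.log (1 + u ^ 2))
      have h4 : Real.log (1 + u ^ 2) ≤ Real.log (1 + b ^ 2) := by
        refine Real.log_le_log (by positivity) ?_
        have : u ^ 2 ≤ b ^ 2 := by rw [← sq_abs u]; gcongr
        linarith
      have h5 : κ * Real.log (1 + u ^ 2) ≤ c / Real.log (1 + b ^ 2) * Real.log (1 + b ^ 2) :=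
        mul_le_mul k3 h4 hlog0 (by positivity)
      rw [div_mul_cancel₀ _ hlogb.ne'] at h5
      linarith
    · have hu0 : u ≠ 0 := by rintro rfl; simp at h1; linarith
      have hupos : 0 < |u| := abs_pos.2 hu0
      refine (hf.norm_charFun_le_div hu0).trans ?_
      rw [← hC]
      have h3 : C ≤ Real.sqrt |u| := Real.le_sqrt_of_sq_le ((le_max_left _ _).trans h2)
      have h4 : C / |u| ≤ (Real.sqrt |u|)⁻¹ := by
        rw [div_le_iff₀ hupos]
        have h5 : 0 < Real.sqrt |u| := Real.sqrt_pos.2 hupos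
        have h6 : (Real.sqrt |u|)⁻¹ * |u| = Real.sqrt |u| := by
          nth_rewrite 2 [← Real.mul_self_sqrt hupos.le]
          field_simp
        rwa [h6]
      refine h4.trans ?_
      rw [Real.sqrt_eq_rpow, ← Real.rpow_neg hupos.le, Real.rpow_def_of_pos hupos,
        Real.exp_le_exp]
      have h5 : Real.log (1 + u ^ 2) ≤ 4 * Real.log |u| := by
        have : (4 : ℝ) * Real.log |u| = Real.log (|u| ^ 4) := by rw [Real.log_pow]; norm_num
        rw [this]
        refine Real.log_le_log (by positivity) ?_
        have h6 : 2 ≤ |u| := hb2.trans h2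
        have h7 : |u| ^ 4 = u ^ 2 * u ^ 2 := by rw [← sq_abs u]; ring
        have h8 : 4 ≤ u ^ 2 := by rw [← sq_abs u]; nlinarith
        rw [h7]
        nlinarith
      have h9 : 0 ≤ Real.log |u| := Real.log_nonneg h1
      have h10 : κ * Real.log (1 + u ^ 2) ≤ 1 / 8 * (4 * Real.log |u|) :=
        mul_le_mul k2 h5 hlog0 (by norm_num)
      linarith

/-- Second order expansion of the characteristic function, in exponential form. -/
lemma norm_charFun_sub_exp_le (hf : IsStepDensity f) :
    ∃ C : ℝ, 0 ≤ C ∧ ∀ u : ℝ, |u| ≤ 1 →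
      ‖charFun (densityLaw f) u -
        ((Real.exp (-(∫ x, x ^ 2 ∂(densityLaw f)) * u ^ 2 / 2) : ℝ) : ℂ)‖ ≤ C * |u| ^ 3 := by
  have hprob := hf.isProbabilityMeasure
  set μ := densityLaw f with hμ
  set v := ∫ x, x ^ 2 ∂μ with hv
  have hv0 : 0 < v := hf.integral_sq_pos
  set M := ∫ x, |x| ^ 3 ∂μ with hM
  have hM0 : 0 ≤ M := integral_nonneg fun x => by positivity
  have hi1 : Integrable (fun x : ℝ => x) μ := by simpa using hf.integrable_pow 1
  have hi2 := hf.integrable_pow 2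
  have hi3 : Integrable (fun x => |x| ^ 3) μ := by
    have := (hf.integrable_pow 3).abs
    simpa [abs_pow] using this
  have htaylor : ∀ y : ℝ, ‖Complex.exp (y * Complex.I) - (1 + y * Complex.I - y ^ 2 / 2)‖ ≤
      4 * |y| ^ 3 := by
    intro y
    have hy : ‖(y * Complex.I : ℂ)‖ = |y| := by simp
    rcases le_total |y| 1 with h | h
    · have := Complex.exp_bound (x := y * Complex.I) (by rwa [hy]) (n := 3) (by norm_num)
      rw [hy] at this
      have e : ∑ m ∈ Finset.range 3, (y * Complex.I : ℂ) ^ m / (m.factorial : ℂ) =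
          1 + y * Complex.I - y ^ 2 / 2 := by
        simp [Finset.sum_range_succ, Nat.factorial, mul_pow]
        ring
      rw [e] at this
      refine this.trans ?_
      have h3 : 0 ≤ |y| ^ 3 := by positivity
      norm_num [Nat.factorial]
      linarith
    · have h1 : ‖Complex.exp (y * Complex.I)‖ = 1 := Complex.norm_exp_ofReal_mul_I y
      have h2 : ‖(1 + y * Complex.I - y ^ 2 / 2 : ℂ)‖ ≤ 1 + |y| + |y| ^ 2 / 2 := by
        refine (norm_sub_le _ _).trans (add_le_add ((norm_add_le _ _).trans ?_) ?_)
        · rw [hy]; simp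
        · simp
      refine (norm_sub_le _ _).trans ?_
      have h3 : |y| ≤ |y| ^ 3 := le_self_pow₀ h (by norm_num)
      have h4 : |y| ^ 2 ≤ |y| ^ 3 := pow_le_pow_right₀ h (by norm_num)
      linarith
  refine ⟨4 * M + v ^ 2, by positivity, fun u hu => ?_⟩
  have hexpi : Integrable (fun x : ℝ => Complex.exp (u * x * Complex.I)) μ := by
    refine Integrable.of_bound (C := 1)
      (by fun_prop : Continuous fun x : ℝ => Complex.exp (u * x * Complex.I)).aestronglyMeasurable
      (Eventually.of_forall fun x => ?_)
    rw [← Complex.ofReal_mul, Complex.norm_exp_ofReal_mul_I]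
  have hpoly : ∫ x : ℝ, (1 + ((u * x : ℝ) : ℂ) * Complex.I - ((u * x : ℝ) : ℂ) ^ 2 / 2) ∂μ =
      ((1 - v * u ^ 2 / 2 : ℝ) : ℂ) := by
    have j1 : Integrable (fun x : ℝ => ((u * x : ℝ) : ℂ) * Complex.I) μ :=
      (hi1.const_mul u).ofReal.mul_const _
    have j2 : Integrable (fun x : ℝ => ((u * x : ℝ) : ℂ) ^ 2 / 2) μ := by
      have := ((hi2.const_mul (u ^ 2 / 2)).ofReal (𝕜 := ℂ))
      refine this.congr (Eventually.of_forall fun x => ?_)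
      simp; ring
    have j0 : Integrable (fun x : ℝ => 1 + ((u * x : ℝ) : ℂ) * Complex.I) μ :=
      (integrable_const _).add j1
    rw [integral_sub j0 j2, integral_add (integrable_const _) j1, integral_mul_const, integral_complex_ofReal, integral_const_mul]
    have k1 : ∫ x : ℝ, x ∂μ = 0 := hf.integral_odd (g := fun x => x) fun x => rfl
    have k2 : ∫ x : ℝ, ((u * x : ℝ) : ℂ) ^ 2 / 2 ∂μ = ((v * u ^ 2 / 2 : ℝ) : ℂ) := by
      have : ∀ x : ℝ, ((u * x : ℝ) : ℂ) ^ 2 / 2 = ((u ^ 2 / 2 * x ^ 2 : ℝ) : ℂ) := fun x => by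
        push_cast; ring
      simp_rw [this]
      rw [integral_complex_ofReal, integral_const_mul, ← hv]
      push_cast; ring
    rw [k1, k2]
    simp
  have h1 : ‖charFun μ u - ((1 - v * u ^ 2 / 2 : ℝ) : ℂ)‖ ≤ 4 * M * |u| ^ 3 := by
    rw [charFun_apply_real, ← hpoly, ← integral_sub hexpi]
    · refine (norm_integral_le_integral_norm _).trans ?_
      rw [hM, ← integral_const_mul, ← integral_mul_const]
      refine integral_mono_of_nonneg (Eventually.of_forall fun x => norm_nonneg _)
        ((hi3.const_mul _).mul_const _) (Eventually.of_forall fun x => ?_)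
      have := htaylor (u * x)
      have e : 4 * |u * x| ^ 3 = 4 * |x| ^ 3 * |u| ^ 3 := by rw [abs_mul]; ring
      rw [e] at this
      simpa only [Complex.ofReal_mul] using this
    · by_contra hcon
      rw [integral_undef hcon] at hpoly
      have h0 : ((1 - v * u ^ 2 / 2 : ℝ) : ℂ) = 0 := hpoly.symm
      exact hcon (((integrable_const _).add ((hi1.const_mul u).ofReal.mul_const _)).sub (by
        have := ((hi2.const_mul (u ^ 2 / 2)).ofReal (𝕜 := ℂ))
        refine this.congr (Eventually.of_forall fun x => ?_)
        simp; ring))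
  have h2 : |1 - v * u ^ 2 / 2 - Real.exp (-v * u ^ 2 / 2)| ≤ v ^ 2 * |u| ^ 3 := by
    set w := v * u ^ 2 / 2 with hw
    have hw0 : 0 ≤ w := by positivity
    have e1 : -v * u ^ 2 / 2 = -w := by rw [hw]; ring
    have e2 := Real.add_one_le_exp (-w)
    have e3 : Real.exp (-w) ≤ 1 - w + w ^ 2 := by
      have h1 := Real.add_one_le_exp w
      have h2 : Real.exp (-w) * Real.exp w = 1 := by rw [← Real.exp_add]; simp
      have h3 : Real.exp (-w) * (w + 1) ≤ 1 :=
        (mul_le_mul_of_nonneg_left h1 (Real.exp_pos _).le).trans_eq h2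
      have h4 : 1 ≤ (1 - w + w ^ 2) * (w + 1) := by nlinarith [pow_nonneg hw0 3]
      exact le_of_mul_le_mul_right (h3.trans h4) (by linarith)
    have e4 : w ^ 2 ≤ v ^ 2 * |u| ^ 3 := by
      have h5 : |u| ^ 4 ≤ |u| ^ 3 := pow_le_pow_of_le_one (abs_nonneg u) hu (by norm_num)
      have h6 : w ^ 2 = v ^ 2 * |u| ^ 4 / 4 := by
        rw [hw, show |u| ^ 4 = (|u| ^ 2) ^ 2 by ring, sq_abs]; ring
      have h7 := mul_le_mul_of_nonneg_left h5 (sq_nonneg v)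
      have h8 : 0 ≤ v ^ 2 * |u| ^ 4 := by positivity
      rw [h6]
      linarith
    rw [e1, abs_sub_comm, abs_le]
    constructor <;> linarith [sq_nonneg w]
  have h3 : charFun μ u - ((Real.exp (-v * u ^ 2 / 2) : ℝ) : ℂ) =
      (charFun μ u - ((1 - v * u ^ 2 / 2 : ℝ) : ℂ)) +
        ((1 - v * u ^ 2 / 2 - Real.exp (-v * u ^ 2 / 2) : ℝ) : ℂ) := by
    push_cast; ring
  rw [h3]
  refine (norm_add_le _ _).trans ?_
  rw [Complex.norm_real, Real.norm_eq_abs]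
  linarith

end IsStepDensity

/-! ### Products of characteristic functions -/

lemma norm_prod_sub_prod_le {ι : Type*} (s : Finset ι) (a b : ι → ℂ)
    (ha : ∀ i ∈ s, ‖a i‖ ≤ 1) (hb : ∀ i ∈ s, ‖b i‖ ≤ 1) :
    ‖∏ i ∈ s, a i - ∏ i ∈ s, b i‖ ≤ ∑ i ∈ s, ‖a i - b i‖ := by
  classical
  induction s using Finset.induction_on with
  | empty => simp
  | insert i s hi ih =>
    rw [Finset.prod_insert hi, Finset.prod_insert hi, Finset.sum_insert hi]
    have h1 : a i * ∏ i ∈ s, a i - b i * ∏ i ∈ s, b i =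
        (a i - b i) * ∏ i ∈ s, a i + b i * (∏ i ∈ s, a i - ∏ i ∈ s, b i) := by ring
    have h2 : ‖∏ i ∈ s, a i‖ ≤ 1 := by
      rw [norm_prod]
      exact Finset.prod_le_one (fun _ _ => norm_nonneg _)
        fun j hj => ha j (Finset.mem_insert_of_mem hj)
    have h3 := ih (fun j hj => ha j (Finset.mem_insert_of_mem hj))
      (fun j hj => hb j (Finset.mem_insert_of_mem hj))
    rw [h1]
    refine (norm_add_le _ _).trans (add_le_add ?_ ?_)
    · rw [norm_mul]
      exact mul_le_of_le_one_right (norm_nonneg _) h2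
    · rw [norm_mul]
      exact (mul_le_of_le_one_left (norm_nonneg _) (hb i (Finset.mem_insert_self _ _))).trans h3

lemma prod_Ico_two_mul {M : Type*} [CommMonoid M] (g : ℕ → M) (b q : ℕ) :
    ∏ j ∈ Finset.Ico b (b + 2 * q), g j =
      ∏ i ∈ Finset.range q, (g (b + i) * g (b + q + i)) := by
  rw [Finset.prod_Ico_eq_prod_range, Nat.add_sub_cancel_left, two_mul, Finset.prod_range_add,
    Finset.prod_mul_distrib]
  simp [add_assoc]

/-- Of two values of an affine function at points at distance at least `1 / 8` in `[0, 1]`, one is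
comparable with the size of the coefficients. -/
lemma norm_le_max_affine {s t d d' : ℝ} (hd0 : 0 ≤ d) (hd1 : d ≤ 1) (hdd : 1 / 8 ≤ d - d') :
    ‖(s, t)‖ ≤ 17 * max |s + t * d| |s + t * d'| := by
  set m := max |s + t * d| |s + t * d'| with hm
  have h1 : |s + t * d| ≤ m := le_max_left _ _
  have h2 : |s + t * d'| ≤ m := le_max_right _ _
  have h3 : |t| ≤ 16 * m := by
    have e : t * (d - d') = (s + t * d) - (s + t * d') := by ring
    have h4 : |t * (d - d')| ≤ m + m := by
      rw [e]
      exact (abs_sub _ _).trans (add_le_add h1 h2)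
    rw [abs_mul, abs_of_nonneg (by linarith : (0 : ℝ) ≤ d - d')] at h4
    nlinarith [abs_nonneg t]
  have h4 : |s| ≤ 17 * m := by
    have e : s = (s + t * d) - t * d := by ring
    have h5 : |t * d| ≤ |t| := by
      rw [abs_mul, abs_of_nonneg hd0]
      exact mul_le_of_le_one_right (abs_nonneg t) hd1
    have h6 : |s| ≤ |s + t * d| + |t * d| := by
      nth_rewrite 1 [e]
      exact abs_sub _ _
    linarith
  rw [Prod.norm_def]
  refine max_le h4 (h3.trans ?_)
  have : 0 ≤ m := (abs_nonneg _).trans h1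
  linarith

namespace IsStepDensity

variable {f : ℝ → ℝ}

lemma norm_charFun_le_one (hf : IsStepDensity f) (u : ℝ) : ‖charFun (densityLaw f) u‖ ≤ 1 := by
  have := hf.isProbabilityMeasure
  exact MeasureTheory.norm_charFun_le_one u

/-- Domination of the joint characteristic function of the rescaled sums `∑ X_j` and
`∑ (N - j) X_j`, over any block of indices of length at least `N / 4`, and with a bounded
perturbation `θ` of the coefficients, by an integrable function that does not depend on `N`. The
indices of the block are paired so that, for `‖p‖` large compared with `Θ`, one of the two
coefficients of each pair is comparable with `‖p‖`. -/
lemma exists_prod_charFun_le (hf : IsStepDensity f) {sd : ℝ} (hsd : 0 < sd) {Θ : ℝ} (hΘ : 0 ≤ Θ) :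
    ∃ (C : ℝ) (N₀ : ℕ), 0 < C ∧ ∀ N : ℕ, N₀ ≤ N → ∀ b q : ℕ, b + 2 * q ≤ N → N ≤ 8 * q →
      ∀ θ : ℕ → ℝ, (∀ j, |θ j| ≤ Θ) → ∀ p : ℝ × ℝ,
        ∏ j ∈ Finset.Ico b (b + 2 * q),
          ‖charFun (densityLaw f) ((θ j + (p.1 + p.2 * ((N - j) / N))) / (sd * √N))‖ ≤
            C * (1 + ‖p‖) ^ (-3 : ℝ) := by
  obtain ⟨κ, hκ, hφ⟩ := hf.norm_charFun_le_exp_log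
  set a := κ / (24 * (34 ^ 2 * sd ^ 2)) with ha
  have ha0 : 0 < a := by positivity
  set C₁ := 2 * max 1 a⁻¹ with hC₁
  have hC₁0 : 0 < C₁ := by positivity
  refine ⟨C₁ ^ 3 + (1 + 34 * Θ) ^ 3, ⌈24 / κ⌉₊ + 1, by positivity, ?_⟩
  intro N hN b q hbq hNq θ hθ p
  obtain ⟨s, t⟩ := p
  have hN0 : 0 < N := by omega
  have hNR : (0 : ℝ) < N := by exact_mod_cast hN0
  have hNκ : 1 ≤ κ * N / 24 := by
    have h1 : (24 / κ : ℝ) ≤ N := (Nat.le_ceil _).trans (by exact_mod_cast (by omega))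
    rw [div_le_iff₀ hκ] at h1
    linarith
  set ρ := ‖(s, t)‖ with hρ
  have hρ0 : 0 ≤ ρ := norm_nonneg _
  have hpow : (1 + ρ) ^ (-3 : ℝ) = ((1 + ρ) ^ 3)⁻¹ := by
    rw [Real.rpow_neg (by linarith)]
    norm_cast
  rw [hpow, ← div_eq_mul_inv, le_div_iff₀ (by positivity)]
  have hprod0 : 0 ≤ ∏ j ∈ Finset.Ico b (b + 2 * q),
      ‖charFun (densityLaw f) ((θ j + (s + t * ((N - j) / N))) / (sd * √N))‖ :=
    Finset.prod_nonneg fun _ _ => norm_nonneg _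
  -- the perturbation matters only for `‖p‖ < 34 Θ`, where the trivial bound suffices
  rcases lt_or_ge ρ (34 * Θ) with hlt | hge
  · have h1 : ∏ j ∈ Finset.Ico b (b + 2 * q),
        ‖charFun (densityLaw f) ((θ j + (s + t * ((N - j) / N))) / (sd * √N))‖ ≤ 1 :=
      Finset.prod_le_one (fun _ _ => norm_nonneg _) fun _ _ => hf.norm_charFun_le_one _
    have h2 : (1 + ρ) ^ 3 ≤ (1 + 34 * Θ) ^ 3 := by gcongr
    have h3 : 0 ≤ C₁ ^ 3 := by positivity
    have h4 : 0 ≤ (1 + ρ) ^ 3 := by positivity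
    nlinarith
  · set x := ρ ^ 2 / (34 ^ 2 * sd ^ 2) with hx
    have hx0 : 0 ≤ x := by positivity
    set E := Real.exp (-κ * Real.log (1 + x / N)) with hE
    have hpair : ∀ i ∈ Finset.range q,
        ‖charFun (densityLaw f) ((θ (b + i) + (s + t * ((N - (b + i : ℕ)) / N))) / (sd * √N))‖ *
        ‖charFun (densityLaw f) ((θ (b + q + i) + (s + t * ((N - (b + q + i : ℕ)) / N))) /
          (sd * √N))‖ ≤ E := by
      intro i hi
      have hi' : i < q := Finset.mem_range.1 hi
      have hle : ∀ (j : ℕ), ρ ≤ 17 * |s + t * ((N - j) / N)| →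
          ‖charFun (densityLaw f) ((θ j + (s + t * ((N - j) / N))) / (sd * √N))‖ ≤ E := by
        intro j hj
        refine (hφ _).trans (Real.exp_le_exp.2 ?_)
        rw [neg_mul, neg_mul, neg_le_neg_iff]
        refine mul_le_mul_of_nonneg_left (Real.log_le_log (by positivity) ?_) hκ.le
        rw [div_pow, mul_pow, Real.sq_sqrt hNR.le, hx, div_div, add_le_add_iff_left,
          div_le_div_iff₀ (by positivity) (by positivity)]
        have h1 : ρ / 34 ≤ |θ j + (s + t * ((N - j) / N))| := by
          have h2 := abs_sub_abs_le_abs_sub (s + t * ((N - j) / N)) (-θ j)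
          rw [abs_neg, sub_neg_eq_add, add_comm _ (θ j)] at h2
          have := hθ j
          linarith
        have h2 : (ρ / 34) ^ 2 ≤ (θ j + (s + t * ((N - j) / N))) ^ 2 := by
          rw [← sq_abs (θ j + _)]
          gcongr
        have h3 : 0 < sd ^ 2 * (N : ℝ) := by positivity
        have h4 := mul_le_mul_of_nonneg_right h2 (mul_pos h3 (by norm_num : (0 : ℝ) < 34 ^ 2)).le
        linarith
      have hmax := norm_le_max_affine (s := s) (t := t) (d := (N - (b + i : ℕ)) / N)
        (d' := (N - (b + q + i : ℕ)) / N)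
        (div_nonneg (sub_nonneg.2 (by exact_mod_cast (by omega))) hNR.le)
        ((div_le_one hNR).2 (by
          have : (0 : ℝ) ≤ ((b + i : ℕ) : ℝ) := Nat.cast_nonneg _
          linarith))
        (by
          rw [← sub_div, le_div_iff₀ hNR]
          have : (N : ℝ) ≤ 8 * q := by exact_mod_cast hNq
          push_cast
          linarith)
      rcases le_total |s + t * ((N - (b + i : ℕ)) / N)| |s + t * ((N - (b + q + i : ℕ)) / N)|
        with h | h
      · rw [max_eq_right h] at hmax
        exact (mul_le_of_le_one_left (norm_nonneg _) (hf.norm_charFun_le_one _)).trans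
          (hle _ hmax)
      · rw [max_eq_left h] at hmax
        exact (mul_le_of_le_one_right (norm_nonneg _) (hf.norm_charFun_le_one _)).trans
          (hle _ hmax)
    have hprod : ∏ j ∈ Finset.Ico b (b + 2 * q),
        ‖charFun (densityLaw f) ((θ j + (s + t * ((N - j) / N))) / (sd * √N))‖ ≤ E ^ q := by
      rw [prod_Ico_two_mul]
      refine (Finset.prod_le_prod (fun _ _ => by positivity) hpair).trans ?_
      simp
    -- Bernoulli: `(1 + x / N) ^ (κ N / 24) ≥ 1 + κ x / 24`, as soon as `κ N / 24 ≥ 1`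
    have hEq : E ^ q ≤ ((1 + a * ρ ^ 2) ^ 3)⁻¹ := by
      have hb := one_add_mul_self_le_rpow_one_add (s := x / N)
        (by have : 0 ≤ x / N := by positivity
            linarith) hNκ
      have e1 : κ * N / 24 * (x / N) = a * ρ ^ 2 := by
        rw [hx, ha]; field_simp
      rw [e1] at hb
      have hl0 : 0 ≤ Real.log (1 + x / N) := Real.log_nonneg (by
        have : 0 ≤ x / N := by positivity
        linarith)
      have hlog : Real.log (1 + a * ρ ^ 2) ≤ κ * N / 24 * Real.log (1 + x / N) := by
        rw [← Real.log_rpow (by positivity)]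
        exact Real.log_le_log (by positivity) hb
      have e2 : ((1 + a * ρ ^ 2) ^ 3)⁻¹ = Real.exp (-(3 * Real.log (1 + a * ρ ^ 2))) := by
        rw [Real.exp_neg, show (3 : ℝ) * Real.log (1 + a * ρ ^ 2) =
          Real.log ((1 + a * ρ ^ 2) ^ 3) by rw [Real.log_pow]; norm_num,
          Real.exp_log (by positivity)]
      rw [e2, hE, ← Real.exp_nat_mul, Real.exp_le_exp]
      have hq8 : (N : ℝ) ≤ 8 * q := by exact_mod_cast hNq
      have h1 : κ * N / 8 * Real.log (1 + x / N) ≤ κ * q * Real.log (1 + x / N) := by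
        refine mul_le_mul_of_nonneg_right ?_ hl0
        nlinarith
      linarith
    have hC : 1 + ρ ≤ C₁ * (1 + a * ρ ^ 2) := by
      have h1 : 1 + ρ ≤ 2 * (1 + ρ ^ 2) := by nlinarith [sq_nonneg (ρ - 1)]
      have h2 : 1 + ρ ^ 2 ≤ max 1 a⁻¹ * (1 + a * ρ ^ 2) := by
        have h3 : (1 : ℝ) ≤ max 1 a⁻¹ := le_max_left _ _
        have h4 : 1 ≤ max 1 a⁻¹ * a := by
          have := mul_le_mul_of_nonneg_right (le_max_right 1 a⁻¹) ha0.le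
          rwa [inv_mul_cancel₀ ha0.ne'] at this
        nlinarith [sq_nonneg ρ]
      rw [hC₁]
      linarith
    have hC3 : (1 + ρ) ^ 3 ≤ C₁ ^ 3 * (1 + a * ρ ^ 2) ^ 3 := by
      rw [← mul_pow]
      gcongr
    have hpos : 0 < (1 + a * ρ ^ 2) ^ 3 := by positivity
    have h5 := mul_le_mul (hprod.trans hEq) hC3 (by positivity) (by positivity)
    have h6 : ((1 + a * ρ ^ 2) ^ 3)⁻¹ * (C₁ ^ 3 * (1 + a * ρ ^ 2) ^ 3) = C₁ ^ 3 := by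
      field_simp
    rw [h6] at h5
    have h7 : 0 ≤ (1 + 34 * Θ) ^ 3 := by positivity
    linarith

/-- The central limit theorem for triangular arrays of bounded coefficients, at the level of
characteristic functions. -/
lemma tendsto_prod_charFun (hf : IsStepDensity f) {ι : Type*} {l : Filter ι} {N : ι → ℕ}
    (hN : Tendsto N l atTop) {h : ι → ℕ → ℝ} {H : ℝ} (hH : ∀ i j, |h i j| ≤ H) {v : ℝ}
    (hv : Tendsto (fun i => (∑ j ∈ Finset.range (N i), h i j ^ 2) / N i) l (𝓝 v)) :
    Tendsto (fun i => ∏ j ∈ Finset.range (N i),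
      charFun (densityLaw f) (h i j / (√(∫ x, x ^ 2 ∂(densityLaw f)) * √(N i)))) l
      (𝓝 ((Real.exp (-v / 2) : ℝ) : ℂ)) := by
  obtain ⟨C, hC0, hC⟩ := hf.norm_charFun_sub_exp_le
  set w := ∫ x, x ^ 2 ∂(densityLaw f) with hw
  have hw0 : 0 < w := hf.integral_sq_pos
  have hNR : Tendsto (fun i => √(N i : ℝ)) l atTop :=
    Real.tendsto_sqrt_atTop.comp (tendsto_natCast_atTop_atTop.comp hN)
  have hlim : Tendsto (fun i => ((Real.exp (-((∑ j ∈ Finset.range (N i), h i j ^ 2) / N i) / 2) :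
      ℝ) : ℂ)) l (𝓝 ((Real.exp (-v / 2) : ℝ) : ℂ)) :=
    (Complex.continuous_ofReal.tendsto _).comp
      ((Real.continuous_exp.tendsto _).comp ((hv.neg).div_const 2))
  have hdiff : Tendsto (fun i => (∏ j ∈ Finset.range (N i),
      charFun (densityLaw f) (h i j / (√w * √(N i)))) -
      ((Real.exp (-((∑ j ∈ Finset.range (N i), h i j ^ 2) / N i) / 2) : ℝ) : ℂ)) l (𝓝 0) := by
    have hbd : Tendsto (fun i => C * (|H| / √w) ^ 3 * (√(N i : ℝ))⁻¹) l (𝓝 0) := by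
      have := (tendsto_inv_atTop_zero.comp hNR).const_mul (C * (|H| / √w) ^ 3)
      simpa using this
    refine squeeze_zero_norm' ?_ hbd
    have hev : ∀ᶠ i in l, |H| / √w + 1 ≤ √(N i : ℝ) := hNR.eventually_ge_atTop _
    filter_upwards [hev] with i hi
    have hsN : 0 < √(N i : ℝ) := lt_of_lt_of_le (by positivity) hi
    have hsw : 0 < √w := Real.sqrt_pos.2 hw0
    have hNi : (0 : ℝ) < N i := Real.sqrt_pos.1 hsN
    have e1 : ((Real.exp (-((∑ j ∈ Finset.range (N i), h i j ^ 2) / N i) / 2) : ℝ) : ℂ) =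
        ∏ j ∈ Finset.range (N i),
          ((Real.exp (-w * (h i j / (√w * √(N i))) ^ 2 / 2) : ℝ) : ℂ) := by
      rw [← Complex.ofReal_prod, ← Real.exp_sum]
      congr 2
      rw [← Finset.sum_div, ← Finset.mul_sum]
      simp_rw [div_pow, mul_pow, Real.sq_sqrt hw0.le, Real.sq_sqrt hNi.le]
      rw [← Finset.sum_div]
      field_simp
    have hu : ∀ j, |h i j / (√w * √(N i))| ≤ |H| / √w / √(N i) := by
      intro j
      rw [abs_div, abs_of_pos (mul_pos hsw hsN), div_div]
      exact div_le_div_of_nonneg_right ((hH i j).trans (le_abs_self H)) (mul_pos hsw hsN).le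
    have hu1 : ∀ j, |h i j / (√w * √(N i))| ≤ 1 := fun j =>
      (hu j).trans ((div_le_one hsN).2 (by linarith))
    rw [e1]
    refine (norm_prod_sub_prod_le _ _ _ (fun j _ => hf.norm_charFun_le_one _) fun j _ => ?_).trans ?_
    · rw [Complex.norm_real, Real.norm_eq_abs, Real.abs_exp, Real.exp_le_one_iff]
      have : 0 ≤ w * (h i j / (√w * √(N i))) ^ 2 := by positivity
      linarith
    · have hterm : ∀ j ∈ Finset.range (N i), ‖charFun (densityLaw f) (h i j / (√w * √(N i))) -
          ((Real.exp (-w * (h i j / (√w * √(N i))) ^ 2 / 2) : ℝ) : ℂ)‖ ≤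
          C * (|H| / √w / √(N i)) ^ 3 := fun j _ =>
        (hC _ (hu1 j)).trans (by have := hu j; gcongr)
      refine (Finset.sum_le_sum hterm).trans (le_of_eq ?_)
      rw [Finset.sum_const, Finset.card_range, nsmul_eq_mul]
      have : (N i : ℝ) = √(N i : ℝ) ^ 2 := (Real.sq_sqrt hNi.le).symm
      nth_rewrite 1 [this]
      field_simp
  have := hdiff.add hlim
  simpa using this

end IsStepDensity

/-! ### Solving for the last two steps of the walk -/

lemma walk_congr {a : ℝ} {x y : ℕ → ℝ} {n : ℕ} (h : ∀ i < n, x i = y i) :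
    walk a x n = walk a y n := by
  unfold walk
  rw [Finset.sum_congr rfl fun i hi => h i (Finset.mem_range.1 hi)]

lemma integratedWalk_congr {a b : ℝ} {x y : ℕ → ℝ} {n : ℕ} (h : ∀ i < n, x i = y i) :
    integratedWalk a b x n = integratedWalk a b y n := by
  unfold integratedWalk
  rw [Finset.sum_congr rfl fun k hk => walk_congr fun i hi => h i (by
    have := Finset.mem_range.1 hk
    omega)]

lemma walk_succ (a : ℝ) (x : ℕ → ℝ) (n : ℕ) : walk a x (n + 1) = walk a x n + x n := by
  simp [walk, Finset.sum_range_succ, add_assoc]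

lemma integratedWalk_succ (a b : ℝ) (x : ℕ → ℝ) (n : ℕ) :
    integratedWalk a b x (n + 1) = integratedWalk a b x n + walk a x (n + 1) := by
  simp [integratedWalk, Finset.sum_range_succ, add_assoc]

@[fun_prop]
lemma continuous_walk (a : ℝ) (n : ℕ) : Continuous fun x : ℕ → ℝ => walk a x n := by
  unfold walk; fun_prop

@[fun_prop]
lemma continuous_integratedWalk (a b : ℝ) (n : ℕ) :
    Continuous fun x : ℕ → ℝ => integratedWalk a b x n := by
  unfold integratedWalk; fun_prop

/-- The sequence `x` with the entries `m` and `m + 1` replaced by `u` and `v`. -/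
def replaceTwo (m : ℕ) (x : ℕ → ℝ) (u v : ℝ) : ℕ → ℝ :=
  Function.update (Function.update x m u) (m + 1) v

lemma replaceTwo_of_lt {m i : ℕ} (hi : i < m) (x : ℕ → ℝ) (u v : ℝ) :
    replaceTwo m x u v i = x i := by
  simp [replaceTwo, Function.update_of_ne (by omega : i ≠ m + 1),
    Function.update_of_ne (by omega : i ≠ m)]

@[simp] lemma replaceTwo_self (m : ℕ) (x : ℕ → ℝ) (u v : ℝ) : replaceTwo m x u v m = u := by
  simp [replaceTwo]

@[simp] lemma replaceTwo_succ (m : ℕ) (x : ℕ → ℝ) (u v : ℝ) :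
    replaceTwo m x u v (m + 1) = v := by
  simp [replaceTwo]

lemma continuous_replaceTwo (m : ℕ) :
    Continuous fun p : (ℕ → ℝ) × ℝ × ℝ => replaceTwo m p.1 p.2.1 p.2.2 := by
  unfold replaceTwo
  exact (continuous_fst.update m (continuous_fst.comp continuous_snd)).update (m + 1)
    (continuous_snd.comp continuous_snd)

lemma walk_replaceTwo (a : ℝ) (m : ℕ) (x : ℕ → ℝ) (u v : ℝ) :
    walk a (replaceTwo m x u v) (m + 2) = walk a x m + u + v := by
  rw [walk_succ, walk_succ, replaceTwo_self, replaceTwo_succ,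
    walk_congr fun i hi => replaceTwo_of_lt hi x u v]

lemma integratedWalk_replaceTwo (a b : ℝ) (m : ℕ) (x : ℕ → ℝ) (u v : ℝ) :
    integratedWalk a b (replaceTwo m x u v) (m + 2) =
      integratedWalk a b x m + 2 * walk a x m + 2 * u + v := by
  rw [integratedWalk_succ, integratedWalk_succ, walk_replaceTwo, walk_succ, replaceTwo_self,
    walk_congr fun i hi => replaceTwo_of_lt hi x u v,
    integratedWalk_congr fun i hi => replaceTwo_of_lt hi x u v]
  ring

/-- The terminal value `(Y_N, Z_N)`. -/
def endpoint (a b : ℝ) (N : ℕ) (x : ℕ → ℝ) : ℝ × ℝ :=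
  (walk a x N, integratedWalk a b x N)

@[fun_prop]
lemma continuous_endpoint (a b : ℝ) (N : ℕ) : Continuous (endpoint a b N) := by
  unfold endpoint; fun_prop

/-- The step `m` forced by the steps before it if the walk is to be at `t` at time `m + 2`. -/
def forcedStep (a b : ℝ) (m : ℕ) (t : ℝ × ℝ) (x : ℕ → ℝ) : ℝ :=
  t.2 - integratedWalk a b x m - walk a x m - t.1

/-- The step `m + 1` forced by the steps before `m` if the walk is to be at `t` at time `m + 2`. -/
def forcedStep' (a b : ℝ) (m : ℕ) (t : ℝ × ℝ) (x : ℕ → ℝ) : ℝ :=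
  t.1 - walk a x m - forcedStep a b m t x

/-- The sequence of steps with the entries `m` and `m + 1` changed so that the walk is at `t` at
time `m + 2`. -/
def closeUp (a b : ℝ) (m : ℕ) (t : ℝ × ℝ) (x : ℕ → ℝ) : ℕ → ℝ :=
  replaceTwo m x (forcedStep a b m t x) (forcedStep' a b m t x)

/-- The density of the two forced steps. -/
def closeWeight (f : ℝ → ℝ) (a b : ℝ) (m : ℕ) (t : ℝ × ℝ) (x : ℕ → ℝ) : ℝ :=
  f (forcedStep a b m t x) * f (forcedStep' a b m t x)

lemma continuous_forcedStep (a b : ℝ) (m : ℕ) :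
    Continuous fun p : (ℝ × ℝ) × (ℕ → ℝ) => forcedStep a b m p.1 p.2 := by
  have h1 := (continuous_walk a m).comp (continuous_snd (X := ℝ × ℝ) (Y := ℕ → ℝ))
  have h2 := (continuous_integratedWalk a b m).comp (continuous_snd (X := ℝ × ℝ) (Y := ℕ → ℝ))
  unfold forcedStep
  simp only [Function.comp_def] at h1 h2
  fun_prop

lemma continuous_forcedStep' (a b : ℝ) (m : ℕ) :
    Continuous fun p : (ℝ × ℝ) × (ℕ → ℝ) => forcedStep' a b m p.1 p.2 := by
  have h1 := (continuous_walk a m).comp (continuous_snd (X := ℝ × ℝ) (Y := ℕ → ℝ))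
  have h2 := continuous_forcedStep a b m
  unfold forcedStep'
  simp only [Function.comp_def] at h1 h2
  fun_prop

lemma continuous_closeUp (a b : ℝ) (m : ℕ) :
    Continuous fun p : (ℝ × ℝ) × (ℕ → ℝ) => closeUp a b m p.1 p.2 :=
  (continuous_replaceTwo m).comp (continuous_snd.prodMk
    ((continuous_forcedStep a b m).prodMk (continuous_forcedStep' a b m)))

lemma continuous_closeWeight {f : ℝ → ℝ} (hf : Continuous f) (a b : ℝ) (m : ℕ) :
    Continuous fun p : (ℝ × ℝ) × (ℕ → ℝ) => closeWeight f a b m p.1 p.2 :=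
  (hf.comp (continuous_forcedStep a b m)).mul (hf.comp (continuous_forcedStep' a b m))

/-! ### Disintegration of the law of the steps with respect to the terminal value -/

/-- Resampling one coordinate does not change an infinite product measure. -/
lemma map_update_infinitePi (μ : Measure ℝ) [IsProbabilityMeasure μ] (k : ℕ) :
    ((Measure.infinitePi fun _ : ℕ => μ).prod μ).map (fun p => Function.update p.1 k p.2) =
      Measure.infinitePi fun _ : ℕ => μ := by
  refine Measure.eq_infinitePi (fun _ : ℕ => μ) fun s t ht => ?_
  have hm : Measurable fun p : (ℕ → ℝ) × ℝ => Function.update p.1 k p.2 := by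
    refine measurable_pi_lambda _ fun i => ?_
    by_cases hi : i = k
    · subst hi; simpa using measurable_snd
    · simpa [Function.update_of_ne hi, Function.comp_def] using
        (measurable_pi_apply i).comp (measurable_fst (α := ℕ → ℝ) (β := ℝ))
  rw [Measure.map_apply hm (MeasurableSet.pi s.countable_toSet fun i _ => ht i)]
  have hpre : (fun p : (ℕ → ℝ) × ℝ => Function.update p.1 k p.2) ⁻¹' (s : Set ℕ).pi t =
      ((s.erase k : Finset ℕ) : Set ℕ).pi t ×ˢ (if k ∈ s then t k else Set.univ) := by
    ext ⟨x, u⟩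
    simp only [Set.mem_preimage, Set.mem_pi, Set.mem_prod, Finset.mem_coe, Finset.mem_erase]
    constructor
    · intro h
      refine ⟨fun i hi => by simpa [Function.update_of_ne hi.1] using h i hi.2, ?_⟩
      split_ifs with hk
      · simpa using h k hk
      · trivial
    · rintro ⟨h1, h2⟩ i hi
      by_cases hik : i = k
      · subst hik
        rw [if_pos hi] at h2
        simpa using h2
      · simpa [Function.update_of_ne hik] using h1 i ⟨hik, hi⟩
  rw [hpre, Measure.prod_prod, Measure.infinitePi_pi _ fun i _ => ht i]
  by_cases hk : k ∈ s
  · rw [if_pos hk, Finset.prod_erase_mul s (fun i => μ (t i)) hk]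
  · rw [if_neg hk, measure_univ, mul_one, Finset.erase_eq_of_notMem hk]

lemma measurable_update_pair (k : ℕ) :
    Measurable fun p : (ℕ → ℝ) × ℝ => Function.update p.1 k p.2 :=
  (continuous_fst.update k continuous_snd).measurable

lemma lintegral_update_infinitePi (μ : Measure ℝ) [IsProbabilityMeasure μ] (k : ℕ)
    {H : (ℕ → ℝ) → ENNReal} (hH : Measurable H) :
    ∫⁻ x, H x ∂(Measure.infinitePi fun _ : ℕ => μ) =
      ∫⁻ x, ∫⁻ u, H (Function.update x k u) ∂μ ∂(Measure.infinitePi fun _ : ℕ => μ) := by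
  have h := lintegral_prod (μ := Measure.infinitePi fun _ : ℕ => μ) (ν := μ)
    (fun p => H (Function.update p.1 k p.2)) (hH.comp (measurable_update_pair k)).aemeasurable
  rw [← h, ← lintegral_map hH (measurable_update_pair k), map_update_infinitePi]

lemma lintegral_replaceTwo_infinitePi (μ : Measure ℝ) [IsProbabilityMeasure μ] (m : ℕ)
    {H : (ℕ → ℝ) → ENNReal} (hH : Measurable H) :
    ∫⁻ x, H x ∂(Measure.infinitePi fun _ : ℕ => μ) =
      ∫⁻ x, ∫⁻ u, ∫⁻ v, H (replaceTwo m x u v) ∂μ ∂μ ∂(Measure.infinitePi fun _ : ℕ => μ) := by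
  rw [lintegral_update_infinitePi μ (m + 1) hH]
  exact lintegral_update_infinitePi μ m
    ((hH.comp (measurable_update_pair (m + 1))).lintegral_prod_right')

section StepsLaw

/-- The law of the steps: independent with density `f`. -/
noncomputable def stepsLaw (f : ℝ → ℝ) [IsProbabilityMeasure (densityLaw f)] : Measure (ℕ → ℝ) :=
  Measure.infinitePi fun _ : ℕ => densityLaw f

instance (f : ℝ → ℝ) [IsProbabilityMeasure (densityLaw f)] :
    IsProbabilityMeasure (stepsLaw f) := by
  unfold stepsLaw; infer_instance

variable {f : ℝ → ℝ}

lemma lintegral_densityLaw (hf : IsStepDensity f) {φ : ℝ → ENNReal} (hφ : Measurable φ) :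
    ∫⁻ u, φ u ∂(densityLaw f) = ∫⁻ u, ENNReal.ofReal (f u) * φ u := by
  rw [densityLaw, lintegral_withDensity_eq_lintegral_mul _
    hf.continuous.measurable.ennreal_ofReal hφ]
  rfl

lemma lintegral_densityLaw_densityLaw (hf : IsStepDensity f) {φ : ℝ × ℝ → ENNReal}
    (hφ : Measurable φ) :
    ∫⁻ u, ∫⁻ v, φ (u, v) ∂(densityLaw f) ∂(densityLaw f) =
      ∫⁻ u, ∫⁻ v, ENNReal.ofReal (f u * f v) * φ (u, v) := by
  have hfm : Measurable fun x => ENNReal.ofReal (f x) := hf.continuous.measurable.ennreal_ofReal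
  have h1 : ∀ u, Measurable fun v => φ (u, v) := fun u => hφ.comp measurable_prodMk_left
  have := hf.isProbabilityMeasure
  rw [lintegral_densityLaw hf hφ.lintegral_prod_right']
  refine lintegral_congr fun u => ?_
  have h2 : Measurable fun v => ENNReal.ofReal (f v) * φ (u, v) := hfm.mul (h1 u)
  rw [lintegral_densityLaw hf (h1 u), ← lintegral_const_mul _ h2]
  refine lintegral_congr fun v => ?_
  rw [ENNReal.ofReal_mul (hf.nonneg u), mul_assoc]

/-- Change of variables for the affine map that sends the last two steps to the terminal value. -/
lemma lintegral_affine_shear (W Z : ℝ) {G : ℝ × ℝ → ENNReal} (hG : Measurable G) :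
    ∫⁻ t, G t = ∫⁻ u : ℝ, ∫⁻ v : ℝ, G (W + u + v, Z + 2 * W + 2 * u + v) := by
  rw [Measure.volume_eq_prod, lintegral_prod _ hG.aemeasurable]
  have e2 : ∀ y : ℝ, ∫⁻ z, G (y, z) = ∫⁻ u, G (y, u + (Z + W + y)) := fun y =>
    (lintegral_add_right_eq_self (fun z => G (y, z)) (Z + W + y)).symm
  simp_rw [e2]
  rw [lintegral_lintegral_swap]
  · refine lintegral_congr fun u => ?_
    rw [← lintegral_add_right_eq_self _ (W + u)]
    refine lintegral_congr fun v => ?_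
    congr 2 <;> ring
  · have : Measurable fun p : ℝ × ℝ => ((p.1, p.2 + (Z + W + p.1)) : ℝ × ℝ) := by fun_prop
    exact (hG.comp this).aemeasurable

variable [IsProbabilityMeasure (densityLaw f)]

/-- Disintegration of the law of the steps over the terminal value: the last two of the `m + 2` steps
are exchanged for the terminal value by an affine map of determinant `-1`. -/
lemma lintegral_endpoint (hf : IsStepDensity f) (a b : ℝ) (m : ℕ)
    {H : (ℝ × ℝ) × (ℕ → ℝ) → ENNReal} (hH : Measurable H) :
    ∫⁻ x, H (endpoint a b (m + 2) x, x) ∂(stepsLaw f) =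
      ∫⁻ t, ∫⁻ x, ENNReal.ofReal (closeWeight f a b m t x) * H (t, closeUp a b m t x)
        ∂(stepsLaw f) := by
  have hW : Measurable fun p : (ℝ × ℝ) × (ℕ → ℝ) => ENNReal.ofReal (closeWeight f a b m p.1 p.2) :=
    (continuous_closeWeight hf.continuous a b m).measurable.ennreal_ofReal
  have hC : Measurable fun p : (ℝ × ℝ) × (ℕ → ℝ) => (p.1, closeUp a b m p.1 p.2) :=
    measurable_fst.prodMk (continuous_closeUp a b m).measurable
  have hG : Measurable fun p : (ℝ × ℝ) × (ℕ → ℝ) =>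
      ENNReal.ofReal (closeWeight f a b m p.1 p.2) * H (p.1, closeUp a b m p.1 p.2) :=
    hW.mul (hH.comp hC)
  have hE : Measurable fun x => H (endpoint a b (m + 2) x, x) :=
    hH.comp ((continuous_endpoint a b (m + 2)).measurable.prodMk measurable_id)
  have hR : Measurable fun p : (ℕ → ℝ) × ℝ × ℝ => replaceTwo m p.1 p.2.1 p.2.2 :=
    (continuous_replaceTwo m).measurable
  rw [lintegral_lintegral_swap hG.aemeasurable, stepsLaw,
    lintegral_replaceTwo_infinitePi (densityLaw f) m hE]
  refine lintegral_congr fun x => ?_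
  have hφ : Measurable fun p : ℝ × ℝ => H (endpoint a b (m + 2) (replaceTwo m x p.1 p.2),
      replaceTwo m x p.1 p.2) :=
    hE.comp (hR.comp (measurable_prodMk_left (x := x)))
  have hK : Measurable fun t : ℝ × ℝ => ENNReal.ofReal (closeWeight f a b m t x) *
      H (t, closeUp a b m t x) := by
    have h := hG.comp (measurable_prodMk_right (α := ℝ × ℝ) (y := x))
    simpa only [Function.comp_def] using h
  rw [lintegral_densityLaw_densityLaw hf hφ,
    lintegral_affine_shear (walk a x m) (integratedWalk a b x m) hK]
  refine lintegral_congr fun u => lintegral_congr fun v => ?_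
  have h1 : forcedStep a b m (walk a x m + u + v,
      integratedWalk a b x m + 2 * walk a x m + 2 * u + v) x = u := by
    simp only [forcedStep]; ring
  have h2 : forcedStep' a b m (walk a x m + u + v,
      integratedWalk a b x m + 2 * walk a x m + 2 * u + v) x = v := by
    rw [forcedStep', h1]; ring
  rw [closeWeight, closeUp, h1, h2, endpoint, walk_replaceTwo, integratedWalk_replaceTwo]

/-- The joint law of the terminal value and of the steps is the image of Lebesgue measure times the
law of the steps, weighted by the density of the forced steps, under `closeUp`. -/
lemma map_endpoint_eq (hf : IsStepDensity f) (a b : ℝ) (m : ℕ) :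
    (((volume : Measure (ℝ × ℝ)).prod (stepsLaw f)).withDensity fun p =>
        ENNReal.ofReal (closeWeight f a b m p.1 p.2)).map
          (fun p => (p.1, closeUp a b m p.1 p.2)) =
      (stepsLaw f).map fun x => (endpoint a b (m + 2) x, x) := by
  have hW : Measurable fun p : (ℝ × ℝ) × (ℕ → ℝ) => ENNReal.ofReal (closeWeight f a b m p.1 p.2) :=
    (continuous_closeWeight hf.continuous a b m).measurable.ennreal_ofReal
  have hC : Measurable fun p : (ℝ × ℝ) × (ℕ → ℝ) => (p.1, closeUp a b m p.1 p.2) :=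
    measurable_fst.prodMk (continuous_closeUp a b m).measurable
  refine Measure.ext_of_lintegral _ fun H hH => ?_
  have hE : Measurable fun x => (endpoint a b (m + 2) x, x) :=
    (continuous_endpoint a b (m + 2)).measurable.prodMk measurable_id
  have hG : Measurable fun p : (ℝ × ℝ) × (ℕ → ℝ) => H (p.1, closeUp a b m p.1 p.2) := hH.comp hC
  rw [lintegral_map hH hC, lintegral_map hH hE,
    lintegral_withDensity_eq_lintegral_mul _ hW hG, lintegral_endpoint hf a b m hH,
    lintegral_prod _ (hW.mul hG).aemeasurable]
  rfl

end StepsLaw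

/-! ### The conditional law of the walk given its terminal value -/

section Conditional

variable {f : ℝ → ℝ}

/-- The density at `t` of the terminal value, weighted by the function `G` of the steps. -/
noncomputable def weightedDensity (f : ℝ → ℝ) [IsProbabilityMeasure (densityLaw f)] (a b : ℝ)
    (m : ℕ) {F : Type*} [NormedAddCommGroup F] [NormedSpace ℝ F] (G : (ℕ → ℝ) → F) (t : ℝ × ℝ) : F :=
  ∫ x, closeWeight f a b m t x • G (closeUp a b m t x) ∂(stepsLaw f)

lemma closeWeight_nonneg (hf : IsStepDensity f) (a b : ℝ) (m : ℕ) (t : ℝ × ℝ) (x : ℕ → ℝ) :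
    0 ≤ closeWeight f a b m t x := mul_nonneg (hf.nonneg _) (hf.nonneg _)

lemma closeWeight_le (hf : IsStepDensity f) (a b : ℝ) (m : ℕ) (t : ℝ × ℝ) (x : ℕ → ℝ) :
    closeWeight f a b m t x ≤ f 0 * f 0 :=
  mul_le_mul (hf.le_zero _) (hf.le_zero _) (hf.nonneg _) hf.zero_pos.le

lemma continuous_closeUp_right (a b : ℝ) (m : ℕ) (t : ℝ × ℝ) :
    Continuous fun x => closeUp a b m t x := by
  have h := (continuous_closeUp a b m).comp (Continuous.prodMk_right t)
  simpa only [Function.comp_def] using h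

lemma continuous_closeUp_left (a b : ℝ) (m : ℕ) (x : ℕ → ℝ) :
    Continuous fun t => closeUp a b m t x := by
  have h := (continuous_closeUp a b m).comp (Continuous.prodMk_left x)
  simpa only [Function.comp_def] using h

lemma continuous_closeWeight_right (hf : Continuous f) (a b : ℝ) (m : ℕ) (t : ℝ × ℝ) :
    Continuous fun x => closeWeight f a b m t x := by
  have h := (continuous_closeWeight hf a b m).comp (Continuous.prodMk_right t)
  simpa only [Function.comp_def] using h

lemma continuous_closeWeight_left (hf : Continuous f) (a b : ℝ) (m : ℕ) (x : ℕ → ℝ) :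
    Continuous fun t => closeWeight f a b m t x := by
  have h := (continuous_closeWeight hf a b m).comp (Continuous.prodMk_left x)
  simpa only [Function.comp_def] using h

attribute [local irreducible] closeWeight closeUp

variable [IsProbabilityMeasure (densityLaw f)]

lemma integrable_closeWeight (hf : IsStepDensity f) (a b : ℝ) (m : ℕ) (t : ℝ × ℝ) :
    Integrable (fun x => closeWeight f a b m t x) (stepsLaw f) :=
  Integrable.of_bound (C := f 0 * f 0)
    (continuous_closeWeight_right hf.continuous a b m t).aestronglyMeasurable
    (Eventually.of_forall fun x => by
      rw [Real.norm_eq_abs, abs_of_nonneg (closeWeight_nonneg hf a b m t x)]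
      exact closeWeight_le hf a b m t x)

lemma continuous_weightedDensity (hf : IsStepDensity f) (a b : ℝ) (m : ℕ)
    {F : Type*} [NormedAddCommGroup F] [NormedSpace ℝ F] [SecondCountableTopologyEither (ℕ → ℝ) F]
    {G : (ℕ → ℝ) → F} (hG : Continuous G) {C : ℝ} (hC : ∀ x, ‖G x‖ ≤ C) :
    Continuous fun t => weightedDensity f a b m G t := by
  refine continuous_of_dominated (bound := fun _ => f 0 * f 0 * C) (fun t => ?_) (fun t => ?_)
    (integrable_const _) (Eventually.of_forall fun x => ?_)
  · exact ((continuous_closeWeight_right hf.continuous a b m t).smul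
      (hG.comp (continuous_closeUp_right a b m t))).aestronglyMeasurable
  · refine Eventually.of_forall fun x => ?_
    rw [norm_smul, Real.norm_eq_abs, abs_of_nonneg (closeWeight_nonneg hf a b m t x)]
    exact mul_le_mul (closeWeight_le hf a b m t x) (hC _) (norm_nonneg _)
      (mul_nonneg hf.zero_pos.le hf.zero_pos.le)
  · exact (continuous_closeWeight_left hf.continuous a b m x).smul
      (hG.comp (continuous_closeUp_left a b m x))

lemma continuous_weightedDensity_one (hf : IsStepDensity f) (a b : ℝ) (m : ℕ) :
    Continuous fun t => weightedDensity f a b m (fun _ => (1 : ℝ)) t :=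
  continuous_weightedDensity hf a b m continuous_const (C := 1) (by simp)

lemma weightedDensity_one_nonneg (hf : IsStepDensity f) (a b : ℝ) (m : ℕ) (t : ℝ × ℝ) :
    0 ≤ weightedDensity f a b m (fun _ => (1 : ℝ)) t :=
  integral_nonneg fun x => by simpa using closeWeight_nonneg hf a b m t x

lemma lintegral_closeWeight (hf : IsStepDensity f) (a b : ℝ) (m : ℕ) (t : ℝ × ℝ) :
    ∫⁻ x, ENNReal.ofReal (closeWeight f a b m t x) ∂(stepsLaw f) =
      ENNReal.ofReal (weightedDensity f a b m (fun _ => (1 : ℝ)) t) := by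
  rw [weightedDensity, ofReal_integral_eq_lintegral_ofReal]
  · simp
  · simpa using integrable_closeWeight hf a b m t
  · exact Eventually.of_forall fun x => by simpa using closeWeight_nonneg hf a b m t x

/-- The law of the terminal value has the density `weightedDensity f a b m 1`. -/
lemma map_endpoint_apply (hf : IsStepDensity f) (a b : ℝ) (m : ℕ) {s : Set (ℝ × ℝ)}
    (hs : MeasurableSet s) :
    (stepsLaw f).map (endpoint a b (m + 2)) s =
      ∫⁻ t in s, ENNReal.ofReal (weightedDensity f a b m (fun _ => (1 : ℝ)) t) := by
  have hmE : Measurable (endpoint a b (m + 2)) := (continuous_endpoint a b (m + 2)).measurable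
  have h := lintegral_endpoint hf a b m (H := fun p => s.indicator 1 p.1)
    ((measurable_one.indicator hs).comp measurable_fst)
  rw [Measure.map_apply hmE hs, ← lintegral_indicator_one (hmE hs), ← lintegral_indicator hs]
  refine Eq.trans ?_ (h.trans ?_)
  · rfl
  · refine lintegral_congr fun t => ?_
    by_cases ht : t ∈ s
    · simp [Set.indicator_of_mem ht, lintegral_closeWeight hf]
    · simp [Set.indicator_of_notMem ht]

/-- A regular conditional distribution of the steps given the terminal value, explicit wherever the
density of the terminal value is positive. -/
lemma exists_kernel (hf : IsStepDensity f) (a b : ℝ) (m : ℕ) :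
    ∃ κ : Kernel (ℝ × ℝ) (ℕ → ℝ), IsMarkovKernel κ ∧
      HasCondDistrib id (endpoint a b (m + 2)) κ (stepsLaw f) ∧
      ∀ t, 0 < weightedDensity f a b m (fun _ => (1 : ℝ)) t →
        κ t = ((stepsLaw f).withDensity fun x => ENNReal.ofReal
          (closeWeight f a b m t x / weightedDensity f a b m (fun _ => (1 : ℝ)) t)).map
            (closeUp a b m t) := by
  set ψ : ℝ × ℝ → ℝ := fun t => weightedDensity f a b m (fun _ => (1 : ℝ)) t with hψ
  have hψc : Continuous ψ := continuous_weightedDensity_one hf a b m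
  have hψ0 : ∀ t, 0 ≤ ψ t := weightedDensity_one_nonneg hf a b m
  set w : ℝ × ℝ → (ℕ → ℝ) → ENNReal := fun t x => ENNReal.ofReal (closeWeight f a b m t x / ψ t)
    with hw
  have hwm : Measurable (Function.uncurry w) :=
    ((continuous_closeWeight hf.continuous a b m).measurable.div
      (hψc.measurable.comp measurable_fst)).ennreal_ofReal
  have hcm : ∀ t, Measurable (closeUp a b m t) := fun t =>
    (continuous_closeUp_right a b m t).measurable
  have hcm' : Measurable fun p : (ℝ × ℝ) × (ℕ → ℝ) => closeUp a b m p.1 p.2 :=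
    (continuous_closeUp a b m).measurable
  have hS : MeasurableSet {t | 0 < ψ t} := measurableSet_lt measurable_const hψc.measurable
  set κ₀ : Kernel (ℝ × ℝ) (ℕ → ℝ) := Kernel.withDensity (Kernel.const _ (stepsLaw f)) w with hκ₀
  set κ₁ : Kernel (ℝ × ℝ) (ℕ → ℝ) :=
    (Kernel.id ×ₖ κ₀).map (fun p => closeUp a b m p.1 p.2) with hκ₁
  have : IsSFiniteKernel κ₀ := Kernel.IsSFiniteKernel.withDensity _ fun _ _ => ENNReal.ofReal_ne_top
  have hκ₀t : ∀ t, κ₀ t = (stepsLaw f).withDensity (w t) := fun t => by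
    rw [hκ₀, Kernel.withDensity_apply _ hwm, Kernel.const_apply]
  have hκ₁t : ∀ t, κ₁ t = ((stepsLaw f).withDensity (w t)).map (closeUp a b m t) := by
    intro t
    refine Measure.ext_of_lintegral _ fun H hH => ?_
    have hHc : Measurable fun p : (ℝ × ℝ) × (ℕ → ℝ) => H (closeUp a b m p.1 p.2) := hH.comp hcm'
    rw [hκ₁, Kernel.lintegral_map _ hcm' _ hH, Kernel.lintegral_id_prod hHc,
      lintegral_map hH (hcm t), hκ₀t]
  have hfin : ∀ t, 0 < ψ t → IsProbabilityMeasure (κ₁ t) := by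
    intro t ht
    rw [hκ₁t]
    have : IsProbabilityMeasure ((stepsLaw f).withDensity (w t)) := by
      constructor
      rw [withDensity_apply _ MeasurableSet.univ, Measure.restrict_univ]
      simp_rw [hw, ENNReal.ofReal_div_of_pos ht, div_eq_mul_inv]
      rw [lintegral_mul_const _ (continuous_closeWeight_right hf.continuous a b
        m t).measurable.ennreal_ofReal, lintegral_closeWeight hf, ENNReal.mul_inv_cancel]
      · simpa using ht
      · exact ENNReal.ofReal_ne_top
    exact Measure.isProbabilityMeasure_map (hcm t).aemeasurable
  classical
  let κ : Kernel (ℝ × ℝ) (ℕ → ℝ) := Kernel.piecewise hS κ₁ (Kernel.const _ (stepsLaw f))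
  have hκt : ∀ t, 0 < ψ t → κ t = κ₁ t := fun t ht => by
    simp only [κ, Kernel.piecewise_apply]
    exact if_pos ht
  have hκM : IsMarkovKernel κ := by
    constructor
    intro t
    by_cases ht : 0 < ψ t
    · rw [hκt t ht]; exact hfin t ht
    · have : κ t = stepsLaw f := by
        simp only [κ, Kernel.piecewise_apply]
        exact if_neg ht
      rw [this]; infer_instance
  have hmE : Measurable (endpoint a b (m + 2)) := (continuous_endpoint a b (m + 2)).measurable
  refine ⟨κ, hκM, ⟨(hmE.prodMk measurable_id).aemeasurable, ?_⟩, fun t ht => ?_⟩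
  · refine Measure.ext_of_lintegral _ fun H hH => ?_
    have hh : Measurable fun t => ∫⁻ x, H (t, x) ∂(κ t) := hH.lintegral_kernel_prod_right'
    rw [lintegral_map hH (hmE.prodMk measurable_id), Measure.lintegral_compProd hH,
      lintegral_map hh hmE]
    have e1 := lintegral_endpoint hf a b m hH
    have e2 := lintegral_endpoint hf a b m (hh.comp measurable_fst)
    simp only [id_eq, Function.comp_def] at e1 e2 ⊢
    rw [e1, e2]
    refine lintegral_congr fun t => ?_
    have hw1 : Measurable fun x => ENNReal.ofReal (closeWeight f a b m t x) :=
      (continuous_closeWeight_right hf.continuous a b m t).measurable.ennreal_ofReal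
    have hH0 : Measurable fun x => H (t, x) := hH.comp measurable_prodMk_left
    have hH1 : Measurable fun x => H (t, closeUp a b m t x) := hH0.comp (hcm t)
    have hw2 : Measurable (w t) := hwm.of_uncurry_left
    have hw3 : Measurable fun x => w t x * H (t, closeUp a b m t x) := hw2.mul hH1
    have hw4 : Measurable fun x => ENNReal.ofReal (closeWeight f a b m t x) *
      H (t, closeUp a b m t x) := hw1.mul hH1
    rw [lintegral_mul_const _ hw1, lintegral_closeWeight hf]
    rcases (hψ0 t).eq_or_lt with h0 | hpos
    · have hz : ∫⁻ x, ENNReal.ofReal (closeWeight f a b m t x) ∂(stepsLaw f) = 0 := by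
        rw [lintegral_closeWeight hf]
        have : weightedDensity f a b m (fun _ => (1 : ℝ)) t = 0 := h0.symm
        rw [this, ENNReal.ofReal_zero]
      rw [← lintegral_closeWeight hf, hz, zero_mul, lintegral_eq_zero_iff hw4]
      filter_upwards [(lintegral_eq_zero_iff hw1).1 hz] with x hx
      simp only [Pi.zero_apply] at hx ⊢
      rw [hx, zero_mul]
    · rw [hκt t hpos, hκ₁t, lintegral_map hH0 (hcm t),
        lintegral_withDensity_eq_lintegral_mul _ hw2 hH1]
      simp only [Pi.mul_apply]
      rw [← lintegral_const_mul _ hw3]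
      refine lintegral_congr fun x => ?_
      simp only [hw]
      rw [← mul_assoc, ← ENNReal.ofReal_mul (hψ0 t), mul_div_cancel₀ _ hpos.ne']
  · rw [hκt t ht, hκ₁t]

/-- Where the density of the terminal value is positive, the conditional law of a continuous
functional of the steps exists. -/
lemma exists_isCondLaw_endpoint (hf : IsStepDensity f) (a b : ℝ) (m : ℕ) {E : Type*}
    [TopologicalSpace E] [MeasurableSpace E] [BorelSpace E]
    {X : (ℕ → ℝ) → E} (hX : Continuous X) {t : ℝ × ℝ}
    (ht : 0 < weightedDensity f a b m (fun _ => (1 : ℝ)) t) :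
    ∃ ν : Measure E, IsProbabilityMeasure ν ∧
      IsCondLaw (stepsLaw f) X (endpoint a b (m + 2)) t ν ∧
      ∀ G : E → ℂ, Continuous G → ∫ y, G y ∂ν =
        (weightedDensity f a b m (fun _ => (1 : ℝ)) t)⁻¹ •
          weightedDensity f a b m (fun x => G (X x)) t := by
  obtain ⟨κ, hκM, hκ, hκt⟩ := exists_kernel hf a b m
  set ψ : ℝ × ℝ → ℝ := fun t => weightedDensity f a b m (fun _ => (1 : ℝ)) t with hψ
  have hψc : Continuous ψ := continuous_weightedDensity_one hf a b m
  have hψ0 : ∀ t, 0 ≤ ψ t := weightedDensity_one_nonneg hf a b m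
  have hformula : ∀ {F : Type} [NormedAddCommGroup F] [NormedSpace ℝ F]
      [SecondCountableTopology F] (G : E → F), Continuous G → ∀ t, 0 < ψ t →
        ∫ y, G y ∂(κ.map X t) = (ψ t)⁻¹ • weightedDensity f a b m (fun x => G (X x)) t := by
    intro F _ _ _ G hG t ht
    have hcm : Measurable (closeUp a b m t) := (continuous_closeUp_right a b m t).measurable
    borelize F
    have hGX : StronglyMeasurable fun x => G (X x) := (hG.comp hX).measurable.stronglyMeasurable
    rw [Kernel.map_apply _ hX.measurable, integral_map hX.measurable.aemeasurable
      hG.measurable.stronglyMeasurable.aestronglyMeasurable, hκt t ht,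
      integral_map hcm.aemeasurable hGX.aestronglyMeasurable,
      integral_withDensity_eq_integral_toReal_smul
        (((continuous_closeWeight_right hf.continuous a b m t).measurable.div_const _).ennreal_ofReal)
        (by simp)]
    change _ = (ψ t)⁻¹ • ∫ x, closeWeight f a b m t x • G (X (closeUp a b m t x)) ∂(stepsLaw f)
    rw [← integral_smul]
    refine integral_congr_ae (Eventually.of_forall fun x => ?_)
    simp only
    rw [ENNReal.toReal_ofReal (div_nonneg (closeWeight_nonneg hf a b m t x) (hψ0 t)), smul_smul,
      div_eq_inv_mul]
  have : IsMarkovKernel (κ.map X) := Kernel.IsMarkovKernel.map _ hX.measurable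
  refine ⟨κ.map X t, inferInstance, ⟨?_, κ.map X, inferInstance, hκ.comp_left hX.measurable, ?_, rfl⟩,
    fun G hG => hformula G hG t ht⟩
  · rw [Measure.mem_support_iff_forall]
    intro U hU
    have hU' : U ∩ {s | 0 < ψ s} ∈ 𝓝 t :=
      inter_mem hU ((isOpen_lt continuous_const hψc).mem_nhds ht)
    obtain ⟨O, hOU, hO, htO⟩ := mem_nhds_iff.1 hU'
    refine lt_of_lt_of_le ?_ (measure_mono (hOU.trans Set.inter_subset_left))
    rw [map_endpoint_apply hf a b m hO.measurableSet]
    rw [setLIntegral_pos_iff (hψc.measurable.ennreal_ofReal)]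
    refine lt_of_lt_of_le (hO.measure_pos volume ⟨t, htO⟩) (measure_mono fun s hs => ⟨?_, hs⟩)
    have : 0 < ψ s := (hOU hs).2
    simpa [Function.mem_support] using this
  · intro g
    have hev : ∀ᶠ s in 𝓝 t, (ψ s)⁻¹ • weightedDensity f a b m (fun x => g (X x)) s =
        ∫ y, g y ∂(κ.map X s) := by
      filter_upwards [(isOpen_lt continuous_const hψc).mem_nhds ht] with s hs
      exact (hformula g g.continuous s hs).symm
    refine ContinuousAt.congr ?_ hev
    have h1 := continuous_weightedDensity hf a b m (g.continuous.comp hX) (C := ‖g‖)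
      fun x => g.norm_coe_le_norm (X x)
    exact (hψc.continuousAt.inv₀ ht.ne').smul h1.continuousAt

end Conditional

/-! ### Fourier inversion in the plane -/

/-- The Fourier inversion formula on `ℝ × ℝ`, with the characters `exp (i (ξ₁ t₁ + ξ₂ t₂))`. -/
lemma eq_integral_fourier_prod {ψ : ℝ × ℝ → ℂ} (hc : Continuous ψ) (hi : Integrable ψ)
    (hF : Integrable fun ξ : ℝ × ℝ => ∫ t : ℝ × ℝ,
      Complex.exp (((ξ.1 * t.1 + ξ.2 * t.2 : ℝ) : ℂ) * Complex.I) * ψ t) (t₀ : ℝ × ℝ) :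
    ψ t₀ = (((2 * Real.pi) ^ 2)⁻¹ : ℝ) • ∫ ξ : ℝ × ℝ,
      Complex.exp (((-(ξ.1 * t₀.1 + ξ.2 * t₀.2) : ℝ) : ℂ) * Complex.I) *
        ∫ t : ℝ × ℝ, Complex.exp (((ξ.1 * t.1 + ξ.2 * t.2 : ℝ) : ℂ) * Complex.I) * ψ t := by
  set χ : ℝ × ℝ → ℂ := fun ξ => ∫ t : ℝ × ℝ,
      Complex.exp (((ξ.1 * t.1 + ξ.2 * t.2 : ℝ) : ℂ) * Complex.I) * ψ t with hχ
  have hmp : MeasurePreserving (WithLp.ofLp : WithLp 2 (ℝ × ℝ) → ℝ × ℝ) :=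
    WithLp.volume_preserving_ofLp ℝ ℝ
  have hme : MeasurableEmbedding (WithLp.ofLp : WithLp 2 (ℝ × ℝ) → ℝ × ℝ) :=
    (WithLp.homeomorphProd 2 ℝ ℝ).measurableEmbedding
  set g : WithLp 2 (ℝ × ℝ) → ℂ := fun v => ψ v.ofLp with hg
  have hgc : Continuous g := hc.comp (WithLp.homeomorphProd 2 ℝ ℝ).continuous
  have hgi : Integrable g := hmp.integrable_comp_of_integrable hi
  have hFg : ∀ w, FourierTransform.fourier g w = χ ((-(2 * Real.pi)) • w.ofLp) := by
    intro w
    rw [Real.fourier_eq', hχ]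
    simp only
    rw [← hmp.integral_comp hme]
    refine integral_congr_ae (Eventually.of_forall fun v => ?_)
    simp only [smul_eq_mul, hg]
    congr 3
    rw [WithLp.prod_inner_apply]
    simp
    ring
  have hFi : Integrable (FourierTransform.fourier g) := by
    have h1 : Integrable fun ξ : ℝ × ℝ => χ ((-(2 * Real.pi)) • ξ) :=
      hF.comp_smul (by simp [Real.pi_ne_zero])
    refine (hmp.integrable_comp_of_integrable h1).congr (Eventually.of_forall fun w => ?_)
    exact (hFg w).symm
  have hinv := congrFun (hgc.fourierInv_fourier_eq hgi hFi) (WithLp.toLp 2 t₀)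
  have e1 : g (WithLp.toLp 2 t₀) = ψ t₀ := rfl
  rw [← e1, ← hinv, Real.fourierInv_eq']
  have e2 : ∫ v : WithLp 2 (ℝ × ℝ), Complex.exp (((2 * Real.pi *
      inner ℝ v (WithLp.toLp 2 t₀) : ℝ) : ℂ) * Complex.I) • FourierTransform.fourier g v =
      ∫ ξ : ℝ × ℝ, (fun ξ : ℝ × ℝ => Complex.exp (((-(ξ.1 * t₀.1 + ξ.2 * t₀.2) : ℝ) : ℂ) *
        Complex.I) * χ ξ) ((-(2 * Real.pi)) • ξ) := by
    rw [← hmp.integral_comp hme]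
    refine integral_congr_ae (Eventually.of_forall fun v => ?_)
    simp only [smul_eq_mul, hFg]
    congr 3
    rw [WithLp.prod_inner_apply]
    simp
    ring
  rw [e2]
  refine (Measure.integral_comp_smul volume (fun ξ : ℝ × ℝ => Complex.exp
    (((-(ξ.1 * t₀.1 + ξ.2 * t₀.2) : ℝ) : ℂ) * Complex.I) * χ ξ) (-(2 * Real.pi))).trans ?_
  congr 1
  rw [Module.finrank_prod, Module.finrank_self, one_add_one_eq_two, neg_sq, abs_of_pos]
  have := Real.pi_pos
  positivity

lemma map_mul_prod_volume {A B : ℝ} (hA : 0 < A) (hB : 0 < B) :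
    Measure.map (fun p : ℝ × ℝ => (A * p.1, B * p.2)) volume =
      ENNReal.ofReal (A * B)⁻¹ • (volume : Measure (ℝ × ℝ)) := by
  have h1 := Measure.map_prod_map (volume : Measure ℝ) (volume : Measure ℝ)
    (measurable_const_mul A) (measurable_const_mul B)
  rw [Real.map_volume_mul_left hA.ne', Real.map_volume_mul_left hB.ne'] at h1
  rw [Measure.volume_eq_prod]
  refine Eq.trans h1.symm ?_
  rw [Measure.prod_smul_left, Measure.prod_smul_right, smul_smul,
    ← ENNReal.ofReal_mul (abs_nonneg _), abs_of_pos (inv_pos.2 hA), abs_of_pos (inv_pos.2 hB),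
    mul_inv]

lemma measurableEmbedding_mul_prod {A B : ℝ} (hA : 0 < A) (hB : 0 < B) :
    MeasurableEmbedding fun p : ℝ × ℝ => (A * p.1, B * p.2) :=
  ((Homeomorph.mulLeft₀ A hA.ne').prodCongr (Homeomorph.mulLeft₀ B hB.ne')).measurableEmbedding

lemma integral_comp_mul_prod {F : Type*} [NormedAddCommGroup F] [NormedSpace ℝ F] (g : ℝ × ℝ → F)
    {A B : ℝ} (hA : 0 < A) (hB : 0 < B) :
    ∫ p : ℝ × ℝ, g (A * p.1, B * p.2) = (A * B)⁻¹ • ∫ p, g p := by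
  rw [← (measurableEmbedding_mul_prod hA hB).integral_map, map_mul_prod_volume hA hB,
    integral_smul_measure, ENNReal.toReal_ofReal (by positivity)]

/-! ### The conditional law as a quotient of Fourier integrals -/

section Conditional

variable {f : ℝ → ℝ} [IsProbabilityMeasure (densityLaw f)]

attribute [local irreducible] closeWeight closeUp

lemma integrable_weighted (hf : IsStepDensity f) (a b : ℝ) (m : ℕ)
    {G : (ℕ → ℝ) → ℂ} (hG : Continuous G) {C : ℝ} (hC : ∀ x, ‖G x‖ ≤ C) :
    Integrable (fun p : (ℝ × ℝ) × (ℕ → ℝ) => closeWeight f a b m p.1 p.2 •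
      G (closeUp a b m p.1 p.2)) ((volume : Measure (ℝ × ℝ)).prod (stepsLaw f)) := by
  have hw : Integrable (fun p : (ℝ × ℝ) × (ℕ → ℝ) => closeWeight f a b m p.1 p.2)
      ((volume : Measure (ℝ × ℝ)).prod (stepsLaw f)) := by
    have hc := continuous_closeWeight hf.continuous a b m
    refine ⟨hc.aestronglyMeasurable, ?_⟩
    have h1 : ∫⁻ p, ‖closeWeight f a b m p.1 p.2‖ₑ ∂((volume : Measure (ℝ × ℝ)).prod (stepsLaw f)) =
        ∫⁻ p, ENNReal.ofReal (closeWeight f a b m p.1 p.2)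
          ∂((volume : Measure (ℝ × ℝ)).prod (stepsLaw f)) :=
      lintegral_congr fun p => Real.enorm_of_nonneg (closeWeight_nonneg hf a b m p.1 p.2)
    have h2 := lintegral_endpoint hf a b m (H := fun _ => 1) measurable_const
    rw [HasFiniteIntegral, h1, lintegral_prod _ hc.measurable.ennreal_ofReal.aemeasurable]
    simp only [mul_one] at h2
    rw [← h2]
    simp
  have hGc : Continuous fun p : (ℝ × ℝ) × (ℕ → ℝ) => G (closeUp a b m p.1 p.2) :=
    hG.comp (continuous_closeUp a b m)
  exact hw.smul_bdd C hGc.aestronglyMeasurable (Eventually.of_forall fun p => hC _)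

/-- The Fourier transform of `weightedDensity` is a characteristic function of the terminal value. -/
lemma integral_char_weightedDensity (hf : IsStepDensity f) (a b : ℝ) (m : ℕ)
    {G : (ℕ → ℝ) → ℂ} (hG : Continuous G) {C : ℝ} (hC : ∀ x, ‖G x‖ ≤ C) (ξ : ℝ × ℝ) :
    ∫ t : ℝ × ℝ, Complex.exp (((ξ.1 * t.1 + ξ.2 * t.2 : ℝ) : ℂ) * Complex.I) *
        weightedDensity f a b m G t =
      ∫ x, Complex.exp (((ξ.1 * walk a x (m + 2) + ξ.2 * integratedWalk a b x (m + 2) : ℝ) : ℂ) *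
        Complex.I) * G x ∂(stepsLaw f) := by
  set e : ℝ × ℝ → ℂ := fun t =>
    Complex.exp (((ξ.1 * t.1 + ξ.2 * t.2 : ℝ) : ℂ) * Complex.I) with he
  have hec : Continuous e := by rw [he]; fun_prop
  have he1 : ∀ t, ‖e t‖ ≤ 1 := fun t => (Complex.norm_exp_ofReal_mul_I _).le
  set Q : (ℝ × ℝ) × (ℕ → ℝ) → ℂ := fun p => e p.1 * G p.2 with hQ
  have hQc : Continuous Q := (hec.comp continuous_fst).mul (hG.comp continuous_snd)
  have hmap := map_endpoint_eq hf a b m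
  have hW : Measurable fun p : (ℝ × ℝ) × (ℕ → ℝ) => ENNReal.ofReal (closeWeight f a b m p.1 p.2) :=
    (continuous_closeWeight hf.continuous a b m).measurable.ennreal_ofReal
  have hcu : Measurable fun p : (ℝ × ℝ) × (ℕ → ℝ) => (p.1, closeUp a b m p.1 p.2) :=
    measurable_fst.prodMk (continuous_closeUp a b m).measurable
  have hE : Measurable fun x => (endpoint a b (m + 2) x, x) :=
    (continuous_endpoint a b (m + 2)).measurable.prodMk measurable_id
  have hQs : ∀ μ : Measure ((ℝ × ℝ) × (ℕ → ℝ)), AEStronglyMeasurable Q μ := fun μ =>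
    hQc.aestronglyMeasurable
  have h1 : ∫ x, Q (endpoint a b (m + 2) x, x) ∂(stepsLaw f) =
      ∫ p, closeWeight f a b m p.1 p.2 • Q (p.1, closeUp a b m p.1 p.2)
        ∂((volume : Measure (ℝ × ℝ)).prod (stepsLaw f)) := by
    rw [← integral_map hE.aemeasurable (hQs _), ← hmap, integral_map hcu.aemeasurable (hQs _),
      integral_withDensity_eq_integral_toReal_smul hW (by simp)]
    refine integral_congr_ae (Eventually.of_forall fun p => ?_)
    simp only
    rw [ENNReal.toReal_ofReal (closeWeight_nonneg hf a b m p.1 p.2)]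
  have hint : Integrable (fun p : (ℝ × ℝ) × (ℕ → ℝ) => closeWeight f a b m p.1 p.2 •
      Q (p.1, closeUp a b m p.1 p.2)) ((volume : Measure (ℝ × ℝ)).prod (stepsLaw f)) := by
    have h2 := (integrable_weighted hf a b m hG hC).bdd_mul (c := 1)
      (f := fun p : (ℝ × ℝ) × (ℕ → ℝ) => e p.1)
      (hec.comp continuous_fst).aestronglyMeasurable (Eventually.of_forall fun p => he1 p.1)
    refine h2.congr (Eventually.of_forall fun p => ?_)
    simp only [hQ, Complex.real_smul]
    ring
  rw [integral_prod _ hint] at h1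
  have h3 : ∀ t, e t * weightedDensity f a b m G t =
      ∫ x, closeWeight f a b m t x • Q (t, closeUp a b m t x) ∂(stepsLaw f) := by
    intro t
    rw [weightedDensity, ← integral_const_mul]
    refine integral_congr_ae (Eventually.of_forall fun x => ?_)
    simp only [hQ, Complex.real_smul]
    ring
  rw [integral_congr_ae (Eventually.of_forall h3), ← h1]
  refine integral_congr_ae (Eventually.of_forall fun x => ?_)
  simp only [hQ, he, endpoint]

/-- The coefficient of the step `j` in `p.1 Y_N + p.2 Z_N / N`. -/
noncomputable def endCoeff (N : ℕ) (p : ℝ × ℝ) (j : ℕ) : ℝ := p.1 + p.2 * ((N - j) / N)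

/-- The joint characteristic function, at `p`, of the terminal value of the walk started at `(0, 0)`,
rescaled by `sd √N` and `sd N^{3/2}`, and weighted by the function `G` of the steps. -/
noncomputable def weightedChar (f : ℝ → ℝ) [IsProbabilityMeasure (densityLaw f)] (sd : ℝ) (N : ℕ)
    (G : (ℕ → ℝ) → ℂ) (p : ℝ × ℝ) : ℂ :=
  ∫ x, G x * Complex.exp (((∑ j ∈ Finset.range N, endCoeff N p j / (sd * √N) * x j : ℝ) : ℂ) *
    Complex.I) ∂(stepsLaw f)

/-- The inverse Fourier transform of `weightedChar` at the point `z`. -/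
noncomputable def weightedInt (f : ℝ → ℝ) [IsProbabilityMeasure (densityLaw f)] (sd : ℝ) (N : ℕ)
    (G : (ℕ → ℝ) → ℂ) (z : ℝ × ℝ) : ℂ :=
  ∫ p : ℝ × ℝ, Complex.exp (((-(p.1 * z.1 + p.2 * z.2) : ℝ) : ℂ) * Complex.I) *
    weightedChar f sd N G p

/-- The terminal value `t` of the walk started at `(a, b)`, with its mean `(a, b + N a)` subtracted,
rescaled by `sd √N` and `sd N^{3/2}`. -/
noncomputable def rescaledEnd (sd a b : ℝ) (N : ℕ) (t : ℝ × ℝ) : ℝ × ℝ :=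
  ((t.1 - a) / (sd * √N), (t.2 - b - N * a) / (sd * √N * N))

lemma integratedWalk_eq_sum (a b : ℝ) (x : ℕ → ℝ) (N : ℕ) :
    integratedWalk a b x N = b + N * a + ∑ j ∈ Finset.range N, ((N : ℝ) - j) * x j := by
  induction N with
  | zero => simp [integratedWalk]
  | succ n ih =>
    have h : ∑ j ∈ Finset.range n, ((n + 1 : ℕ) - (j : ℝ)) * x j =
        ∑ j ∈ Finset.range n, ((n : ℝ) - j) * x j + ∑ j ∈ Finset.range n, x j := by
      rw [← Finset.sum_add_distrib]
      refine Finset.sum_congr rfl fun j _ => ?_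
      push_cast; ring
    rw [integratedWalk_succ, ih, walk, Finset.sum_range_succ, Finset.sum_range_succ, h]
    push_cast
    ring

lemma sum_endCoeff {sd : ℝ} (hsd : 0 < sd) (a b : ℝ) {N : ℕ} (hN : 0 < N) (p : ℝ × ℝ) (x : ℕ → ℝ) :
    ∑ j ∈ Finset.range N, endCoeff N p j / (sd * √N) * x j =
      p.1 / (sd * √N) * (walk a x N - a) +
        p.2 / (sd * √N * N) * (integratedWalk a b x N - b - N * a) := by
  have hN' : (N : ℝ) ≠ 0 := by exact_mod_cast hN.ne'
  have hs : √(N : ℝ) ≠ 0 := by positivity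
  rw [integratedWalk_eq_sum, walk, add_sub_cancel_left,
    show b + N * a + ∑ j ∈ Finset.range N, ((N : ℝ) - j) * x j - b - N * a =
      ∑ j ∈ Finset.range N, ((N : ℝ) - j) * x j by ring, Finset.mul_sum, Finset.mul_sum,
    ← Finset.sum_add_distrib]
  refine Finset.sum_congr rfl fun j _ => ?_
  rw [endCoeff]
  field_simp

/-- Fourier inversion expresses the weighted density of the terminal value through the rescaled
characteristic function. -/
lemma weightedDensity_eq (hf : IsStepDensity f) {sd : ℝ} (hsd : 0 < sd) (a b : ℝ) (m : ℕ)
    {G : (ℕ → ℝ) → ℂ} (hG : Continuous G) {C : ℝ} (hC : ∀ x, ‖G x‖ ≤ C)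
    (hint : Integrable (weightedChar f sd (m + 2) G)) (t : ℝ × ℝ) :
    weightedDensity f a b m G t = (((2 * Real.pi) ^ 2)⁻¹ * (sd ^ 2 * ((m + 2 : ℕ) : ℝ) ^ 2)⁻¹ : ℝ) •
      weightedInt f sd (m + 2) G (rescaledEnd sd a b (m + 2) t) := by
  set N := m + 2 with hN
  have hN0 : 0 < N := by omega
  have hNR : (0 : ℝ) < N := by exact_mod_cast hN0
  have hsq : √(N : ℝ) * √(N : ℝ) = N := Real.mul_self_sqrt hNR.le
  set A := sd * √(N : ℝ) with hA
  have hA0 : 0 < A := by positivity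
  set B := sd * √(N : ℝ) * N with hB
  have hB0 : 0 < B := by positivity
  -- the phase that comes from centring the terminal value
  set ph : ℝ × ℝ → ℂ := fun ξ =>
    Complex.exp (((ξ.1 * a + ξ.2 * (b + N * a) : ℝ) : ℂ) * Complex.I) with hph
  have hphc : Continuous ph := by rw [hph]; fun_prop
  have hchar : ∀ ξ : ℝ × ℝ, ∫ t : ℝ × ℝ,
      Complex.exp (((ξ.1 * t.1 + ξ.2 * t.2 : ℝ) : ℂ) * Complex.I) * weightedDensity f a b m G t =
      ph ξ * weightedChar f sd N G (A * ξ.1, B * ξ.2) := by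
    intro ξ
    rw [integral_char_weightedDensity hf a b m hG hC, weightedChar, ← integral_const_mul]
    refine integral_congr_ae (Eventually.of_forall fun x => ?_)
    simp only
    rw [sum_endCoeff hsd a b hN0, hph]
    simp only
    rw [mul_left_comm, mul_comm (G x), ← Complex.exp_add]
    congr 2
    rw [← add_mul, ← Complex.ofReal_add]
    congr 2
    rw [← hA, ← hB, mul_div_cancel_left₀ _ hA0.ne', mul_div_cancel_left₀ _ hB0.ne', ← hN]
    ring
  have hint' : Integrable fun ξ : ℝ × ℝ => weightedChar f sd N G (A * ξ.1, B * ξ.2) := by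
    have h2 : Integrable (weightedChar f sd N G)
        (Measure.map (fun p : ℝ × ℝ => (A * p.1, B * p.2)) volume) := by
      rw [map_mul_prod_volume hA0 hB0]
      exact hint.smul_measure ENNReal.ofReal_ne_top
    exact (measurableEmbedding_mul_prod hA0 hB0).integrable_map_iff.1 h2
  have hwi : Integrable fun t => weightedDensity f a b m G t :=
    (integrable_weighted hf a b m hG hC).integral_prod_left
  have hF : Integrable fun ξ : ℝ × ℝ => ∫ t : ℝ × ℝ,
      Complex.exp (((ξ.1 * t.1 + ξ.2 * t.2 : ℝ) : ℂ) * Complex.I) *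
        weightedDensity f a b m G t := by
    simp_rw [hchar]
    exact hint'.bdd_mul (c := 1) hphc.aestronglyMeasurable
      (Eventually.of_forall fun ξ => (Complex.norm_exp_ofReal_mul_I _).le)
  have hmain := eq_integral_fourier_prod (continuous_weightedDensity hf a b m hG hC) hwi hF t
  rw [hmain]
  simp_rw [hchar]
  have hcomp := integral_comp_mul_prod (fun p : ℝ × ℝ =>
    Complex.exp (((-(p.1 * (rescaledEnd sd a b N t).1 + p.2 * (rescaledEnd sd a b N t).2) : ℝ) : ℂ) *
      Complex.I) * weightedChar f sd N G p) hA0 hB0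
  rw [weightedInt, mul_smul]
  congr 1
  have hAB : (sd ^ 2 * (N : ℝ) ^ 2)⁻¹ = (A * B)⁻¹ := by
    rw [hA, hB, show sd * √(N : ℝ) * (sd * √(N : ℝ) * N) = sd ^ 2 * (√(N : ℝ) * √(N : ℝ)) * N by ring,
      hsq]
    ring
  rw [hAB, ← hcomp]
  refine integral_congr_ae (Eventually.of_forall fun ξ => ?_)
  simp only [rescaledEnd]
  rw [← hA, ← hB, hph]
  simp only
  rw [← mul_assoc, ← Complex.exp_add]
  congr 2
  rw [← add_mul, ← Complex.ofReal_add]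
  congr 2
  field_simp
  ring

/-- The conditional law of a continuous functional of the steps given the terminal value, as a
quotient of Fourier integrals. -/
lemma exists_isCondLaw_weightedInt (hf : IsStepDensity f) {sd : ℝ} (hsd : 0 < sd) (a b : ℝ) {N : ℕ}
    (hN : 2 ≤ N) {t : ℝ × ℝ} (hint : Integrable (weightedChar f sd N fun _ => 1))
    (hpos : 0 < (weightedInt f sd N (fun _ => 1) (rescaledEnd sd a b N t)).re)
    {E : Type*} [TopologicalSpace E] [MeasurableSpace E] [BorelSpace E]
    {X : (ℕ → ℝ) → E} (hX : Continuous X) :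
    ∃ ν : Measure E, IsProbabilityMeasure ν ∧
      IsCondLaw (stepsLaw f) X (endpoint a b N) t ν ∧
      ∀ G : E → ℂ, Continuous G → (∃ C, ∀ y, ‖G y‖ ≤ C) →
        Integrable (weightedChar f sd N fun x => G (X x)) →
        ∫ y, G y ∂ν = weightedInt f sd N (fun x => G (X x)) (rescaledEnd sd a b N t) /
          weightedInt f sd N (fun _ => 1) (rescaledEnd sd a b N t) := by
  obtain ⟨m, rfl⟩ : ∃ m, N = m + 2 := ⟨N - 2, by omega⟩
  set c : ℝ := ((2 * Real.pi) ^ 2)⁻¹ * (sd ^ 2 * ((m + 2 : ℕ) : ℝ) ^ 2)⁻¹ with hc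
  have hc0 : 0 < c := by
    have : (0 : ℝ) < ((m + 2 : ℕ) : ℝ) := by positivity
    have := Real.pi_pos
    positivity
  have h1 := weightedDensity_eq hf hsd a b m (G := fun _ => (1 : ℂ)) continuous_const (C := 1)
    (by simp) hint t
  have h2 : weightedDensity f a b m (fun _ => (1 : ℂ)) t =
      ((weightedDensity f a b m (fun _ => (1 : ℝ)) t : ℝ) : ℂ) := by
    rw [weightedDensity, weightedDensity, ← integral_complex_ofReal]
    refine integral_congr_ae (Eventually.of_forall fun x => ?_)
    simp
  rw [h2, ← hc] at h1
  have h3 : 0 < weightedDensity f a b m (fun _ => (1 : ℝ)) t := by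
    have h4 := congrArg Complex.re h1
    rw [Complex.ofReal_re, Complex.smul_re, smul_eq_mul] at h4
    rw [h4]
    exact mul_pos hc0 hpos
  obtain ⟨ν, hν, hcond, hform⟩ := exists_isCondLaw_endpoint hf a b m hX h3
  refine ⟨ν, hν, hcond, fun G hG ⟨C, hC⟩ hGi => ?_⟩
  have h5 : weightedDensity f a b m (fun x => G (X x)) t =
      c • weightedInt f sd (m + 2) (fun x => G (X x)) (rescaledEnd sd a b (m + 2) t) :=
    weightedDensity_eq hf hsd a b m (hG.comp hX) (fun x => hC (X x)) hGi t
  rw [hform G hG, h5,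
    Complex.real_smul, Complex.ofReal_inv, h1, Complex.real_smul, Complex.real_smul]
  have hc' : (c : ℂ) ≠ 0 := by exact_mod_cast hc0.ne'
  rw [mul_inv]
  field_simp

end Conditional

/-! ### Linear functionals of independent steps -/

section Steps

variable {f : ℝ → ℝ} [IsProbabilityMeasure (densityLaw f)]

lemma iIndepFun_stepsLaw : iIndepFun (fun (i : ℕ) (x : ℕ → ℝ) => x i) (stepsLaw f) := by
  unfold stepsLaw
  exact iIndepFun_infinitePi (X := fun _ u => u) (fun _ => measurable_id)

lemma map_eval_stepsLaw (i : ℕ) : (stepsLaw f).map (fun x => x i) = densityLaw f := by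
  unfold stepsLaw
  exact Measure.infinitePi_map_eval _ i

lemma indepFun_sum_stepsLaw {S T : Finset ℕ} (hST : Disjoint S T) (c w : ℕ → ℝ) :
    IndepFun (fun x : ℕ → ℝ => ∑ j ∈ S, c j * x j) (fun x => ∑ j ∈ T, w j * x j) (stepsLaw f) := by
  have h := (iIndepFun_stepsLaw (f := f)).indepFun_finset S T hST (fun i => measurable_pi_apply i)
  have h1 : ∀ (U : Finset ℕ) (d : ℕ → ℝ), Measurable fun y : U → ℝ => ∑ j : U, d j * y j :=
    fun U d => by fun_prop
  have h2 := h.comp (h1 S c) (h1 T w)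
  have h3 : ∀ (U : Finset ℕ) (d : ℕ → ℝ), ((fun y : U → ℝ => ∑ j : U, d j * y j) ∘
      fun (x : ℕ → ℝ) (i : U) => x i) = fun x => ∑ j ∈ U, d j * x j := by
    intro U d
    funext x
    simp only [Function.comp_apply]
    exact Finset.sum_coe_sort U fun j => d j * x j
  rwa [h3, h3] at h2

lemma measurable_sum_mul (S : Finset ℕ) (c : ℕ → ℝ) :
    Measurable fun x : ℕ → ℝ => ∑ j ∈ S, c j * x j := by fun_prop

lemma integral_mul_exp_sum_stepsLaw {S T : Finset ℕ} (hST : Disjoint S T) (c w : ℕ → ℝ) {F : ℝ → ℂ}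
    (hF : Measurable F) :
    ∫ x, F (∑ j ∈ S, c j * x j) *
        Complex.exp (((∑ j ∈ T, w j * x j : ℝ) : ℂ) * Complex.I) ∂(stepsLaw f) =
      (∫ x, F (∑ j ∈ S, c j * x j) ∂(stepsLaw f)) *
        ∫ x, Complex.exp (((∑ j ∈ T, w j * x j : ℝ) : ℂ) * Complex.I) ∂(stepsLaw f) := by
  have he : Measurable fun y : ℝ => Complex.exp ((y : ℂ) * Complex.I) := by fun_prop
  have h := (indepFun_sum_stepsLaw (f := f) hST c w).comp hF he
  have h1 := h.integral_fun_mul_eq_mul_integral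
    (hF.comp (measurable_sum_mul S c)).aestronglyMeasurable
    (he.comp (measurable_sum_mul T w)).aestronglyMeasurable
  exact h1

lemma integral_exp_sum_stepsLaw (T : Finset ℕ) (w : ℕ → ℝ) :
    ∫ x, Complex.exp (((∑ j ∈ T, w j * x j : ℝ) : ℂ) * Complex.I) ∂(stepsLaw f) =
      ∏ j ∈ T, charFun (densityLaw f) (w j) := by
  induction T using Finset.induction_on with
  | empty => simp
  | insert i T hi ih =>
    have he : Measurable fun y : ℝ => Complex.exp ((y : ℂ) * Complex.I) := by fun_prop
    have h := integral_mul_exp_sum_stepsLaw (f := f) (Finset.disjoint_singleton_left.2 hi) w w he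
    rw [Finset.prod_insert hi, ← ih]
    have h1 : ∫ x, Complex.exp (((∑ j ∈ {i}, w j * x j : ℝ) : ℂ) * Complex.I) ∂(stepsLaw f) =
        charFun (densityLaw f) (w i) := by
      rw [charFun_apply_real, ← map_eval_stepsLaw (f := f) i,
        integral_map (measurable_pi_apply i).aemeasurable (by fun_prop)]
      simp
    rw [← h1, ← h]
    refine integral_congr_ae (Eventually.of_forall fun x => ?_)
    simp only
    rw [← Complex.exp_add, Finset.sum_insert hi, Finset.sum_singleton]
    congr 1
    push_cast
    ring

/-- A function of the steps outside the block `T` only contributes its mean, and the steps of the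
block the product of their characteristic functions. -/
lemma norm_integral_mul_exp_sum_le {S T U : Finset ℕ} (hST : Disjoint S T) (hU : S ∪ T = U)
    (c w : ℕ → ℝ) {F : ℝ → ℝ} (hF : Continuous F) :
    ‖∫ x, (F (∑ j ∈ S, c j * x j) : ℂ) *
        Complex.exp (((∑ j ∈ U, w j * x j : ℝ) : ℂ) * Complex.I) ∂(stepsLaw f)‖ ≤
      (∫ x, |F (∑ j ∈ S, c j * x j)| ∂(stepsLaw f)) *
        ∏ j ∈ T, ‖charFun (densityLaw f) (w j)‖ := by
  have h := (iIndepFun_stepsLaw (f := f)).indepFun_finset S T hST (fun i => measurable_pi_apply i)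
  have h1 : Measurable fun y : S → ℝ => (F (∑ j : S, c j * y j) : ℂ) *
      Complex.exp (((∑ j : S, w j * y j : ℝ) : ℂ) * Complex.I) := by
    have := hF.measurable
    fun_prop
  have h2 : Measurable fun y : T → ℝ => Complex.exp (((∑ j : T, w j * y j : ℝ) : ℂ) * Complex.I) := by
    fun_prop
  have hS : Measurable fun (x : ℕ → ℝ) (i : S) => x i := by fun_prop
  have hT : Measurable fun (x : ℕ → ℝ) (i : T) => x i := by fun_prop
  have h3 := (h.comp h1 h2).integral_fun_mul_eq_mul_integral
    (h1.comp hS).aestronglyMeasurable (h2.comp hT).aestronglyMeasurable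
  simp only [Function.comp_apply] at h3
  have hcs : ∀ (V : Finset ℕ) (d x : ℕ → ℝ), ∑ j : V, d j * x j = ∑ j ∈ V, d j * x j :=
    fun V d x => Finset.sum_coe_sort V fun j => d j * x j
  simp only [hcs] at h3
  have h4 : ∫ x, (F (∑ j ∈ S, c j * x j) : ℂ) *
        Complex.exp (((∑ j ∈ U, w j * x j : ℝ) : ℂ) * Complex.I) ∂(stepsLaw f) =
      (∫ x, (F (∑ j ∈ S, c j * x j) : ℂ) *
        Complex.exp (((∑ j ∈ S, w j * x j : ℝ) : ℂ) * Complex.I) ∂(stepsLaw f)) *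
      ∫ x, Complex.exp (((∑ j ∈ T, w j * x j : ℝ) : ℂ) * Complex.I) ∂(stepsLaw f) := by
    rw [← h3]
    refine integral_congr_ae (Eventually.of_forall fun x => ?_)
    simp only
    rw [← hU, Finset.sum_union hST, mul_assoc, ← Complex.exp_add]
    congr 2
    push_cast
    ring
  rw [h4, norm_mul, integral_exp_sum_stepsLaw, norm_prod]
  refine mul_le_mul_of_nonneg_right ((norm_integral_le_integral_norm _).trans (le_of_eq ?_))
    (Finset.prod_nonneg fun _ _ => norm_nonneg _)
  refine integral_congr_ae (Eventually.of_forall fun x => ?_)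
  simp only
  rw [norm_mul, Complex.norm_exp_ofReal_mul_I, mul_one, Complex.norm_real, Real.norm_eq_abs]

lemma integrable_eval_pow (hf : IsStepDensity f) (i n : ℕ) :
    Integrable (fun x : ℕ → ℝ => x i ^ n) (stepsLaw f) := by
  have h := hf.integrable_pow n
  rw [← map_eval_stepsLaw (f := f) i] at h
  exact h.comp_measurable (measurable_pi_apply i)

lemma integral_eval_pow (i n : ℕ) :
    ∫ x, x i ^ n ∂(stepsLaw f) = ∫ u, u ^ n ∂(densityLaw f) := by
  rw [← map_eval_stepsLaw (f := f) i,
    integral_map (measurable_pi_apply i).aemeasurable (by fun_prop)]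

/-- The fourth moment of a linear combination of the steps is at most a multiple of the square of
its variance. -/
lemma exists_integral_sum_pow_four_le (hf : IsStepDensity f) :
    ∃ C : ℝ, 0 < C ∧ ∀ (S : Finset ℕ) (c : ℕ → ℝ),
      Integrable (fun x : ℕ → ℝ => (∑ j ∈ S, c j * x j) ^ 4) (stepsLaw f) ∧
      ∫ x, (∑ j ∈ S, c j * x j) ^ 4 ∂(stepsLaw f) ≤ C * (∑ j ∈ S, c j ^ 2) ^ 2 := by
  set m2 := ∫ u, u ^ 2 ∂(densityLaw f) with hm2
  set m4 := ∫ u, u ^ 4 ∂(densityLaw f) with hm4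
  have hm2' : 0 < m2 := hf.integral_sq_pos
  have hm4' : 0 ≤ m4 := integral_nonneg fun u => by positivity
  have hm1 : ∀ i, ∫ x, x i ∂(stepsLaw f) = 0 := fun i => by
    have := integral_eval_pow (f := f) i 1
    simp only [pow_one] at this
    rw [this]
    exact hf.integral_odd fun x => rfl
  have hm3 : ∀ i, ∫ x, x i ^ 3 ∂(stepsLaw f) = 0 := fun i => by
    rw [integral_eval_pow]
    exact hf.integral_odd fun x => by ring
  refine ⟨m4 + 3 * m2 ^ 2, by positivity, fun S c => ?_⟩
  suffices h : (∀ n ≤ 4, Integrable (fun x : ℕ → ℝ => (∑ j ∈ S, c j * x j) ^ n) (stepsLaw f)) ∧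
      ∫ x, (∑ j ∈ S, c j * x j) ^ 2 ∂(stepsLaw f) = m2 * ∑ j ∈ S, c j ^ 2 ∧
      ∫ x, (∑ j ∈ S, c j * x j) ^ 4 ∂(stepsLaw f) ≤ (m4 + 3 * m2 ^ 2) * (∑ j ∈ S, c j ^ 2) ^ 2 from
    ⟨h.1 4 le_rfl, h.2.2⟩
  induction S using Finset.induction_on with
  | empty =>
    refine ⟨fun n _ => ?_, ?_, ?_⟩ <;> simp
  | insert i S hi ih =>
    obtain ⟨hint, hv, h4⟩ := ih
    set L : (ℕ → ℝ) → ℝ := fun x => ∑ j ∈ S, c j * x j with hL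
    have hind : IndepFun L (fun x => x i) (stepsLaw f) := by
      have h := indepFun_sum_stepsLaw (f := f) (Finset.disjoint_singleton_right.2 hi) c fun _ => 1
      simpa using h
    have hpow : ∀ k l : ℕ, IndepFun (fun x => L x ^ k) (fun x : ℕ → ℝ => x i ^ l) (stepsLaw f) :=
      fun k l => hind.comp (φ := fun y => y ^ k) (ψ := fun y => y ^ l) (by fun_prop) (by fun_prop)
    have hLm : Measurable L := measurable_sum_mul S c
    have hprodi : ∀ k ≤ 4, ∀ l, Integrable (fun x => L x ^ k * x i ^ l) (stepsLaw f) :=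
      fun k hk l => (hpow k l).integrable_mul (hint k hk) (integrable_eval_pow hf i l)
    have hprod : ∀ k l : ℕ, ∫ x, L x ^ k * x i ^ l ∂(stepsLaw f) =
        (∫ x, L x ^ k ∂(stepsLaw f)) * ∫ x, x i ^ l ∂(stepsLaw f) := fun k l =>
      (hpow k l).integral_fun_mul_eq_mul_integral (hLm.pow_const k).aestronglyMeasurable
        ((measurable_pi_apply i).pow_const l).aestronglyMeasurable
    have hsum : ∀ x : ℕ → ℝ, ∑ j ∈ insert i S, c j * x j = L x + c i * x i := fun x => by
      rw [Finset.sum_insert hi, add_comm]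
    have hexp : ∀ (n : ℕ) (x : ℕ → ℝ), (L x + c i * x i) ^ n =
        ∑ k ∈ Finset.range (n + 1), (n.choose k * c i ^ (n - k)) * (L x ^ k * x i ^ (n - k)) := by
      intro n x
      rw [add_pow]
      refine Finset.sum_congr rfl fun k _ => ?_
      rw [mul_pow]
      ring
    have hexpint : ∀ n ≤ 4, ∫ x, (L x + c i * x i) ^ n ∂(stepsLaw f) =
        ∑ k ∈ Finset.range (n + 1), (n.choose k * c i ^ (n - k)) *
          ((∫ x, L x ^ k ∂(stepsLaw f)) * ∫ x, x i ^ (n - k) ∂(stepsLaw f)) := by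
      intro n hn
      simp only [hexp]
      rw [integral_finsetSum _ fun k hk =>
        (hprodi k (by have := Finset.mem_range.1 hk; omega) (n - k)).const_mul _]
      refine Finset.sum_congr rfl fun k _ => ?_
      rw [integral_const_mul, hprod]
    simp only [hsum]
    have hsq : ∑ j ∈ insert i S, c j ^ 2 = ∑ j ∈ S, c j ^ 2 + c i ^ 2 := by
      rw [Finset.sum_insert hi, add_comm]
    rw [hsq]
    set A := ∑ j ∈ S, c j ^ 2 with hA
    have hA0 : 0 ≤ A := Finset.sum_nonneg fun _ _ => sq_nonneg _
    have hv' : ∫ x, L x ^ 2 ∂(stepsLaw f) = m2 * A := hv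
    have h4' : ∫ x, L x ^ 4 ∂(stepsLaw f) ≤ (m4 + 3 * m2 ^ 2) * A ^ 2 := h4
    refine ⟨fun n hn => ?_, ?_, ?_⟩
    · simp only [hexp]
      exact integrable_finsetSum _ fun k hk =>
        (hprodi k (by have := Finset.mem_range.1 hk; omega) (n - k)).const_mul _
    · rw [hexpint 2 (by norm_num)]
      simp only [Finset.sum_range_succ, Finset.sum_range_zero, hv']
      simp [hm1, integral_eval_pow, ← hm2]
      ring
    · rw [hexpint 4 le_rfl]
      simp only [Finset.sum_range_succ, Finset.sum_range_zero, hv']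
      norm_num [Nat.choose, hm1, hm3]
      rw [integral_eval_pow, integral_eval_pow, ← hm2, ← hm4]
      nlinarith [mul_nonneg hm4' (mul_nonneg hA0 (sq_nonneg (c i))),
        mul_nonneg (sq_nonneg m2) (sq_nonneg (c i ^ 2))]

end Steps

/-! ### The interpolated walk as a function of the steps -/

/-- The weight of the step `j` in the interpolated walk at time `u`. -/
noncomputable def stepWeight (u : ℝ) (j : ℕ) : ℝ := max 0 (min 1 (u - j))

lemma stepWeight_nonneg (u : ℝ) (j : ℕ) : 0 ≤ stepWeight u j := le_max_left _ _

lemma stepWeight_le_one (u : ℝ) (j : ℕ) : stepWeight u j ≤ 1 :=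
  max_le zero_le_one (min_le_left _ _)

lemma stepWeight_mono {u v : ℝ} (h : u ≤ v) (j : ℕ) : stepWeight u j ≤ stepWeight v j :=
  max_le_max le_rfl (min_le_min le_rfl (by linarith))

lemma stepWeight_eq_one {u : ℝ} {j : ℕ} (h : (j : ℝ) + 1 ≤ u) : stepWeight u j = 1 := by
  rw [stepWeight, min_eq_left (by linarith), max_eq_right zero_le_one]

lemma stepWeight_eq_zero {u : ℝ} {j : ℕ} (h : u ≤ j) : stepWeight u j = 0 := by
  rw [stepWeight, max_eq_left ((min_le_right _ _).trans (by linarith))]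

lemma continuous_stepWeight (j : ℕ) : Continuous fun u => stepWeight u j := by
  unfold stepWeight; fun_prop

lemma sum_stepWeight {u : ℝ} (hu : 0 ≤ u) {M : ℕ} (hM : u ≤ M) :
    ∑ j ∈ Finset.range M, stepWeight u j = u := by
  have h := interpolate_eq_sum (fun k => (k : ℝ)) M u hu hM
  simp only [interpolate, Nat.cast_add, Nat.cast_one, add_sub_cancel_left, mul_one, one_mul,
    Nat.cast_zero, zero_add, add_sub_cancel] at h
  exact h.symm

lemma mul_mem_of_unitInterval (N : ℕ) (t : I) : 0 ≤ (N : ℝ) * t ∧ (N : ℝ) * t ≤ N :=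
  ⟨mul_nonneg N.cast_nonneg t.2.1, mul_le_of_le_one_right N.cast_nonneg t.2.2⟩

lemma interpolatedPath_apply (w : ℕ → ℝ) (N : ℕ) (t : I) :
    interpolatedPath w N t =
      w 0 + ∑ k ∈ Finset.range N, (w (k + 1) - w k) * stepWeight (N * t) k :=
  interpolate_eq_sum w N _ (mul_mem_of_unitInterval N t).1 (mul_mem_of_unitInterval N t).2

lemma interpolatedPath_walk_apply (a : ℝ) (x : ℕ → ℝ) (N : ℕ) (t : I) :
    interpolatedPath (walk a x) N t =
      a + ∑ k ∈ Finset.range N, stepWeight (N * t) k * x k := by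
  rw [interpolatedPath_apply]
  congr 1
  · simp [walk]
  · refine Finset.sum_congr rfl fun k _ => ?_
    rw [walk_succ]
    ring

lemma rescaledPair_fst_apply (sd a b : ℝ) (N : ℕ) (x : ℕ → ℝ) (t : I) :
    (rescaledPair sd a b N x).1 t =
      a / (sd * √N) + ∑ k ∈ Finset.range N, stepWeight (N * t) k / (sd * √N) * x k := by
  simp only [rescaledPair, ContinuousMap.smul_apply, smul_eq_mul, interpolatedPath_walk_apply]
  rw [mul_add, Finset.mul_sum, div_eq_inv_mul]
  congr 1
  refine Finset.sum_congr rfl fun k _ => ?_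
  rw [div_eq_inv_mul]
  ring

lemma continuous_interpolatedPath (N : ℕ) : Continuous fun w : ℕ → ℝ => interpolatedPath w N := by
  refine ContinuousMap.continuous_of_continuous_uncurry _ ?_
  have h : (Function.uncurry fun (w : ℕ → ℝ) (t : I) => interpolatedPath w N t) = fun p =>
      p.1 0 + ∑ k ∈ Finset.range N, (p.1 (k + 1) - p.1 k) * stepWeight (N * p.2) k := by
    funext p
    exact interpolatedPath_apply p.1 N p.2
  rw [h]
  have := continuous_stepWeight
  fun_prop

lemma continuous_rescaledPair (sd a b : ℝ) (N : ℕ) : Continuous (rescaledPair sd a b N) := by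
  have h1 : Continuous fun x : ℕ → ℝ => interpolatedPath (walk a x) N :=
    (continuous_interpolatedPath N).comp (continuous_pi fun n => continuous_walk a n)
  have h2 : Continuous fun x : ℕ → ℝ => interpolatedPath (integratedWalk a b x) N :=
    (continuous_interpolatedPath N).comp (continuous_pi fun n => continuous_integratedWalk a b n)
  exact (h1.const_smul (sd * √(N : ℝ))⁻¹).prodMk
    (h2.const_smul (sd * (N : ℝ) ^ (3 / 2 : ℝ))⁻¹)

/-! ### The integrated walk and the integral of the interpolated walk -/

lemma interpolate_eq_of_mem {w : ℕ → ℝ} {k : ℕ} {u : ℝ} (h : (k : ℝ) ≤ u) (h' : u ≤ k + 1) :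
    interpolate w u = w k + (u - k) * (w (k + 1) - w k) := by
  have hu : 0 ≤ u := (Nat.cast_nonneg k).trans h
  rcases h'.lt_or_eq with h1 | h1
  · rw [interpolate, (Nat.floor_eq_iff hu).2 ⟨h, h1⟩]
  · have hf : ⌊u⌋₊ = k + 1 := by
      rw [h1]; exact_mod_cast Nat.floor_natCast (R := ℝ) (k + 1)
    simp only [interpolate, hf]
    rw [h1]; push_cast; ring

lemma intervalIntegrable_interpolate (w : ℕ → ℝ) {a b : ℝ} (ha : 0 ≤ a) (hb : 0 ≤ b) :
    IntervalIntegrable (interpolate w) volume a b := by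
  refine ContinuousOn.intervalIntegrable ?_
  set M := ⌈max a b⌉₊
  have h : Continuous fun u : ℝ => w 0 + ∑ k ∈ Finset.range M,
      (w (k + 1) - w k) * max 0 (min 1 (u - k)) := by fun_prop
  refine h.continuousOn.congr fun u hu => ?_
  rw [Set.mem_uIcc] at hu
  refine interpolate_eq_sum w M u ?_ (le_trans ?_ (Nat.le_ceil (max a b)))
  · rcases hu with h | h <;> linarith [h.1]
  · rcases hu with h | h
    · exact h.2.trans (le_max_right _ _)
    · exact h.2.trans (le_max_left _ _)

lemma integral_interpolate_natCast (w : ℕ → ℝ) (k : ℕ) :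
    ∫ u in (0 : ℝ)..k, interpolate w u =
      ∑ j ∈ Finset.range k, w (j + 1) - (w k - w 0) / 2 := by
  induction k with
  | zero => simp
  | succ k ih =>
    have h1 : ∫ u in (k : ℝ)..((k + 1 : ℕ) : ℝ), interpolate w u =
        ∫ u in (k : ℝ)..((k + 1 : ℕ) : ℝ), (w k + (u - k) * (w (k + 1) - w k)) := by
      refine intervalIntegral.integral_congr fun u hu => ?_
      rw [Set.uIcc_of_le (by push_cast; linarith)] at hu
      push_cast at hu
      exact interpolate_eq_of_mem hu.1 hu.2
    have h2 : ∫ u in (k : ℝ)..((k + 1 : ℕ) : ℝ), (w k + (u - k) * (w (k + 1) - w k)) =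
        (w k + w (k + 1)) / 2 := by
      rw [intervalIntegral.integral_add (by simp) (by
        apply Continuous.intervalIntegrable; fun_prop), intervalIntegral.integral_mul_const,
        intervalIntegral.integral_sub (by simp) (by simp), integral_id]
      simp
      ring
    rw [← intervalIntegral.integral_add_adjacent_intervals
      (intervalIntegrable_interpolate w le_rfl (Nat.cast_nonneg k))
      (intervalIntegrable_interpolate w (Nat.cast_nonneg k) (Nat.cast_nonneg _)), ih, h1, h2,
      Finset.sum_range_succ]
    ring

lemma abs_interpolate_le {w : ℕ → ℝ} {M : ℝ} {k : ℕ} (hk : |w k| ≤ M) (hk' : |w (k + 1)| ≤ M)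
    {u : ℝ} (h : (k : ℝ) ≤ u) (h' : u ≤ k + 1) : |interpolate w u| ≤ M := by
  rw [interpolate_eq_of_mem h h', abs_le]
  rw [abs_le] at hk hk'
  constructor <;> nlinarith [mul_nonneg (sub_nonneg.2 h) (sub_nonneg.2 hk'.2),
    mul_nonneg (sub_nonneg.2 h) (sub_nonneg.2 hk'.1),
    mul_nonneg (sub_nonneg.2 h') (sub_nonneg.2 hk.2),
    mul_nonneg (sub_nonneg.2 h') (sub_nonneg.2 hk.1)]

/-- The interpolation of the partial sums of `w` is close to the integral of the interpolation
of `w`: at integer times the difference telescopes. -/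
lemma abs_interpolate_sum_sub_integral_le {w : ℕ → ℝ} {M : ℝ} {N : ℕ}
    (hw : ∀ k ≤ N, |w k| ≤ M) {u : ℝ} (hu : 0 ≤ u) (huN : u ≤ N) :
    |interpolate (fun n => ∑ k ∈ Finset.range n, w (k + 1)) u - ∫ v in (0 : ℝ)..u, interpolate w v| ≤
      3 * M := by
  have hM : 0 ≤ M := (abs_nonneg _).trans (hw 0 (Nat.zero_le _))
  rcases N.eq_zero_or_pos with h0 | hpos
  · have : u = 0 := le_antisymm (by simpa [h0] using huN) hu
    simp [this, interpolate, hM]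
  obtain ⟨k, hkN, hk, hk'⟩ : ∃ k : ℕ, k + 1 ≤ N ∧ (k : ℝ) ≤ u ∧ u ≤ k + 1 := by
    rcases huN.lt_or_eq with h | h
    · exact ⟨⌊u⌋₊, (Nat.floor_lt hu).2 h, Nat.floor_le hu, (Nat.lt_floor_add_one u).le⟩
    · refine ⟨N - 1, by omega, ?_, ?_⟩ <;> rw [h, Nat.cast_sub hpos] <;> push_cast <;> linarith
  have hk0 : (0 : ℝ) ≤ k := Nat.cast_nonneg k
  rw [interpolate_eq_of_mem hk hk', ← intervalIntegral.integral_add_adjacent_intervals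
    (intervalIntegrable_interpolate w le_rfl hk0) (intervalIntegrable_interpolate w hk0 hu),
    integral_interpolate_natCast, Finset.sum_range_succ, add_sub_cancel_left]
  have h1 := hw k (by omega)
  have h2 := hw (k + 1) hkN
  have h3 := hw 0 (Nat.zero_le _)
  have h4 : |∫ v in (k : ℝ)..u, interpolate w v| ≤ M := by
    have h5 := intervalIntegral.norm_integral_le_of_norm_le_const (f := interpolate w) (C := M)
      (a := k) (b := u) (fun v hv => by
        rw [Set.uIoc_of_le hk] at hv
        exact abs_interpolate_le h1 h2 hv.1.le (hv.2.trans hk'))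
    rw [Real.norm_eq_abs, abs_of_nonneg (sub_nonneg.2 hk)] at h5
    refine h5.trans ?_
    nlinarith
  have h6 : |(u - k) * w (k + 1)| ≤ M := by
    rw [abs_mul, abs_of_nonneg (sub_nonneg.2 hk)]
    nlinarith [abs_nonneg (w (k + 1))]
  rw [abs_le] at *
  constructor <;> linarith [h1.1, h1.2, h3.1, h3.2, h4.1, h4.2, h6.1, h6.2]

/-- The second coordinate of the rescaled walk is the integral of the first up to a relative error of
order `1 / N`, for every realization. -/
lemma norm_rescaledPair_snd_sub_integralPath_le {sd : ℝ} (hsd : 0 < sd) (a : ℝ) {N : ℕ} (hN : 0 < N)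
    (x : ℕ → ℝ) :
    ‖(rescaledPair sd a 0 N x).2 - integralPath (rescaledPair sd a 0 N x).1‖ ≤
      3 / N * ‖(rescaledPair sd a 0 N x).1‖ := by
  have hNR : (0 : ℝ) < N := by exact_mod_cast hN
  set y := interpolatedPath (walk a x) N with hy
  have hy1 : (rescaledPair sd a 0 N x).1 = (sd * √(N : ℝ))⁻¹ • y := rfl
  have hc : 0 < (sd * √(N : ℝ))⁻¹ := by positivity
  have hwk : ∀ k ≤ N, |walk a x k| ≤ ‖y‖ := by
    intro k hk
    have ht : (k : ℝ) / N ∈ I := ⟨by positivity, by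
      rw [div_le_one hNR]; exact_mod_cast hk⟩
    have h := y.norm_coe_le_norm ⟨_, ht⟩
    have h1 : y ⟨_, ht⟩ = walk a x k := by
      change interpolate (walk a x) (N * ((k : ℝ) / N)) = _
      rw [mul_div_cancel₀ _ hNR.ne', interpolate_eq_of_mem le_rfl (by linarith)]
      ring
    rwa [h1, Real.norm_eq_abs] at h
  have hpow : (N : ℝ) ^ (3 / 2 : ℝ) = √(N : ℝ) * N := by
    rw [Real.sqrt_eq_rpow, show (3 / 2 : ℝ) = 1 / 2 + 1 by norm_num, Real.rpow_add hNR,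
      Real.rpow_one]
  rw [ContinuousMap.norm_le _ (by positivity)]
  intro t
  have hsub : integralPath (rescaledPair sd a 0 N x).1 t =
      (sd * √(N : ℝ))⁻¹ * ((N : ℝ)⁻¹ * ∫ v in (0 : ℝ)..(N * t), interpolate (walk a x) v) := by
    change ∫ s in (0 : ℝ)..t, (rescaledPair sd a 0 N x).1 (Set.projIcc 0 1 zero_le_one s) = _
    have h1 : ∫ s in (0 : ℝ)..t, (rescaledPair sd a 0 N x).1 (Set.projIcc 0 1 zero_le_one s) =
        ∫ s in (0 : ℝ)..t, (sd * √(N : ℝ))⁻¹ * interpolate (walk a x) (N * s) := by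
      refine intervalIntegral.integral_congr fun s hs => ?_
      rw [Set.uIcc_of_le t.2.1] at hs
      have hs' : s ∈ Set.Icc (0 : ℝ) 1 := ⟨hs.1, hs.2.trans t.2.2⟩
      simp only [hy1, Set.projIcc_of_mem zero_le_one hs', ContinuousMap.smul_apply, smul_eq_mul]
      rfl
    rw [h1, intervalIntegral.integral_const_mul, intervalIntegral.integral_comp_mul_left _ hNR.ne',
      mul_zero, smul_eq_mul]
  have hz : (rescaledPair sd a 0 N x).2 t = (sd * √(N : ℝ))⁻¹ * ((N : ℝ)⁻¹ *
      interpolate (fun n => ∑ k ∈ Finset.range n, walk a x (k + 1)) (N * t)) := by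
    change (sd * (N : ℝ) ^ (3 / 2 : ℝ))⁻¹ * interpolate (integratedWalk a 0 x) (N * t) = _
    have h1 : integratedWalk a 0 x = fun n => ∑ k ∈ Finset.range n, walk a x (k + 1) := by
      funext n
      simp [integratedWalk]
    rw [h1, hpow, ← mul_assoc sd, mul_inv, mul_assoc]
  have hb := abs_interpolate_sum_sub_integral_le hwk (mul_mem_of_unitInterval N t).1
    (mul_mem_of_unitInterval N t).2
  rw [ContinuousMap.sub_apply, hsub, hz, ← mul_sub, ← mul_sub, Real.norm_eq_abs, abs_mul, abs_mul,
    abs_of_pos hc, abs_of_pos (inv_pos.2 hNR), hy1, norm_smul, Real.norm_eq_abs, abs_of_pos hc]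
  calc (sd * √(N : ℝ))⁻¹ * ((N : ℝ)⁻¹ * _) ≤ (sd * √(N : ℝ))⁻¹ * ((N : ℝ)⁻¹ * (3 * ‖y‖)) := by
        gcongr
    _ = 3 / N * ((sd * √(N : ℝ))⁻¹ * ‖y‖) := by ring

/-! ### Riemann sums -/

lemma integral_floor (g : ℕ → ℝ) {N : ℕ} (hN : 0 < N) :
    ∫ u in (0 : ℝ)..1, g ⌊(N : ℝ) * u⌋₊ = (∑ j ∈ Finset.range N, g j) / N := by
  have hNR : (N : ℝ) ≠ 0 := by exact_mod_cast hN.ne'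
  have hae : ∀ k : ℕ, ∀ᵐ u ∂(volume.restrict (Set.Ioc (k : ℝ) ((k + 1 : ℕ) : ℝ))),
      g ⌊u⌋₊ = g k := by
    intro k
    have h1 : ∀ᵐ u : ℝ, u ≠ ((k + 1 : ℕ) : ℝ) := by
      simp [ae_iff]
    rw [ae_restrict_iff' measurableSet_Ioc]
    filter_upwards [h1] with u hu hu'
    congr 1
    rw [Nat.floor_eq_iff ((Nat.cast_nonneg k).trans hu'.1.le)]
    refine ⟨hu'.1.le, ?_⟩
    have := lt_of_le_of_ne hu'.2 hu
    push_cast at this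
    exact this
  have hint : ∀ k : ℕ, IntervalIntegrable (fun u : ℝ => g ⌊u⌋₊) volume (k : ℝ) ((k + 1 : ℕ) : ℝ) := by
    intro k
    rw [intervalIntegrable_iff_integrableOn_Ioc_of_le (by push_cast; linarith)]
    have h1 : IntegrableOn (fun _ : ℝ => g k) (Set.Ioc (k : ℝ) ((k + 1 : ℕ) : ℝ)) :=
      integrableOn_const (by simp)
    exact h1.congr ((hae k).mono fun u hu => hu.symm)
  have h := intervalIntegral.sum_integral_adjacent_intervals (n := N)
    (a := fun k : ℕ => (k : ℝ)) fun k _ => hint k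
  rw [intervalIntegral.integral_comp_mul_left (fun u => g ⌊u⌋₊) hNR, mul_zero, mul_one,
    ← Nat.cast_zero, ← h, smul_eq_mul, div_eq_inv_mul]
  congr 1
  refine Finset.sum_congr rfl fun k _ => ?_
  rw [intervalIntegral.integral_of_le (by push_cast; linarith), integral_congr_ae (hae k)]
  simp

/-- The density on `[0, 1]` of the linear functional `∑ θ_l B_{τ_l} + p.1 B_1 + p.2 I_1` with respect
to white noise. -/
noncomputable def profile {ι : Type*} [Fintype ι] (θ : ι → ℝ) (τ : ι → I) (p : ℝ × ℝ) (u : ℝ) : ℝ :=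
  ∑ l, θ l * (if u < τ l then 1 else 0) + (p.1 + p.2 * (1 - u))

/-- The variance of the linear functional `∑ θ_l B_{τ_l} + p.1 B_1 + p.2 I_1`. -/
noncomputable def profileVar {ι : Type*} [Fintype ι] (θ : ι → ℝ) (τ : ι → I) (p : ℝ × ℝ) : ℝ :=
  ∫ u in (0 : ℝ)..1, profile θ τ p u ^ 2

lemma tendsto_stepWeight_floor {N : ℕ → ℕ} (hN : Tendsto N atTop atTop) {t u : ℝ} (hu : 0 ≤ u)
    (hut : u ≠ t) : Tendsto (fun i => stepWeight (N i * t) ⌊(N i : ℝ) * u⌋₊) atTop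
      (𝓝 (if u < t then 1 else 0)) := by
  have hNR : Tendsto (fun i => (N i : ℝ)) atTop atTop := tendsto_natCast_atTop_atTop.comp hN
  rcases lt_or_gt_of_ne hut with h | h
  · rw [if_pos h]
    refine tendsto_const_nhds.congr' ?_
    filter_upwards [hNR.eventually_ge_atTop (t - u)⁻¹] with i hi
    refine (stepWeight_eq_one ?_).symm
    have h1 := Nat.floor_le (mul_nonneg (N i).cast_nonneg hu)
    have h2 : 1 ≤ (N i : ℝ) * (t - u) := by
      rwa [← div_le_iff₀ (by linarith), one_div]
    linarith
  · rw [if_neg h.not_gt]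
    refine tendsto_const_nhds.congr' ?_
    filter_upwards [hNR.eventually_ge_atTop (u - t)⁻¹] with i hi
    refine (stepWeight_eq_zero ?_).symm
    have h1 := Nat.lt_floor_add_one ((N i : ℝ) * u)
    have h2 : 1 ≤ (N i : ℝ) * (u - t) := by
      rwa [← div_le_iff₀ (by linarith), one_div]
    linarith

/-- The variances of the linear functionals of the rescaled walk are Riemann sums for the variance of
the same functional of Brownian motion. -/
lemma tendsto_sum_sq_div {ι : Type*} [Fintype ι] (θ : ι → ℝ) (τ : ι → I) (p : ℝ × ℝ)
    {N : ℕ → ℕ} (hN : Tendsto N atTop atTop) :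
    Tendsto (fun i => (∑ j ∈ Finset.range (N i),
      (∑ l, θ l * stepWeight (N i * τ l) j + endCoeff (N i) p j) ^ 2) / N i) atTop
      (𝓝 (profileVar θ τ p)) := by
  have hNR : Tendsto (fun i => (N i : ℝ)) atTop atTop := tendsto_natCast_atTop_atTop.comp hN
  have hpos : ∀ᶠ i in atTop, 0 < N i := hN.eventually_gt_atTop 0
  set F : ℕ → ℝ → ℝ := fun i u =>
    (∑ l, θ l * stepWeight (N i * τ l) ⌊(N i : ℝ) * u⌋₊ + endCoeff (N i) p ⌊(N i : ℝ) * u⌋₊) ^ 2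
    with hF
  have h1 : Tendsto (fun i => ∫ u in (0 : ℝ)..1, F i u) atTop (𝓝 (profileVar θ τ p)) := by
    refine intervalIntegral.tendsto_integral_filter_of_dominated_convergence
      (fun _ => (∑ l, |θ l| + (|p.1| + |p.2|)) ^ 2) ?_ ?_ ?_ ?_
    · refine Eventually.of_forall fun i => Measurable.aestronglyMeasurable ?_
      have h2 : Measurable fun j : ℕ =>
        (∑ l, θ l * stepWeight (N i * τ l) j + endCoeff (N i) p j) ^ 2 := measurable_from_nat
      have h3 : Measurable fun u : ℝ => ⌊(N i : ℝ) * u⌋₊ :=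
        Nat.measurable_floor.comp (measurable_const_mul _)
      exact h2.comp h3
    · filter_upwards [hpos] with i hi
      refine Eventually.of_forall fun u hu => ?_
      rw [Set.uIoc_of_le zero_le_one] at hu
      have hi' : (0 : ℝ) < N i := by exact_mod_cast hi
      rw [Real.norm_eq_abs, abs_pow]
      refine pow_le_pow_left₀ (abs_nonneg _) ((abs_add_le _ _).trans (add_le_add ?_ ?_)) 2
      · refine (Finset.abs_sum_le_sum_abs _ _).trans (Finset.sum_le_sum fun l _ => ?_)
        rw [abs_mul, abs_of_nonneg (stepWeight_nonneg _ _)]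
        exact mul_le_of_le_one_right (abs_nonneg _) (stepWeight_le_one _ _)
      · refine (abs_add_le _ _).trans (add_le_add le_rfl ?_)
        rw [abs_mul]
        refine mul_le_of_le_one_right (abs_nonneg _) ?_
        have h5 : (⌊(N i : ℝ) * u⌋₊ : ℝ) ≤ N i := by
          refine (Nat.floor_le (by nlinarith [hu.1])).trans ?_
          nlinarith [hu.2]
        rw [abs_of_nonneg (div_nonneg (by linarith) hi'.le), div_le_one hi']
        linarith [Nat.cast_nonneg (α := ℝ) ⌊(N i : ℝ) * u⌋₊]
    · simp
    · have h6 : ∀ᵐ u : ℝ, ∀ l, u ≠ τ l := ae_all_iff.2 fun l => by simp [ae_iff]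
      filter_upwards [h6] with u hu hu'
      rw [Set.uIoc_of_le zero_le_one] at hu'
      refine Tendsto.pow (Tendsto.add (tendsto_finsetSum _ fun l _ =>
        (tendsto_stepWeight_floor hN hu'.1.le (hu l)).const_mul _) ?_) 2
      have h7 : Tendsto (fun i => (⌊u * (N i : ℝ)⌋₊ : ℝ) / N i) atTop (𝓝 u) :=
        (tendsto_nat_floor_mul_div_atTop hu'.1.le).comp hNR
      refine (((h7.const_sub 1).const_mul p.2).const_add p.1).congr' ?_
      filter_upwards [hpos] with i hi
      have hi' : (N i : ℝ) ≠ 0 := by exact_mod_cast hi.ne'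
      rw [endCoeff, sub_div, div_self hi', mul_comm u]
  refine h1.congr' ?_
  filter_upwards [hpos] with i hi
  exact integral_floor (fun j => (∑ l, θ l * stepWeight (N i * τ l) j + endCoeff (N i) p j) ^ 2) hi

/-! ### Weighted characteristic functions of the walk -/

section Limit

variable {f : ℝ → ℝ} [IsProbabilityMeasure (densityLaw f)]

lemma continuous_weightedChar (sd : ℝ) (N : ℕ) {G : (ℕ → ℝ) → ℂ} (hG : Continuous G) {C : ℝ}
    (hC : ∀ x, ‖G x‖ ≤ C) : Continuous (weightedChar f sd N G) := by
  unfold weightedChar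
  refine continuous_of_dominated (bound := fun _ => C) (fun p => ?_) (fun p => ?_)
    (integrable_const _) (Eventually.of_forall fun x => ?_)
  · exact (hG.mul (by fun_prop)).aestronglyMeasurable
  · refine Eventually.of_forall fun x => ?_
    rw [norm_mul, Complex.norm_exp_ofReal_mul_I, mul_one]
    exact hC x
  · unfold endCoeff
    fun_prop

lemma integrable_bound (C : ℝ) : Integrable fun p : ℝ × ℝ => C * (1 + ‖p‖) ^ (-3 : ℝ) :=
  (integrable_one_add_norm (by
    rw [Module.finrank_prod, Module.finrank_self]; norm_num)).const_mul C

/-- The exponential `exp (i ∑ θ_l y(τ_l))`, whose mean is a characteristic function of a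
finite-dimensional distribution of the path `y`. -/
noncomputable def expFunctional {ι : Type*} [Fintype ι] (θ : ι → ℝ) (τ : ι → I) (y : C(I, ℝ)) : ℂ :=
  Complex.exp (((∑ l, θ l * y (τ l) : ℝ) : ℂ) * Complex.I)

lemma norm_expFunctional {ι : Type*} [Fintype ι] (θ : ι → ℝ) (τ : ι → I) (y : C(I, ℝ)) :
    ‖expFunctional θ τ y‖ = 1 := Complex.norm_exp_ofReal_mul_I _

lemma continuous_expFunctional {ι : Type*} [Fintype ι] (θ : ι → ℝ) (τ : ι → I) :
    Continuous (expFunctional θ τ) := by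
  unfold expFunctional
  have : ∀ l, Continuous fun y : C(I, ℝ) => y (τ l) := fun l => continuous_eval_const _
  fun_prop

lemma weightedChar_expFunctional {ι : Type*} [Fintype ι] (θ : ι → ℝ) (τ : ι → I) (sd a b : ℝ)
    (N : ℕ) (p : ℝ × ℝ) :
    weightedChar f sd N (fun x => expFunctional θ τ (rescaledPair sd a b N x).1) p =
      Complex.exp (((a / (sd * √N) * ∑ l, θ l : ℝ) : ℂ) * Complex.I) *
        ∏ j ∈ Finset.range N, charFun (densityLaw f)
          ((∑ l, θ l * stepWeight (N * τ l) j + endCoeff N p j) / (sd * √N)) := by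
  rw [weightedChar, ← integral_exp_sum_stepsLaw, ← integral_const_mul]
  refine integral_congr_ae (Eventually.of_forall fun x => ?_)
  simp only [expFunctional, rescaledPair_fst_apply]
  rw [← Complex.exp_add, ← Complex.exp_add, ← add_mul, ← add_mul, ← Complex.ofReal_add,
    ← Complex.ofReal_add]
  congr 3
  simp only [mul_add, Finset.sum_add_distrib, add_assoc]
  congr 1
  · rw [Finset.mul_sum]
    exact Finset.sum_congr rfl fun l _ => mul_comm _ _
  · simp only [Finset.mul_sum]
    rw [Finset.sum_comm, ← Finset.sum_add_distrib]
    refine Finset.sum_congr rfl fun j _ => ?_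
    rw [add_div, add_mul, Finset.sum_div, Finset.sum_mul]
    congr 1
    refine Finset.sum_congr rfl fun l _ => ?_
    ring

/-- A bound for the characteristic functions of the walk that is integrable and uniform in `N`. -/
lemma exists_norm_weightedChar_expFunctional_le (hf : IsStepDensity f) {sd : ℝ} (hsd : 0 < sd)
    {ι : Type*} [Fintype ι] (θ : ι → ℝ) (τ : ι → I) :
    ∃ (C : ℝ) (N₀ : ℕ), 0 < C ∧ ∀ N : ℕ, N₀ ≤ N → ∀ (a b : ℝ) (p : ℝ × ℝ),
      ‖weightedChar f sd N (fun x => expFunctional θ τ (rescaledPair sd a b N x).1) p‖ ≤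
        C * (1 + ‖p‖) ^ (-3 : ℝ) := by
  obtain ⟨C, N₀, hC, h⟩ := hf.exists_prod_charFun_le hsd (Θ := ∑ l, |θ l|)
    (Finset.sum_nonneg fun _ _ => abs_nonneg _)
  refine ⟨C, max N₀ 2, hC, fun N hN a b p => ?_⟩
  have hN1 : N₀ ≤ N := (le_max_left _ _).trans hN
  have hN2 : 2 ≤ N := (le_max_right _ _).trans hN
  have h1 := h N hN1 0 (N / 2) (by omega) (by omega)
    (fun j => ∑ l, θ l * stepWeight (N * τ l) j) (fun j =>
      (Finset.abs_sum_le_sum_abs _ _).trans (Finset.sum_le_sum fun l _ => by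
        rw [abs_mul, abs_of_nonneg (stepWeight_nonneg _ _)]
        exact mul_le_of_le_one_right (abs_nonneg _) (stepWeight_le_one _ _))) p
  rw [weightedChar_expFunctional, norm_mul, Complex.norm_exp_ofReal_mul_I, one_mul, norm_prod]
  refine le_trans ?_ h1
  refine Finset.prod_le_prod_of_subset_of_le_one (fun j hj => ?_) (fun _ _ => norm_nonneg _)
    fun j _ _ => hf.norm_charFun_le_one _
  have := Finset.mem_Ico.1 hj
  exact Finset.mem_range.2 (by omega)

lemma integrable_weightedChar_of_le {sd : ℝ} {N : ℕ} {G : (ℕ → ℝ) → ℂ} (hG : Continuous G)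
    {C C' : ℝ} (hC : ∀ x, ‖G x‖ ≤ C)
    (h : ∀ p, ‖weightedChar f sd N G p‖ ≤ C' * (1 + ‖p‖) ^ (-3 : ℝ)) :
    Integrable (weightedChar f sd N G) :=
  (integrable_bound C').mono' (continuous_weightedChar sd N hG hC).aestronglyMeasurable
    (Eventually.of_forall h)

lemma continuous_expFunctional_rescaledPair {ι : Type*} [Fintype ι] (θ : ι → ℝ) (τ : ι → I)
    (sd a b : ℝ) (N : ℕ) :
    Continuous fun x => expFunctional θ τ (rescaledPair sd a b N x).1 :=
  (continuous_expFunctional θ τ).comp (continuous_rescaledPair sd a b N).fst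

/-- The Fourier integrals of exponential functionals of the rescaled walk converge. -/
lemma tendsto_weightedInt_expFunctional (hf : IsStepDensity f) {ι : Type*} [Fintype ι] (θ : ι → ℝ)
    (τ : ι → I) {N : ℕ → ℕ} (hN : Tendsto N atTop atTop) {a : ℕ → ℝ} {b : ℝ} {R : ℝ}
    (ha : ∀ i, |a i| ≤ R) {z : ℕ → ℝ × ℝ} (hz : Tendsto z atTop (𝓝 0)) {sd : ℝ}
    (hsd : sd = √(∫ x, x ^ 2 ∂(densityLaw f))) :
    Tendsto (fun i => weightedInt f sd (N i)
      (fun x => expFunctional θ τ (rescaledPair sd (a i) b (N i) x).1) (z i)) atTop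
      (𝓝 (∫ p : ℝ × ℝ, ((Real.exp (-profileVar θ τ p / 2) : ℝ) : ℂ))) := by
  have hsd0 : 0 < sd := by rw [hsd]; exact Real.sqrt_pos.2 hf.integral_sq_pos
  obtain ⟨C, N₀, hC, hbd⟩ := exists_norm_weightedChar_expFunctional_le hf hsd0 θ τ
  have hNR : Tendsto (fun i => (N i : ℝ)) atTop atTop := tendsto_natCast_atTop_atTop.comp hN
  unfold weightedInt
  refine tendsto_integral_filter_of_dominated_convergence
    (fun p => C * (1 + ‖p‖) ^ (-3 : ℝ)) ?_ ?_ (integrable_bound C) ?_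
  · refine Eventually.of_forall fun i => Continuous.aestronglyMeasurable ?_
    have := continuous_weightedChar (f := f) sd (N i)
      (continuous_expFunctional_rescaledPair θ τ sd (a i) b (N i))
      (fun x => (norm_expFunctional θ τ _).le)
    fun_prop
  · filter_upwards [hN.eventually_ge_atTop N₀] with i hi
    refine Eventually.of_forall fun p => ?_
    rw [norm_mul, Complex.norm_exp_ofReal_mul_I, one_mul]
    exact hbd (N i) hi (a i) b p
  · refine Eventually.of_forall fun p => ?_
    have h1 : Tendsto (fun i => Complex.exp
        (((-(p.1 * (z i).1 + p.2 * (z i).2) : ℝ) : ℂ) * Complex.I)) atTop (𝓝 1) := by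
      have hc : Continuous fun q : ℝ × ℝ => Complex.exp
        (((-(p.1 * q.1 + p.2 * q.2) : ℝ) : ℂ) * Complex.I) := by fun_prop
      have := (hc.tendsto 0).comp hz
      simpa [Function.comp_def] using this
    have h2 : Tendsto (fun i => Complex.exp
        (((a i / (sd * √(N i)) * ∑ l, θ l : ℝ) : ℂ) * Complex.I)) atTop (𝓝 1) := by
      have h3 : Tendsto (fun i => a i / (sd * √(N i))) atTop (𝓝 0) := by
        have h4 : Tendsto (fun i => R / (sd * √(N i))) atTop (𝓝 0) :=
          ((Real.tendsto_sqrt_atTop.comp hNR).const_mul_atTop hsd0).const_div_atTop R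
        refine squeeze_zero_norm (fun i => ?_) h4
        rw [Real.norm_eq_abs, abs_div, abs_of_nonneg (by positivity : 0 ≤ sd * √(N i : ℝ))]
        exact div_le_div_of_nonneg_right (ha i) (by positivity)
      have hc : Continuous fun q : ℝ => Complex.exp (((q * ∑ l, θ l : ℝ) : ℂ) * Complex.I) := by
        fun_prop
      have := (hc.tendsto 0).comp h3
      simpa [Function.comp_def] using this
    -- the profile is only evaluated at the steps before `N i`
    set h : ℕ → ℕ → ℝ := fun i j => if j < N i then
      ∑ l, θ l * stepWeight (N i * τ l) j + endCoeff (N i) p j else 0 with hh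
    have hH : ∀ i j, |h i j| ≤ ∑ l, |θ l| + (|p.1| + |p.2|) := by
      intro i j
      rw [hh]
      simp only
      split_ifs with hj
      · have hi' : (0 : ℝ) < N i := by exact_mod_cast (Nat.zero_le j).trans_lt hj
        have hj' : (j : ℝ) ≤ N i := by exact_mod_cast hj.le
        refine (abs_add_le _ _).trans (add_le_add ?_ ?_)
        · refine (Finset.abs_sum_le_sum_abs _ _).trans (Finset.sum_le_sum fun l _ => ?_)
          rw [abs_mul, abs_of_nonneg (stepWeight_nonneg _ _)]
          exact mul_le_of_le_one_right (abs_nonneg _) (stepWeight_le_one _ _)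
        · refine (abs_add_le _ _).trans (add_le_add le_rfl ?_)
          rw [abs_mul]
          refine mul_le_of_le_one_right (abs_nonneg _) ?_
          rw [abs_of_nonneg (div_nonneg (by linarith) hi'.le), div_le_one hi']
          linarith [Nat.cast_nonneg (α := ℝ) j]
      · rw [abs_zero]
        positivity
    have hv : Tendsto (fun i => (∑ j ∈ Finset.range (N i), h i j ^ 2) / N i) atTop
        (𝓝 (profileVar θ τ p)) := by
      refine (tendsto_sum_sq_div θ τ p hN).congr fun i => ?_
      congr 1
      refine Finset.sum_congr rfl fun j hj => ?_
      rw [hh]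
      simp only
      rw [if_pos (Finset.mem_range.1 hj)]
    have h5 := hf.tendsto_prod_charFun hN hH hv
    have h6 := h1.mul (h2.mul h5)
    rw [one_mul, one_mul] at h6
    refine h6.congr fun i => ?_
    rw [weightedChar_expFunctional]
    congr 2
    refine Finset.prod_congr rfl fun j hj => ?_
    rw [hh, ← hsd]
    simp only
    rw [if_pos (Finset.mem_range.1 hj)]

/-- The truncated fourth power. It is bounded, so that its mean under a conditional law is a quotient
of Fourier integrals. -/
noncomputable def truncPow (y : ℝ) : ℝ := min |y| 1 ^ 4

lemma continuous_truncPow : Continuous truncPow := by unfold truncPow; fun_prop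

lemma truncPow_nonneg (y : ℝ) : 0 ≤ truncPow y := by unfold truncPow; positivity

lemma truncPow_le_one (y : ℝ) : truncPow y ≤ 1 :=
  pow_le_one₀ (le_min (abs_nonneg _) zero_le_one) (min_le_right _ _)

lemma truncPow_le (y : ℝ) : truncPow y ≤ y ^ 4 := by
  rw [truncPow, ← Even.pow_abs (by decide : Even 4) y]
  exact pow_le_pow_left₀ (le_min (abs_nonneg _) zero_le_one) (min_le_left _ _) 4

/-- The moment bound for increments, jointly with the characteristic function of the terminal value.
A time interval of length at most `1 / 4` is disjoint from a block of a quarter of the steps. The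
increment and the characteristic function of the block are independent; the first contributes
`(t - s) ^ 2`, the second the integrable decay in `p`. -/
lemma exists_norm_weightedChar_increment_le (hf : IsStepDensity f) {sd : ℝ} (hsd : 0 < sd) :
    ∃ (C : ℝ) (N₀ : ℕ), 0 < C ∧ ∀ N : ℕ, N₀ ≤ N → ∀ (a b : ℝ) (s t : I), s ≤ t →
      (t : ℝ) - s ≤ 1 / 4 → ∀ p : ℝ × ℝ,
        ‖weightedChar f sd N (fun x => ((truncPow ((rescaledPair sd a b N x).1 t -
          (rescaledPair sd a b N x).1 s) : ℝ) : ℂ)) p‖ ≤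
            (C * ((t : ℝ) - s) ^ 2) * (1 + ‖p‖) ^ (-3 : ℝ) := by
  obtain ⟨C₁, N₀, hC₁, hblock⟩ := hf.exists_prod_charFun_le hsd le_rfl
  obtain ⟨C₂, hC₂, hmom⟩ := exists_integral_sum_pow_four_le hf
  refine ⟨C₂ / sd ^ 4 * C₁, max N₀ 64, by positivity, ?_⟩
  intro N hN a b s t hst hts p
  have hN1 : N₀ ≤ N := (le_max_left _ _).trans hN
  have hN2 : 64 ≤ N := (le_max_right _ _).trans hN
  have hN0 : 0 < N := by omega
  have hNR : (0 : ℝ) < N := by exact_mod_cast hN0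
  have hNR' : (64 : ℝ) ≤ N := by exact_mod_cast hN2
  set e : ℕ → ℝ := fun j => stepWeight (N * t) j - stepWeight (N * s) j with he
  have hmul : (N : ℝ) * s ≤ N * t := mul_le_mul_of_nonneg_left hst hNR.le
  have he0 : ∀ j, 0 ≤ e j := fun j => sub_nonneg.2 (stepWeight_mono hmul j)
  have he1 : ∀ j, e j ≤ 1 := fun j => by
    have h1 := stepWeight_le_one (N * (t : ℝ)) j
    have h2 := stepWeight_nonneg (N * (s : ℝ)) j
    simp only [he]
    linarith
  -- a block of steps that do not contribute to the increment: the last ones if `t ≤ 5 / 8`, and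
  -- otherwise, since then `s ≥ 3 / 8`, the first ones
  obtain ⟨m, q, hmq, hNq, hz⟩ : ∃ m q : ℕ, m + 2 * q ≤ N ∧ N ≤ 8 * q ∧
      ∀ j ∈ Finset.Ico m (m + 2 * q), e j = 0 := by
    rcases le_or_gt (t : ℝ) (5 / 8) with h | h
    · refine ⟨5 * N / 8 + 1, N / 8 + 1, by omega, by omega, fun j hj => ?_⟩
      have hj1 : 5 * N / 8 + 1 ≤ j := (Finset.mem_Ico.1 hj).1
      have hj2 : 5 * N ≤ 8 * j := by omega
      have hj3 : 5 * (N : ℝ) ≤ 8 * j := by exact_mod_cast hj2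
      have hj4 : (N : ℝ) * t ≤ j := by nlinarith
      simp only [he]
      rw [stepWeight_eq_zero hj4, stepWeight_eq_zero (hmul.trans hj4), sub_zero]
    · refine ⟨0, N / 8 + 1, by omega, by omega, fun j hj => ?_⟩
      have hj1 : j < 0 + 2 * (N / 8 + 1) := (Finset.mem_Ico.1 hj).2
      have hj2 : 8 * (j + 1) ≤ 3 * N := by omega
      have hj3 : 8 * ((j : ℝ) + 1) ≤ 3 * N := by exact_mod_cast hj2
      have hj4 : (j : ℝ) + 1 ≤ N * s := by nlinarith
      simp only [he]
      rw [stepWeight_eq_one hj4, stepWeight_eq_one (hj4.trans hmul), sub_self]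
  set T := Finset.Ico m (m + 2 * q) with hT
  set S := Finset.range N \ T with hS
  have hTN : T ⊆ Finset.range N := fun j hj =>
    Finset.mem_range.2 ((Finset.mem_Ico.1 hj).2.trans_le hmq)
  have hdis : Disjoint S T := Finset.sdiff_disjoint
  have hU : S ∪ T = Finset.range N := Finset.sdiff_union_of_subset hTN
  have hincr : ∀ x : ℕ → ℝ, (rescaledPair sd a b N x).1 t - (rescaledPair sd a b N x).1 s =
      ∑ j ∈ S, e j / (sd * √N) * x j := by
    intro x
    rw [rescaledPair_fst_apply, rescaledPair_fst_apply, add_sub_add_left_eq_sub,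
      ← Finset.sum_sub_distrib, ← hU, Finset.sum_union hdis]
    rw [Finset.sum_eq_zero (s := T) fun j hj => by
      rw [← sub_mul, ← sub_div, show stepWeight (N * (t : ℝ)) j - stepWeight (N * (s : ℝ)) j = e j
        from rfl, hz j hj, zero_div, zero_mul], add_zero]
    refine Finset.sum_congr rfl fun j _ => ?_
    rw [← sub_mul, ← sub_div]
  have h1 := norm_integral_mul_exp_sum_le (f := f) hdis hU (fun j => e j / (sd * √N))
    (fun j => endCoeff N p j / (sd * √N)) continuous_truncPow
  have h2 := hblock N hN1 m q hmq hNq (fun _ => 0) (by simp) p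
  simp only [zero_add] at h2
  have h3 : ∫ x, |truncPow (∑ j ∈ S, e j / (sd * √N) * x j)| ∂(stepsLaw f) ≤
      C₂ / sd ^ 4 * ((t : ℝ) - s) ^ 2 := by
    obtain ⟨hi, hm⟩ := hmom S fun j => e j / (sd * √N)
    have h4 : ∑ j ∈ S, (e j / (sd * √N)) ^ 2 ≤ ((t : ℝ) - s) / sd ^ 2 := by
      have h5 : ∑ j ∈ S, e j ≤ N * ((t : ℝ) - s) := by
        calc ∑ j ∈ S, e j ≤ ∑ j ∈ Finset.range N, e j :=
              Finset.sum_le_sum_of_subset_of_nonneg Finset.sdiff_subset fun j _ _ => he0 j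
          _ = N * ((t : ℝ) - s) := by
              simp only [he]
              rw [Finset.sum_sub_distrib,
                sum_stepWeight (mul_mem_of_unitInterval N t).1 (mul_mem_of_unitInterval N t).2,
                sum_stepWeight (mul_mem_of_unitInterval N s).1 (mul_mem_of_unitInterval N s).2]
              ring
      calc ∑ j ∈ S, (e j / (sd * √N)) ^ 2 ≤ ∑ j ∈ S, e j / (sd ^ 2 * N) := by
            refine Finset.sum_le_sum fun j _ => ?_
            rw [div_pow, mul_pow, Real.sq_sqrt hNR.le]
            refine div_le_div_of_nonneg_right ?_ (by positivity)
            nlinarith [he0 j, he1 j]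
        _ = (∑ j ∈ S, e j) / (sd ^ 2 * N) := by rw [Finset.sum_div]
        _ ≤ N * ((t : ℝ) - s) / (sd ^ 2 * N) := div_le_div_of_nonneg_right h5 (by positivity)
        _ = ((t : ℝ) - s) / sd ^ 2 := by field_simp
    calc ∫ x, |truncPow (∑ j ∈ S, e j / (sd * √N) * x j)| ∂(stepsLaw f)
        ≤ ∫ x, (∑ j ∈ S, e j / (sd * √N) * x j) ^ 4 ∂(stepsLaw f) := by
          refine integral_mono_of_nonneg (Eventually.of_forall fun x => abs_nonneg _) hi
            (Eventually.of_forall fun x => ?_)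
          simp only
          rw [abs_of_nonneg (truncPow_nonneg _)]
          exact truncPow_le _
      _ ≤ C₂ * (∑ j ∈ S, (e j / (sd * √N)) ^ 2) ^ 2 := hm
      _ ≤ C₂ * (((t : ℝ) - s) / sd ^ 2) ^ 2 := by
          have : 0 ≤ ∑ j ∈ S, (e j / (sd * √N)) ^ 2 := Finset.sum_nonneg fun _ _ => sq_nonneg _
          gcongr
      _ = C₂ / sd ^ 4 * ((t : ℝ) - s) ^ 2 := by ring
  simp only [weightedChar, hincr]
  refine h1.trans ?_
  calc _ ≤ C₂ / sd ^ 4 * ((t : ℝ) - s) ^ 2 * (C₁ * (1 + ‖p‖) ^ (-3 : ℝ)) :=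
        mul_le_mul h3 h2 (Finset.prod_nonneg fun _ _ => norm_nonneg _) (by positivity)
    _ = _ := by ring

end Limit

/-! ### Measurability in path space -/

/-- The values of a path along a dense sequence of times. -/
noncomputable def denseEval (y : C(I, ℝ)) (k : ℕ) : ℝ := y (TopologicalSpace.denseSeq I k)

/-- As `C([0, 1])` is Polish, a path is a measurable function of countably many of its values. -/
lemma measurableEmbedding_denseEval : MeasurableEmbedding denseEval := by
  have hc : Continuous denseEval := continuous_pi fun k => continuous_eval_const _
  refine hc.measurableEmbedding fun y z h => ?_
  refine ContinuousMap.coe_injective (Continuous.ext_on (TopologicalSpace.denseRange_denseSeq I)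
    y.continuous z.continuous ?_)
  rintro _ ⟨k, rfl⟩
  exact congrFun h k

lemma exists_measurable_leftInverse_denseEval :
    ∃ g : (ℕ → ℝ) → C(I, ℝ), Measurable g ∧ ∀ y, g (denseEval y) = y := by
  obtain ⟨g, hg, h⟩ := measurableEmbedding_denseEval.exists_measurable_extend
    (measurable_id (α := C(I, ℝ))) fun _ => inferInstance
  exact ⟨g, hg, fun y => congrFun h y⟩

lemma aemeasurable_of_eval {Ω : Type*} [MeasurableSpace Ω] {P : Measure Ω} {B : Ω → C(I, ℝ)}
    (h : ∀ t : I, AEMeasurable (fun ω => B ω t) P) : AEMeasurable B P := by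
  obtain ⟨g, hg, hgi⟩ := exists_measurable_leftInverse_denseEval
  have h1 : AEMeasurable (fun ω => denseEval (B ω)) P := aemeasurable_pi_lambda _ fun k => h _
  have h2 := hg.comp_aemeasurable h1
  have h3 : g ∘ (fun ω => denseEval (B ω)) = B := funext fun ω => hgi (B ω)
  rwa [h3] at h2

lemma dist_integralPath_le (y z : C(I, ℝ)) :
    dist (integralPath y) (integralPath z) ≤ dist y z := by
  rw [ContinuousMap.dist_le dist_nonneg]
  intro t
  have hi : ∀ w : C(I, ℝ), IntervalIntegrable (fun s => w (Set.projIcc 0 1 zero_le_one s)) volume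
      (0 : ℝ) t := fun w => by
    have h : Continuous fun s : ℝ => w (Set.projIcc 0 1 zero_le_one s) := by fun_prop
    exact h.intervalIntegrable _ _
  change dist (∫ s in (0 : ℝ)..t, y (Set.projIcc 0 1 zero_le_one s))
    (∫ s in (0 : ℝ)..t, z (Set.projIcc 0 1 zero_le_one s)) ≤ _
  rw [Real.dist_eq, ← intervalIntegral.integral_sub (hi y) (hi z)]
  have h1 := intervalIntegral.norm_integral_le_of_norm_le_const (a := 0) (b := (t : ℝ))
    (C := dist y z) (f := fun s => y (Set.projIcc 0 1 zero_le_one s) -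
      z (Set.projIcc 0 1 zero_le_one s)) fun s _ => by
      rw [← dist_eq_norm]
      exact ContinuousMap.dist_apply_le_dist _
  rw [sub_zero, abs_of_nonneg t.2.1, Real.norm_eq_abs] at h1
  exact h1.trans (mul_le_of_le_one_right dist_nonneg t.2.2)

lemma continuous_integralPath : Continuous integralPath :=
  (LipschitzWith.of_dist_le_mul (K := 1) fun y z => by
    rw [NNReal.coe_one, one_mul]
    exact dist_integralPath_le y z).continuous

/-- The terminal value `(y(1), ∫_0^1 y)` of a path together with its integral. -/
noncomputable def pathEnd (y : C(I, ℝ)) : ℝ × ℝ := (y 1, integralPath y 1)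

lemma continuous_pathEnd : Continuous pathEnd :=
  (continuous_eval_const (1 : I)).prodMk
    ((continuous_eval_const (1 : I)).comp continuous_integralPath)

/-! ### The characteristic functional of Brownian motion -/

lemma intervalIntegrable_step (t : I) {g : ℝ → ℝ} (hg : Continuous g) (a b : ℝ) :
    IntervalIntegrable (fun u : ℝ => (if u < (t : ℝ) then (1 : ℝ) else 0) * g u) volume a b := by
  have h1 : (fun u : ℝ => (if u < (t : ℝ) then (1 : ℝ) else 0) * g u) =
      Set.indicator (Set.Iio (t : ℝ)) g := by
    funext u
    simp [Set.indicator_apply]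
  rw [h1, intervalIntegrable_iff]
  exact (intervalIntegrable_iff.1 (hg.intervalIntegrable a b)).indicator measurableSet_Iio

lemma integral_step_mul (t : I) {g : ℝ → ℝ} (hg : Continuous g) :
    ∫ u in (0 : ℝ)..1, (if u < (t : ℝ) then (1 : ℝ) else 0) * g u = ∫ u in (0 : ℝ)..t, g u := by
  rw [← intervalIntegral.integral_add_adjacent_intervals (b := (t : ℝ))
    (intervalIntegrable_step t hg _ _) (intervalIntegrable_step t hg _ _)]
  have h1 : ∫ u in (0 : ℝ)..t, (if u < (t : ℝ) then (1 : ℝ) else 0) * g u = ∫ u in (0 : ℝ)..t, g u := by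
    refine intervalIntegral.integral_congr_ae ?_
    have h : ∀ᵐ u : ℝ, u ≠ t := by simp [ae_iff]
    filter_upwards [h] with u hu hu'
    rw [Set.uIoc_of_le t.2.1] at hu'
    rw [if_pos (lt_of_le_of_ne hu'.2 hu), one_mul]
  have h2 : ∫ u in (t : ℝ)..1, (if u < (t : ℝ) then (1 : ℝ) else 0) * g u = 0 := by
    rw [intervalIntegral.integral_congr_ae (g := fun _ => 0)]
    · simp
    · refine Eventually.of_forall fun u hu' => ?_
      rw [Set.uIoc_of_le t.2.2] at hu'
      rw [if_neg hu'.1.not_gt, zero_mul]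
  rw [h1, h2, add_zero]

lemma integral_step_mul_step (s t : I) :
    ∫ u in (0 : ℝ)..1, (if u < (s : ℝ) then (1 : ℝ) else 0) * (if u < (t : ℝ) then (1 : ℝ) else 0) =
      min (s : ℝ) t := by
  have h1 : ∀ u : ℝ, (if u < (s : ℝ) then (1 : ℝ) else 0) * (if u < (t : ℝ) then (1 : ℝ) else 0) =
      (if u < ((s ⊓ t : I) : ℝ) then (1 : ℝ) else 0) * 1 := by
    intro u
    have : ((s ⊓ t : I) : ℝ) = min (s : ℝ) t := by
      rcases le_total s t with h | h
      · rw [inf_eq_left.2 h, min_eq_left (by exact_mod_cast h)]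
      · rw [inf_eq_right.2 h, min_eq_right (by exact_mod_cast h)]
    simp only [this, lt_min_iff]
    by_cases h1 : u < s <;> by_cases h2 : u < t <;> simp [h1, h2]
  simp only [h1]
  rw [integral_step_mul _ continuous_const, intervalIntegral.integral_const, sub_zero, smul_eq_mul,
    mul_one]
  rcases le_total s t with h | h
  · rw [inf_eq_left.2 h, min_eq_left (by exact_mod_cast h)]
  · rw [inf_eq_right.2 h, min_eq_right (by exact_mod_cast h)]

lemma profileVar_zero {ι : Type*} [Fintype ι] (θ : ι → ℝ) (τ : ι → I) :
    profileVar θ τ 0 = ∑ l, ∑ m, θ l * θ m * min (τ l : ℝ) (τ m) := by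
  have h1 : ∀ u, profile θ τ 0 u ^ 2 = ∑ l, ∑ m, θ l * θ m *
      ((if u < (τ l : ℝ) then (1 : ℝ) else 0) * (if u < (τ m : ℝ) then (1 : ℝ) else 0)) := by
    intro u
    simp only [profile, Prod.fst_zero, Prod.snd_zero, zero_mul, add_zero]
    rw [pow_two, Finset.sum_mul_sum]
    refine Finset.sum_congr rfl fun l _ => Finset.sum_congr rfl fun m _ => ?_
    ring
  have hi : ∀ l m, IntervalIntegrable (fun u : ℝ => θ l * θ m *
      ((if u < (τ l : ℝ) then (1 : ℝ) else 0) * (if u < (τ m : ℝ) then (1 : ℝ) else 0))) volume 0 1 := by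
    intro l m
    refine IntervalIntegrable.const_mul ?_ _
    have h2 := intervalIntegrable_step (τ m) (continuous_const (y := (1 : ℝ))) 0 1
    simp only [mul_one] at h2
    rw [intervalIntegrable_iff] at h2 ⊢
    refine (h2.indicator (measurableSet_Iio (a := (τ l : ℝ)))).congr (Eventually.of_forall fun u => ?_)
    by_cases h3 : u < τ l <;> simp [h3]
  rw [profileVar]
  simp only [h1]
  rw [intervalIntegral.integral_finsetSum fun l _ => by
    have := IntervalIntegrable.sum Finset.univ fun m _ => hi l m
    simpa only [Finset.sum_fn] using this]
  refine Finset.sum_congr rfl fun l _ => ?_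
  rw [intervalIntegral.integral_finsetSum fun m _ => hi l m]
  refine Finset.sum_congr rfl fun m _ => ?_
  rw [intervalIntegral.integral_const_mul, integral_step_mul_step]

/-- The law on `C([0, 1])` of a Brownian motion, described by its characteristic functional. -/
def IsBrownianLaw (W : Measure C(I, ℝ)) : Prop :=
  ∀ {ι : Type} [Fintype ι] (θ : ι → ℝ) (τ : ι → I),
    ∫ y, expFunctional θ τ y ∂W = ((Real.exp (-profileVar θ τ 0 / 2) : ℝ) : ℂ)

lemma IsBrownianMotion.aemeasurable {Ω : Type*} [MeasurableSpace Ω] {P : Measure Ω}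
    {B : Ω → C(I, ℝ)} (hB : IsBrownianMotion B P) : AEMeasurable B P :=
  aemeasurable_of_eval fun t => hB.gaussian.aemeasurable t

lemma IsBrownianMotion.isBrownianLaw {Ω : Type*} [MeasurableSpace Ω] {P : Measure Ω}
    [IsProbabilityMeasure P] {B : Ω → C(I, ℝ)} (hB : IsBrownianMotion B P) :
    IsBrownianLaw (P.map B) := by
  intro ι _ θ τ
  have hg : HasGaussianLaw (fun ω => ∑ l, θ l * B ω (τ l)) P :=
    ((hB.gaussian.comp_right τ).smul θ).hasGaussianLaw_fun_sum
  have hm : ∀ t : I, MemLp (fun ω => B ω t) 2 P := fun t =>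
    (hB.gaussian.hasGaussianLaw_eval t).memLp_two
  have hmean : ∫ ω, ∑ l, θ l * B ω (τ l) ∂P = 0 := by
    rw [integral_finsetSum _ fun l _ => ((hm (τ l)).integrable one_le_two).const_mul _]
    simp [integral_const_mul, hB.mean]
  have hvar : Var[fun ω => ∑ l, θ l * B ω (τ l); P] = profileVar θ τ 0 := by
    rw [variance_fun_sum (X := fun l ω => θ l * B ω (τ l)) fun l => (hm (τ l)).const_mul (θ l),
      profileVar_zero]
    refine Finset.sum_congr rfl fun l _ => Finset.sum_congr rfl fun m _ => ?_
    rw [covariance_const_mul_left, covariance_const_mul_right, hB.covariance]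
    ring
  have h1 := hg.map_eq_gaussianReal
  rw [hmean, hvar] at h1
  have h2 := charFun_gaussianReal (μ := 0) (v := (profileVar θ τ 0).toNNReal) 1
  rw [← h1, charFun_apply_real, integral_map hg.aemeasurable (by fun_prop)] at h2
  rw [integral_map hB.aemeasurable (continuous_expFunctional θ τ).aestronglyMeasurable]
  have hv0 : 0 ≤ profileVar θ τ 0 := hvar ▸ variance_nonneg _ _
  simp only [expFunctional]
  simp only [Complex.ofReal_one, one_mul, Complex.ofReal_zero, mul_zero, zero_mul, zero_sub,
    one_pow, mul_one] at h2
  rw [h2, Real.coe_toNNReal _ hv0]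
  push_cast
  rw [neg_div]

/-! ### Brownian motion jointly with its integral -/

/-- The time `(k + 1) / M`, projected to `[0, 1]`. -/
noncomputable def gridTime (M k : ℕ) : I := Set.projIcc 0 1 zero_le_one (((k : ℝ) + 1) / M)

lemma coe_gridTime {M k : ℕ} (hk : k < M) : (gridTime M k : ℝ) = ((k : ℝ) + 1) / M := by
  have hM : (0 : ℝ) < M := by exact_mod_cast (Nat.zero_le k).trans_lt hk
  have hk' : (k : ℝ) + 1 ≤ M := by exact_mod_cast hk
  rw [gridTime, Set.projIcc_of_mem zero_le_one ⟨by positivity, (div_le_one hM).2 hk'⟩]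

lemma tendsto_sum_gridTime (y : C(I, ℝ)) :
    Tendsto (fun M : ℕ => (∑ k ∈ Finset.range M, y (gridTime M k)) / M) atTop
      (𝓝 (integralPath y 1)) := by
  have h1 : Tendsto (fun M : ℕ => ∫ u in (0 : ℝ)..1, y (gridTime M ⌊(M : ℝ) * u⌋₊)) atTop
      (𝓝 (∫ u in (0 : ℝ)..1, y (Set.projIcc 0 1 zero_le_one u))) := by
    refine intervalIntegral.tendsto_integral_filter_of_dominated_convergence (fun _ => ‖y‖) ?_ ?_ ?_ ?_
    · refine Eventually.of_forall fun M => Measurable.aestronglyMeasurable ?_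
      have h2 : Measurable fun j : ℕ => y (gridTime M j) := measurable_from_nat
      exact h2.comp (Nat.measurable_floor.comp (measurable_const_mul _))
    · exact Eventually.of_forall fun M => Eventually.of_forall fun u _ => y.norm_coe_le_norm _
    · simp
    · refine Eventually.of_forall fun u hu => ?_
      rw [Set.uIoc_of_le zero_le_one] at hu
      have hc : Continuous fun s : ℝ => y (Set.projIcc 0 1 zero_le_one s) := by fun_prop
      refine (hc.tendsto u).comp ?_
      have h7 : Tendsto (fun M : ℕ => (⌊u * (M : ℝ)⌋₊ : ℝ) / M) atTop (𝓝 u) :=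
        (tendsto_nat_floor_mul_div_atTop hu.1.le).comp tendsto_natCast_atTop_atTop
      have h8 := h7.add (tendsto_one_div_atTop_nhds_zero_nat (𝕜 := ℝ))
      rw [add_zero] at h8
      refine h8.congr fun M => ?_
      rw [mul_comm u, add_div]
  refine h1.congr' ?_
  filter_upwards [eventually_gt_atTop 0] with M hM
  exact integral_floor (fun k => y (gridTime M k)) hM

lemma sum_step_gridTime {M : ℕ} {u : ℝ} (hu : 0 ≤ u) (hu1 : u ≤ 1) :
    ∑ k : Fin M, (if u < (gridTime M k : ℝ) then (1 : ℝ) else 0) = M - ⌊(M : ℝ) * u⌋₊ := by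
  have h1 : ∀ k : Fin M, (if u < (gridTime M k : ℝ) then (1 : ℝ) else 0) =
      if ⌊(M : ℝ) * u⌋₊ ≤ (k : ℕ) then 1 else 0 := by
    intro k
    have hM : (0 : ℝ) < M := by exact_mod_cast (Nat.zero_le k).trans_lt k.2
    have h2 : u < (gridTime M k : ℝ) ↔ ⌊(M : ℝ) * u⌋₊ ≤ (k : ℕ) := by
      rw [coe_gridTime k.2, lt_div_iff₀ hM, ← Nat.lt_succ_iff,
        Nat.floor_lt (mul_nonneg hM.le hu), mul_comm u]
      push_cast
      rfl
    simp only [h2]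
  have hle : ⌊(M : ℝ) * u⌋₊ ≤ M := Nat.floor_le_of_le (mul_le_of_le_one_right M.cast_nonneg hu1)
  rw [Finset.sum_congr rfl fun k _ => h1 k,
    Fin.sum_univ_eq_sum_range (fun k => if ⌊(M : ℝ) * u⌋₊ ≤ k then (1 : ℝ) else 0) M,
    Finset.sum_boole, ← Nat.cast_sub hle, ← Nat.card_Ico]
  congr 2
  ext k
  simp [and_comm]

lemma measurable_profile {ι : Type*} [Fintype ι] (θ : ι → ℝ) (τ : ι → I) (p : ℝ × ℝ) :
    Measurable (profile θ τ p) := by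
  unfold profile
  refine Measurable.add (Finset.measurable_sum _ fun l _ => ?_) (by fun_prop)
  exact (Measurable.ite measurableSet_Iio measurable_const measurable_const).const_mul _

lemma abs_profile_le {ι : Type*} [Fintype ι] (θ : ι → ℝ) (τ : ι → I) (p : ℝ × ℝ) {u : ℝ}
    (hu : 0 ≤ u) (hu1 : u ≤ 1) : |profile θ τ p u| ≤ ∑ l, |θ l| + (|p.1| + |p.2|) := by
  refine (abs_add_le _ _).trans (add_le_add ?_ ((abs_add_le _ _).trans (add_le_add le_rfl ?_)))
  · refine (Finset.abs_sum_le_sum_abs _ _).trans (Finset.sum_le_sum fun l _ => ?_)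
    rw [abs_mul]
    refine mul_le_of_le_one_right (abs_nonneg _) ?_
    split_ifs <;> simp
  · rw [abs_mul, abs_of_nonneg (by linarith : 0 ≤ 1 - u)]
    exact mul_le_of_le_one_right (abs_nonneg _) (by linarith)

/-- The joint characteristic functional of a Brownian motion and of its terminal value with its
integral. -/
lemma IsBrownianLaw.integral_expFunctional_mul {W : Measure C(I, ℝ)} [IsProbabilityMeasure W]
    (hW : IsBrownianLaw W) {ι : Type} [Fintype ι] (θ : ι → ℝ) (τ : ι → I) (p : ℝ × ℝ) :
    ∫ y, expFunctional θ τ y * Complex.exp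
        (((p.1 * (pathEnd y).1 + p.2 * (pathEnd y).2 : ℝ) : ℂ) * Complex.I) ∂W =
      ((Real.exp (-profileVar θ τ p / 2) : ℝ) : ℂ) := by
  -- approximate the integral of the path by Riemann sums
  set θ' : (M : ℕ) → ι ⊕ (Unit ⊕ Fin M) → ℝ := fun M =>
    Sum.elim θ (Sum.elim (fun _ => p.1) fun _ => p.2 / M) with hθ'
  set τ' : (M : ℕ) → ι ⊕ (Unit ⊕ Fin M) → I := fun M =>
    Sum.elim τ (Sum.elim (fun _ => 1) fun k => gridTime M k) with hτ'
  have hexp : ∀ (M : ℕ) (y : C(I, ℝ)), expFunctional (θ' M) (τ' M) y =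
      expFunctional θ τ y * Complex.exp (((p.1 * y 1 +
        p.2 * ((∑ k ∈ Finset.range M, y (gridTime M k)) / M) : ℝ) : ℂ) * Complex.I) := by
    intro M y
    rw [expFunctional, expFunctional, ← Complex.exp_add, ← add_mul, ← Complex.ofReal_add]
    congr 3
    simp only [hθ', hτ', Fintype.sum_sum_type, Sum.elim_inl, Sum.elim_inr, Finset.univ_unique,
      Finset.sum_singleton]
    rw [← Finset.mul_sum, Fin.sum_univ_eq_sum_range (fun k => y (gridTime M k)) M]
    ring
  have hleft : Tendsto (fun M => ∫ y, expFunctional (θ' M) (τ' M) y ∂W) atTop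
      (𝓝 (∫ y, expFunctional θ τ y * Complex.exp
        (((p.1 * (pathEnd y).1 + p.2 * (pathEnd y).2 : ℝ) : ℂ) * Complex.I) ∂W)) := by
    refine tendsto_integral_of_dominated_convergence (fun _ => 1) (fun M => ?_)
      (integrable_const _) (fun M => ?_) ?_
    · exact (continuous_expFunctional _ _).aestronglyMeasurable
    · exact Eventually.of_forall fun y => (norm_expFunctional _ _ y).le
    · refine Eventually.of_forall fun y => ?_
      simp only [hexp]
      have hc : Continuous fun x : ℝ => expFunctional θ τ y *
          Complex.exp (((p.1 * y 1 + p.2 * x : ℝ) : ℂ) * Complex.I) := by fun_prop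
      exact (hc.tendsto _).comp (tendsto_sum_gridTime y)
  have hright : Tendsto (fun M => profileVar (θ' M) (τ' M) 0) atTop (𝓝 (profileVar θ τ p)) := by
    unfold profileVar
    refine intervalIntegral.tendsto_integral_filter_of_dominated_convergence
      (fun _ => (∑ l, |θ l| + (|p.1| + |p.2|)) ^ 2) ?_ ?_ ?_ ?_
    · exact Eventually.of_forall fun M =>
        ((measurable_profile _ _ _).pow_const 2).aestronglyMeasurable
    · filter_upwards [eventually_gt_atTop 0] with M hM
      refine Eventually.of_forall fun u hu => ?_
      rw [Set.uIoc_of_le zero_le_one] at hu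
      have hM' : (0 : ℝ) < M := by exact_mod_cast hM
      rw [Real.norm_eq_abs, abs_pow]
      refine pow_le_pow_left₀ (abs_nonneg _) ((abs_profile_le _ _ _ hu.1.le hu.2).trans ?_) 2
      simp only [hθ', Fintype.sum_sum_type, Sum.elim_inl, Sum.elim_inr, Finset.univ_unique,
        Finset.sum_const, Finset.card_univ, Fintype.card_fin, nsmul_eq_mul,
        Prod.fst_zero, Prod.snd_zero, abs_zero, add_zero, abs_div, Nat.abs_cast]
      simp [mul_div_cancel₀ _ hM'.ne']
    · simp
    · have h6 : ∀ᵐ u : ℝ, u ≠ 1 := by simp [ae_iff]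
      filter_upwards [h6] with u hu hu'
      rw [Set.uIoc_of_le zero_le_one] at hu'
      have hu1 : u < ((1 : I) : ℝ) := lt_of_le_of_ne hu'.2 hu
      refine Tendsto.pow ?_ 2
      have h7 : Tendsto (fun M : ℕ => (⌊u * (M : ℝ)⌋₊ : ℝ) / M) atTop (𝓝 u) :=
        (tendsto_nat_floor_mul_div_atTop hu'.1.le).comp tendsto_natCast_atTop_atTop
      refine ((((h7.const_sub 1).const_mul p.2).const_add p.1).const_add
        (∑ l, θ l * (if u < τ l then 1 else 0))).congr' ?_
      filter_upwards [eventually_gt_atTop 0] with M hM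
      have hM' : (M : ℝ) ≠ 0 := by exact_mod_cast hM.ne'
      rw [profile, Fintype.sum_sum_type, Fintype.sum_sum_type]
      change _ = ∑ l, θ l * (if u < τ l then 1 else 0) + (∑ _l : Unit,
        p.1 * (if u < ((1 : I) : ℝ) then 1 else 0) + ∑ k : Fin M, p.2 / M *
          (if u < (gridTime M k : ℝ) then 1 else 0)) + (0 + 0 * (1 - u))
      rw [← Finset.mul_sum _ _ (p.2 / (M : ℝ)), sum_step_gridTime hu'.1.le hu'.2, if_pos hu1, mul_one,
        mul_comm u, Fintype.sum_unique (ι := Unit), zero_mul, add_zero, add_zero]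
      field_simp
  refine tendsto_nhds_unique hleft ?_
  have h9 : ∀ M, ∫ y, expFunctional (θ' M) (τ' M) y ∂W =
      ((Real.exp (-profileVar (θ' M) (τ' M) 0 / 2) : ℝ) : ℂ) := fun M => hW (θ' M) (τ' M)
  simp only [h9]
  exact (Complex.continuous_ofReal.tendsto _).comp
    ((Real.continuous_exp.tendsto _).comp (hright.neg.div_const 2))

/-! ### The bridge and its independence of the terminal value -/

/-- The regression coefficient of `B_t` on `B_1`. -/
def bridgeCoeff₁ (t : ℝ) : ℝ := 3 * t ^ 2 - 2 * t

/-- The regression coefficient of `B_t` on `I_1`. -/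
def bridgeCoeff₂ (t : ℝ) : ℝ := 6 * t * (1 - t)

/-- The path `t ↦ s (3 t² - 2 t) + r (6 t (1 - t))`, which ends at `s` and has integral `r`. -/
noncomputable def bridgeShift (t : ℝ × ℝ) : C(I, ℝ) where
  toFun u := t.1 * bridgeCoeff₁ u + t.2 * bridgeCoeff₂ u
  continuous_toFun := by unfold bridgeCoeff₁ bridgeCoeff₂; fun_prop

lemma bridgeShift_apply (t : ℝ × ℝ) (u : I) :
    bridgeShift t u = t.1 * bridgeCoeff₁ u + t.2 * bridgeCoeff₂ u := rfl

lemma continuous_bridgeShift : Continuous bridgeShift := by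
  refine ContinuousMap.continuous_of_continuous_uncurry _ ?_
  have h : (Function.uncurry fun (t : ℝ × ℝ) (u : I) => bridgeShift t u) = fun q =>
      q.1.1 * bridgeCoeff₁ q.2 + q.1.2 * bridgeCoeff₂ q.2 := rfl
  rw [h]
  unfold bridgeCoeff₁ bridgeCoeff₂
  fun_prop

/-- The path `y` minus its regression on `(y(1), ∫_0^1 y)`. For a Brownian motion this is the
Brownian motion conditioned on `(B_1, I_1) = (0, 0)`. -/
noncomputable def bridge (y : C(I, ℝ)) : C(I, ℝ) := y - bridgeShift (pathEnd y)

lemma continuous_bridge : Continuous bridge :=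
  continuous_id.sub (continuous_bridgeShift.comp continuous_pathEnd)

/-- The change of the coefficients of `(B_1, I_1)` when `B` is replaced by its bridge. -/
noncomputable def regression {ι : Type*} [Fintype ι] (θ : ι → ℝ) (τ : ι → I) : ℝ × ℝ :=
  (-∑ l, θ l * bridgeCoeff₁ (τ l), -∑ l, θ l * bridgeCoeff₂ (τ l))

/-- The variance of `p.1 B_1 + p.2 I_1`. -/
noncomputable def endVar (p : ℝ × ℝ) : ℝ := ∫ u in (0 : ℝ)..1, (p.1 + p.2 * (1 - u)) ^ 2

lemma integral_quadratic (a b c t : ℝ) :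
    ∫ u in (0 : ℝ)..t, (a - b * u + c * u ^ 2) = a * t - b * t ^ 2 / 2 + c * t ^ 3 / 3 := by
  rw [intervalIntegral.integral_add (by apply Continuous.intervalIntegrable; fun_prop)
    (by apply Continuous.intervalIntegrable; fun_prop), intervalIntegral.integral_sub (by simp)
    (by apply Continuous.intervalIntegrable; fun_prop), intervalIntegral.integral_const_mul,
    intervalIntegral.integral_const_mul, integral_id, integral_pow, intervalIntegral.integral_const]
  simp only [smul_eq_mul]
  norm_num
  ring

lemma endVar_eq (p : ℝ × ℝ) : endVar p = p.1 ^ 2 + p.1 * p.2 + p.2 ^ 2 / 3 := by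
  have h1 : ∀ u : ℝ, (p.1 + p.2 * (1 - u)) ^ 2 =
      (p.1 + p.2) ^ 2 - (2 * (p.1 + p.2) * p.2) * u + p.2 ^ 2 * u ^ 2 := fun u => by ring
  unfold endVar
  simp only [h1, integral_quadratic]
  ring

/-- Orthogonality of the bridge and of the terminal value, in terms of their densities with respect to
white noise. -/
lemma integral_profile_regression_mul {ι : Type*} [Fintype ι] (θ : ι → ℝ) (τ : ι → I)
    (p : ℝ × ℝ) :
    ∫ u in (0 : ℝ)..1, profile θ τ (regression θ τ) u * (p.1 + p.2 * (1 - u)) = 0 := by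
  have hg : Continuous fun u : ℝ => p.1 + p.2 * (1 - u) := by fun_prop
  have h1 : ∀ u, profile θ τ (regression θ τ) u * (p.1 + p.2 * (1 - u)) =
      ∑ l, θ l * ((if u < (τ l : ℝ) then (1 : ℝ) else 0) * (p.1 + p.2 * (1 - u)) -
        (bridgeCoeff₁ (τ l) + bridgeCoeff₂ (τ l) * (1 - u)) * (p.1 + p.2 * (1 - u))) := by
    intro u
    simp only [profile, regression]
    rw [add_mul, Finset.sum_mul, ← Finset.sum_neg_distrib, ← Finset.sum_neg_distrib, Finset.sum_mul,
      ← Finset.sum_add_distrib, Finset.sum_mul, ← Finset.sum_add_distrib]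
    refine Finset.sum_congr rfl fun l _ => ?_
    ring
  have hi : ∀ t : I, IntervalIntegrable (fun u : ℝ => (bridgeCoeff₁ t + bridgeCoeff₂ t * (1 - u)) *
      (p.1 + p.2 * (1 - u))) volume 0 1 := fun t => by
    apply Continuous.intervalIntegrable; fun_prop
  simp only [h1]
  rw [intervalIntegral.integral_finsetSum fun l _ =>
    ((intervalIntegrable_step (τ l) hg 0 1).sub (hi (τ l))).const_mul _]
  refine Finset.sum_eq_zero fun l _ => ?_
  rw [intervalIntegral.integral_const_mul,
    intervalIntegral.integral_sub (intervalIntegrable_step (τ l) hg 0 1) (hi (τ l)),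
    integral_step_mul (τ l) hg]
  have h2 : ∀ u : ℝ, (bridgeCoeff₁ (τ l) + bridgeCoeff₂ (τ l) * (1 - u)) * (p.1 + p.2 * (1 - u)) =
      (bridgeCoeff₁ (τ l) + bridgeCoeff₂ (τ l)) * (p.1 + p.2) -
        (bridgeCoeff₂ (τ l) * (p.1 + p.2) + (bridgeCoeff₁ (τ l) + bridgeCoeff₂ (τ l)) * p.2) * u +
        bridgeCoeff₂ (τ l) * p.2 * u ^ 2 := fun u => by ring
  have h3 : ∀ u : ℝ, p.1 + p.2 * (1 - u) = (p.1 + p.2) - p.2 * u + 0 * u ^ 2 := fun u => by ring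
  rw [intervalIntegral.integral_congr fun u _ => h2 u, intervalIntegral.integral_congr fun u _ => h3 u,
    integral_quadratic, integral_quadratic]
  simp only [bridgeCoeff₁, bridgeCoeff₂]
  ring

/-- The variance splits: the bridge is uncorrelated with the terminal value. -/
lemma profileVar_regression_add {ι : Type*} [Fintype ι] (θ : ι → ℝ) (τ : ι → I) (p : ℝ × ℝ) :
    profileVar θ τ (regression θ τ + p) = profileVar θ τ (regression θ τ) + endVar p := by
  have hg : Continuous fun u : ℝ => p.1 + p.2 * (1 - u) := by fun_prop
  have hb : ∀ {g : ℝ → ℝ}, Measurable g → (∃ C, ∀ u, 0 ≤ u → u ≤ 1 → |g u| ≤ C) →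
      IntervalIntegrable g volume 0 1 := by
    rintro g hgm ⟨C, hC⟩
    rw [intervalIntegrable_iff_integrableOn_Ioc_of_le zero_le_one]
    refine Measure.integrableOn_of_bounded (M := C) (by simp) hgm.aestronglyMeasurable ?_
    rw [ae_restrict_iff' measurableSet_Ioc]
    exact Eventually.of_forall fun u hu => hC u hu.1.le hu.2
  set A := profile θ τ (regression θ τ) with hA
  have hAm : Measurable A := measurable_profile _ _ _
  obtain ⟨C, hC⟩ : ∃ C, ∀ u, 0 ≤ u → u ≤ 1 → |A u| ≤ C :=
    ⟨_, fun u h h' => abs_profile_le θ τ (regression θ τ) h h'⟩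
  have hℓ : ∀ u : ℝ, 0 ≤ u → u ≤ 1 → |p.1 + p.2 * (1 - u)| ≤ |p.1| + |p.2| := fun u h h' => by
    have := abs_profile_le (ι := Empty) (fun _ => 0) (fun _ => 0) p h h'
    simpa [profile] using this
  have hi1 : IntervalIntegrable (fun u => A u ^ 2) volume 0 1 := hb (hAm.pow_const 2)
    ⟨C ^ 2, fun u h h' => by
      rw [abs_pow]; exact pow_le_pow_left₀ (abs_nonneg _) (hC u h h') 2⟩
  have hi2 : IntervalIntegrable (fun u => A u * (p.1 + p.2 * (1 - u))) volume 0 1 :=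
    hb (hAm.mul hg.measurable) ⟨C * (|p.1| + |p.2|), fun u h h' => by
      rw [abs_mul]
      exact mul_le_mul (hC u h h') (hℓ u h h') (abs_nonneg _) ((abs_nonneg _).trans (hC u h h'))⟩
  have hi3 : IntervalIntegrable (fun u : ℝ => (p.1 + p.2 * (1 - u)) ^ 2) volume 0 1 := by
    apply Continuous.intervalIntegrable; fun_prop
  have h1 : ∀ u, profile θ τ (regression θ τ + p) u ^ 2 =
      A u ^ 2 + 2 * (A u * (p.1 + p.2 * (1 - u))) + (p.1 + p.2 * (1 - u)) ^ 2 := by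
    intro u
    simp only [hA, profile, Prod.fst_add, Prod.snd_add]
    ring
  unfold profileVar endVar
  simp only [h1]
  rw [intervalIntegral.integral_add (hi1.add (hi2.const_mul 2)) hi3,
    intervalIntegral.integral_add hi1 (hi2.const_mul 2), intervalIntegral.integral_const_mul,
    integral_profile_regression_mul, mul_zero, add_zero]

/-- The joint characteristic functional of the bridge and the terminal value factorizes. -/
lemma IsBrownianLaw.integral_bridge_mul {W : Measure C(I, ℝ)} [IsProbabilityMeasure W]
    (hW : IsBrownianLaw W) {ι : Type} [Fintype ι] (θ : ι → ℝ) (τ : ι → I) (p : ℝ × ℝ) :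
    ∫ y, expFunctional θ τ (bridge y) * Complex.exp
        (((p.1 * (pathEnd y).1 + p.2 * (pathEnd y).2 : ℝ) : ℂ) * Complex.I) ∂W =
      ((Real.exp (-profileVar θ τ (regression θ τ) / 2) : ℝ) : ℂ) *
        ((Real.exp (-endVar p / 2) : ℝ) : ℂ) := by
  rw [← Complex.ofReal_mul, ← Real.exp_add, ← add_div, ← neg_add, ← profileVar_regression_add,
    ← hW.integral_expFunctional_mul]
  refine integral_congr_ae (Eventually.of_forall fun y => ?_)
  simp only [expFunctional]
  rw [← Complex.exp_add, ← Complex.exp_add, ← add_mul, ← add_mul, ← Complex.ofReal_add,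
    ← Complex.ofReal_add]
  congr 3
  have h1 : ∑ l, θ l * bridge y (τ l) = ∑ l, θ l * y (τ l) +
      ((regression θ τ).1 * (pathEnd y).1 + (regression θ τ).2 * (pathEnd y).2) := by
    simp only [bridge, ContinuousMap.sub_apply, bridgeShift_apply, regression, neg_mul]
    rw [Finset.sum_mul, Finset.sum_mul, ← neg_add, ← Finset.sum_add_distrib, ← sub_eq_add_neg,
      ← Finset.sum_sub_distrib]
    refine Finset.sum_congr rfl fun l _ => ?_
    ring
  rw [h1, Prod.fst_add, Prod.snd_add]
  ring

lemma profileVar_zero_left {ι : Type*} [Fintype ι] (τ : ι → I) (p : ℝ × ℝ) :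
    profileVar (fun _ => 0) τ p = endVar p := by
  simp [profileVar, profile, endVar]

lemma regression_zero_left {ι : Type*} [Fintype ι] (τ : ι → I) :
    regression (fun _ => 0) τ = 0 := by
  simp [regression]

lemma endVar_zero : endVar 0 = 0 := by simp [endVar]

lemma IsBrownianLaw.indepFun_bridge_pathEnd {W : Measure C(I, ℝ)} [IsProbabilityMeasure W]
    (hW : IsBrownianLaw W) : IndepFun bridge pathEnd W := by
  have hev : ∀ t : I, Continuous fun y : C(I, ℝ) => y t := fun t => continuous_eval_const t
  have hbm : ∀ k, Measurable fun y => denseEval (bridge y) k := fun k =>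
    ((hev _).comp continuous_bridge).measurable
  have hproc : IndepFun (fun y k => denseEval (bridge y) k) pathEnd W := by
    refine IndepFun.process_indepFun hbm continuous_pathEnd.measurable fun J => ?_
    have hX : Measurable fun (y : C(I, ℝ)) (i : J) => denseEval (bridge y) i :=
      measurable_pi_lambda _ fun i => hbm i
    rw [indepFun_iff_charFunDual_prod hX.aemeasurable continuous_pathEnd.measurable.aemeasurable]
    intro L
    set θ : J → ℝ := fun j => L (Pi.single j 1, 0) with hθ
    set τ : J → I := fun j => TopologicalSpace.denseSeq I j with hτ
    set p : ℝ × ℝ := (L (0, (1, 0)), L (0, (0, 1))) with hp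
    have hL1 : ∀ x : J → ℝ, L (x, 0) = ∑ j, θ j * x j := by
      intro x
      have h := LinearMap.pi_apply_eq_sum_univ (L.comp (.inl ℝ (J → ℝ) (ℝ × ℝ))).toLinearMap x
      have h2 : ∀ j : J, (L.comp (.inl ℝ (J → ℝ) (ℝ × ℝ))).toLinearMap
          (fun k => if j = k then 1 else 0) = θ j := fun j => by
        have : (fun k => if j = k then (1 : ℝ) else 0) = Pi.single j 1 := by
          funext k
          simp [Pi.single_apply, eq_comm]
        rw [this]
        rfl
      simp only [h2, smul_eq_mul] at h
      rw [show L (x, 0) = (L.comp (.inl ℝ (J → ℝ) (ℝ × ℝ))).toLinearMap x from rfl, h]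
      exact Finset.sum_congr rfl fun j _ => mul_comm _ _
    have hL2 : ∀ t : ℝ × ℝ, L (0, t) = p.1 * t.1 + p.2 * t.2 := by
      intro t
      have h : ((0 : J → ℝ), t) = t.1 • ((0 : J → ℝ), ((1 : ℝ), (0 : ℝ))) +
          t.2 • ((0 : J → ℝ), ((0 : ℝ), (1 : ℝ))) := by
        ext <;> simp
      rw [h, map_add, map_smul, map_smul, smul_eq_mul, smul_eq_mul]
      ring
    have hL : ∀ (x : J → ℝ) (t : ℝ × ℝ), L (x, t) = ∑ j, θ j * x j + (p.1 * t.1 + p.2 * t.2) := by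
      intro x t
      rw [← hL1, ← hL2, ← map_add]
      simp
    have hXY : Measurable fun y : C(I, ℝ) =>
        ((fun i : J => denseEval (bridge y) i), pathEnd y) :=
      hX.prodMk continuous_pathEnd.measurable
    rw [charFunDual_apply, charFunDual_apply, charFunDual_apply,
      integral_map hXY.aemeasurable (by fun_prop), integral_map hX.aemeasurable (by fun_prop),
      integral_map continuous_pathEnd.measurable.aemeasurable (by fun_prop)]
    have e1 : ∫ y, Complex.exp ((L ((fun i : J => denseEval (bridge y) i), pathEnd y) : ℂ) *
        Complex.I) ∂W = ((Real.exp (-profileVar θ τ (regression θ τ) / 2) : ℝ) : ℂ) *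
        ((Real.exp (-endVar p / 2) : ℝ) : ℂ) := by
      rw [← hW.integral_bridge_mul]
      refine integral_congr_ae (Eventually.of_forall fun y => ?_)
      simp only
      rw [hL, Complex.ofReal_add, add_mul, Complex.exp_add]
      rfl
    have e2 : ∫ y, Complex.exp (((L.comp (.inl ℝ (J → ℝ) (ℝ × ℝ)))
        (fun i : J => denseEval (bridge y) i) : ℂ) * Complex.I) ∂W =
        ((Real.exp (-profileVar θ τ (regression θ τ) / 2) : ℝ) : ℂ) := by
      have h := hW.integral_bridge_mul θ τ 0
      rw [endVar_zero, neg_zero, zero_div, Real.exp_zero, Complex.ofReal_one, mul_one] at h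
      rw [← h]
      refine integral_congr_ae (Eventually.of_forall fun y => ?_)
      simp only [Prod.fst_zero, Prod.snd_zero, zero_mul, add_zero, Complex.ofReal_zero,
        Complex.exp_zero, mul_one, expFunctional]
      congr 3
      exact hL1 _
    have e3 : ∫ y, Complex.exp (((L.comp (.inr ℝ (J → ℝ) (ℝ × ℝ))) (pathEnd y) : ℂ) *
        Complex.I) ∂W = ((Real.exp (-endVar p / 2) : ℝ) : ℂ) := by
      have h := hW.integral_bridge_mul (fun _ : J => 0) τ p
      rw [regression_zero_left, profileVar_zero_left, endVar_zero, neg_zero, zero_div, Real.exp_zero,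
        Complex.ofReal_one, one_mul] at h
      rw [← h]
      refine integral_congr_ae (Eventually.of_forall fun y => ?_)
      simp only [expFunctional, zero_mul, Finset.sum_const_zero, Complex.ofReal_zero,
        Complex.exp_zero, one_mul]
      congr 3
      exact hL2 _
    exact e1.trans (by rw [← e2, ← e3])
  obtain ⟨g, hg, hgi⟩ := exists_measurable_leftInverse_denseEval
  have h2 := hproc.comp hg measurable_id
  have h3 : (g ∘ fun y k => denseEval (bridge y) k) = bridge := funext fun y => hgi (bridge y)
  rwa [h3] at h2

/-! ### The law of the terminal value of Brownian motion -/

/-- The vector `(B_1, I_1)` has the law of `(U, U / 2 + V)` with independent centred Gaussian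
variables `U` and `V` of variances `1` and `1 / 12`. -/
lemma IsBrownianLaw.map_pathEnd {W : Measure C(I, ℝ)} [IsProbabilityMeasure W]
    (hW : IsBrownianLaw W) :
    W.map pathEnd = ((gaussianReal 0 1).prod (gaussianReal 0 (1 / 12))).map
      fun q : ℝ × ℝ => (q.1, q.1 / 2 + q.2) := by
  have hm : Measurable fun q : ℝ × ℝ => (q.1, q.1 / 2 + q.2) := by fun_prop
  have := Measure.isProbabilityMeasure_map (μ := W) continuous_pathEnd.measurable.aemeasurable
  have := Measure.isProbabilityMeasure_map (μ := (gaussianReal 0 1).prod (gaussianReal 0 (1 / 12)))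
    hm.aemeasurable
  refine Measure.ext_of_charFunDual ?_
  funext L
  set p : ℝ × ℝ := (L (1, 0), L (0, 1)) with hp
  have hL : ∀ t : ℝ × ℝ, L t = p.1 * t.1 + p.2 * t.2 := by
    intro t
    have h : t = t.1 • ((1 : ℝ), (0 : ℝ)) + t.2 • ((0 : ℝ), (1 : ℝ)) := by ext <;> simp
    conv_lhs => rw [h]
    rw [map_add, map_smul, map_smul, smul_eq_mul, smul_eq_mul]
    ring
  have e3 : ∫ y, Complex.exp ((L (pathEnd y) : ℂ) * Complex.I) ∂W =
      ((Real.exp (-endVar p / 2) : ℝ) : ℂ) := by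
    have h := hW.integral_bridge_mul (fun _ : Empty => 0) (fun _ => 0) p
    rw [regression_zero_left, profileVar_zero_left, endVar_zero, neg_zero, zero_div, Real.exp_zero,
      Complex.ofReal_one, one_mul] at h
    rw [← h]
    refine integral_congr_ae (Eventually.of_forall fun y => ?_)
    simp only [expFunctional, zero_mul, Finset.sum_const_zero, Complex.ofReal_zero,
      Complex.exp_zero, one_mul]
    rw [hL]
  rw [charFunDual_apply, charFunDual_apply, integral_map hm.aemeasurable (by fun_prop),
    integral_map continuous_pathEnd.measurable.aemeasurable (by fun_prop), e3]
  have e4 : ∀ q : ℝ × ℝ, Complex.exp ((L (q.1, q.1 / 2 + q.2) : ℂ) * Complex.I) =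
      Complex.exp (((p.1 + p.2 / 2 : ℝ) : ℂ) * q.1 * Complex.I) *
        Complex.exp ((p.2 : ℂ) * q.2 * Complex.I) := by
    intro q
    rw [hL, ← Complex.exp_add]
    congr 1
    push_cast
    ring
  simp only [e4]
  rw [integral_prod_mul (fun u : ℝ => Complex.exp (((p.1 + p.2 / 2 : ℝ) : ℂ) * u * Complex.I))
    (fun u : ℝ => Complex.exp ((p.2 : ℂ) * u * Complex.I)), ← charFun_apply_real,
    ← charFun_apply_real, charFun_gaussianReal, charFun_gaussianReal, ← Complex.exp_add, endVar_eq,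
    Complex.ofReal_exp]
  congr 1
  push_cast
  ring

lemma IsBrownianLaw.zero_mem_support {W : Measure C(I, ℝ)} [IsProbabilityMeasure W]
    (hW : IsBrownianLaw W) : (0 : ℝ × ℝ) ∈ (W.map pathEnd).support := by
  rw [Measure.mem_support_iff_forall]
  intro U hU
  obtain ⟨O, hOU, hO, h0⟩ := mem_nhds_iff.1 hU
  refine lt_of_lt_of_le ?_ (measure_mono hOU)
  have hc : Continuous fun q : ℝ × ℝ => (q.1, q.1 / 2 + q.2) := by fun_prop
  rw [hW.map_pathEnd, Measure.map_apply hc.measurable hO.measurableSet]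
  have h1 : (gaussianReal 0 1).IsOpenPosMeasure :=
    (gaussianReal_absolutelyContinuous' 0 one_ne_zero).isOpenPosMeasure
  have h2 : (gaussianReal 0 (1 / 12)).IsOpenPosMeasure :=
    (gaussianReal_absolutelyContinuous' 0 (by norm_num)).isOpenPosMeasure
  refine (hO.preimage hc).measure_pos _ ⟨0, ?_⟩
  change ((0 : ℝ), (0 : ℝ) / 2 + 0) ∈ O
  rw [zero_div, add_zero]
  exact h0

/-! ### The conditional law of Brownian motion -/

/-- The path with bridge `q.2` and terminal value `q.1`, together with its integral. -/
noncomputable def bridgeLift (q : (ℝ × ℝ) × C(I, ℝ)) : C(I, ℝ) × C(I, ℝ) :=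
  (q.2 + bridgeShift q.1, integralPath (q.2 + bridgeShift q.1))

lemma continuous_bridgeLift : Continuous bridgeLift := by
  have h1 : Continuous fun q : (ℝ × ℝ) × C(I, ℝ) => q.2 + bridgeShift q.1 :=
    continuous_snd.add (continuous_bridgeShift.comp continuous_fst)
  exact h1.prodMk (continuous_integralPath.comp h1)

lemma bridgeLift_pathEnd_bridge (y : C(I, ℝ)) :
    bridgeLift (pathEnd y, bridge y) = (y, integralPath y) := by
  simp [bridgeLift, bridge]

lemma bridgeShift_zero : bridgeShift 0 = 0 := by
  ext u
  simp [bridgeShift_apply]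

/-- The conditional law of Brownian motion and its integral given the terminal value `0` is the law
of the bridge and its integral: given the terminal value `t`, the path is the sum of the independent
bridge and of `bridgeShift t`. -/
lemma IsBrownianLaw.isCondLaw {W : Measure C(I, ℝ)} [IsProbabilityMeasure W]
    (hW : IsBrownianLaw W) :
    IsCondLaw W (fun y => (y, integralPath y)) pathEnd 0
      ((W.map bridge).map fun h => (h, integralPath h)) := by
  have hprob := Measure.isProbabilityMeasure_map (μ := W) continuous_bridge.measurable.aemeasurable
  have hlift : Measurable bridgeLift := continuous_bridgeLift.measurable
  set κ : Kernel (ℝ × ℝ) (C(I, ℝ) × C(I, ℝ)) :=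
    ((Kernel.id : Kernel (ℝ × ℝ) (ℝ × ℝ)) ×ₖ Kernel.const (ℝ × ℝ) (W.map bridge)).map bridgeLift
    with hκ
  have hM : IsMarkovKernel κ := Kernel.IsMarkovKernel.map _ hlift
  have hlt : ∀ t : ℝ × ℝ, Continuous fun h => bridgeLift (t, h) := fun t =>
    continuous_bridgeLift.comp (by fun_prop)
  have hκt : ∀ t, κ t = (W.map bridge).map fun h => bridgeLift (t, h) := by
    intro t
    rw [hκ, Kernel.map_apply _ hlift, Kernel.prod_apply, Kernel.id_apply, Kernel.const_apply,
      Measure.dirac_prod, Measure.map_map hlift (by fun_prop)]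
    rfl
  refine ⟨hW.zero_mem_support, κ, hM, ⟨?_, ?_⟩, fun g => ?_, ?_⟩
  · exact (continuous_pathEnd.prodMk
      (continuous_id.prodMk continuous_integralPath)).measurable.aemeasurable
  · refine Measure.ext_of_lintegral _ fun F hF => ?_
    have hmeas : Measurable fun y : C(I, ℝ) => (pathEnd y, (y, integralPath y)) :=
      (continuous_pathEnd.prodMk (continuous_id.prodMk continuous_integralPath)).measurable
    have hFl : Measurable fun q : (ℝ × ℝ) × C(I, ℝ) => F (q.1, bridgeLift q) :=
      hF.comp (measurable_fst.prodMk hlift)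
    have hind := (indepFun_iff_map_prod_eq_prod_map_map
      continuous_pathEnd.measurable.aemeasurable continuous_bridge.measurable.aemeasurable).1
      hW.indepFun_bridge_pathEnd.symm
    have hpb : Measurable fun y => (pathEnd y, bridge y) :=
      (continuous_pathEnd.prodMk continuous_bridge).measurable
    rw [lintegral_map hF hmeas, Measure.lintegral_compProd hF]
    have e1 : ∫⁻ y, F (pathEnd y, (y, integralPath y)) ∂W =
        ∫⁻ q, F (q.1, bridgeLift q) ∂((W.map pathEnd).prod (W.map bridge)) := by
      rw [← hind, lintegral_map hFl hpb]
      simp only [bridgeLift_pathEnd_bridge]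
    rw [e1, lintegral_prod _ hFl.aemeasurable]
    refine lintegral_congr fun t => ?_
    have h3 : Measurable fun z : C(I, ℝ) × C(I, ℝ) => F (t, z) := hF.comp (by fun_prop)
    rw [hκt, lintegral_map h3 (hlt t).measurable]
  · have h4 : ∀ t, ∫ x, g x ∂(κ t) = ∫ h, g (bridgeLift (t, h)) ∂(W.map bridge) := fun t => by
      rw [hκt, integral_map (hlt t).measurable.aemeasurable
        g.continuous.measurable.aestronglyMeasurable]
    simp only [h4]
    refine Continuous.continuousAt (continuous_of_dominated (bound := fun _ => ‖g‖) (fun t => ?_)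
      (fun t => ?_) (integrable_const _) (Eventually.of_forall fun h => ?_))
    · exact (g.continuous.comp (hlt t)).measurable.aestronglyMeasurable
    · exact Eventually.of_forall fun h => g.norm_coe_le_norm _
    · exact g.continuous.comp (continuous_bridgeLift.comp (by fun_prop))
  · rw [hκt]
    simp [bridgeLift, bridgeShift_zero]

lemma IsCondLaw.of_map {Ω E E' F : Type*} [MeasurableSpace Ω] [MeasurableSpace E']
    [TopologicalSpace E] [MeasurableSpace E] [TopologicalSpace F] [MeasurableSpace F]
    {P : Measure Ω} {B : Ω → E'} (hB : AEMeasurable B P) {X : E' → E} {T : E' → F} {t : F}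
    {μ : Measure E} (h : IsCondLaw (P.map B) X T t μ) :
    IsCondLaw P (fun ω => X (B ω)) (fun ω => T (B ω)) t μ := by
  obtain ⟨hs, κ, hM, hκ, hc, rfl⟩ := h
  have hT : (P.map B).map T = P.map fun ω => T (B ω) :=
    AEMeasurable.map_map_of_aemeasurable hκ.aemeasurable_fst hB
  refine ⟨hT ▸ hs, κ, hM, ⟨?_, ?_⟩, hc, rfl⟩
  · exact hκ.aemeasurable.comp_aemeasurable hB
  · rw [← hT, ← hκ.map_eq]
    exact (AEMeasurable.map_map_of_aemeasurable hκ.aemeasurable hB).symm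

/-! ### The limit of the Fourier integrals -/

lemma integrable_exp_neg_endVar : Integrable fun p : ℝ × ℝ => Real.exp (-endVar p / 2) := by
  have h1 : Integrable fun u : ℝ => Real.exp (-(1 / 32) * u ^ 2) :=
    integrable_exp_neg_mul_sq (by norm_num)
  refine (h1.mul_prod h1).mono' ?_ (Eventually.of_forall fun p => ?_)
  · simp only [endVar_eq]
    exact Continuous.aestronglyMeasurable (by fun_prop)
  · rw [Real.norm_eq_abs, abs_of_pos (Real.exp_pos _), ← Real.exp_add, endVar_eq]
    refine Real.exp_le_exp.2 ?_
    nlinarith [sq_nonneg (15 * p.1 + 8 * p.2), sq_nonneg p.2]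

lemma integral_exp_neg_endVar_pos : 0 < ∫ p : ℝ × ℝ, Real.exp (-endVar p / 2) := by
  rw [integral_pos_iff_support_of_nonneg (fun p => (Real.exp_pos _).le) integrable_exp_neg_endVar]
  have h : (Function.support fun p : ℝ × ℝ => Real.exp (-endVar p / 2)) = Set.univ := by
    ext p
    simp [(Real.exp_pos _).ne']
  rw [h]
  exact isOpen_univ.measure_pos _ Set.univ_nonempty

lemma integral_exp_neg_profileVar {ι : Type*} [Fintype ι] (θ : ι → ℝ) (τ : ι → I) :
    ∫ p : ℝ × ℝ, ((Real.exp (-profileVar θ τ p / 2) : ℝ) : ℂ) =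
      ((Real.exp (-profileVar θ τ (regression θ τ) / 2) : ℝ) : ℂ) *
        ((∫ p : ℝ × ℝ, Real.exp (-endVar p / 2) : ℝ) : ℂ) := by
  rw [← integral_add_left_eq_self _ (regression θ τ), ← integral_complex_ofReal,
    ← integral_const_mul]
  refine integral_congr_ae (Eventually.of_forall fun p => ?_)
  simp only
  rw [profileVar_regression_add, neg_add, add_div, Real.exp_add, Complex.ofReal_mul]

/-! ### Dyadic interpolation of a path -/

/-- The time `k / 2 ^ m`, projected to `[0, 1]`. -/
noncomputable def dyadicTime (m k : ℕ) : I := Set.projIcc 0 1 zero_le_one ((k : ℝ) / 2 ^ m)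

lemma coe_dyadicTime {m k : ℕ} (hk : k ≤ 2 ^ m) : (dyadicTime m k : ℝ) = (k : ℝ) / 2 ^ m := by
  have hk' : (k : ℝ) ≤ 2 ^ m := by exact_mod_cast hk
  rw [dyadicTime, Set.projIcc_of_mem zero_le_one ⟨by positivity, (div_le_one (by positivity)).2 hk'⟩]

lemma dyadicTime_succ_two_mul (m k : ℕ) : dyadicTime (m + 1) (2 * k) = dyadicTime m k := by
  unfold dyadicTime
  congr 1
  push_cast
  rw [pow_succ]
  field_simp

/-- The path that agrees with `y` at the times `k / 2 ^ m` and is linear in between. -/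
noncomputable def dyadicPath (m : ℕ) (y : C(I, ℝ)) : C(I, ℝ) :=
  interpolatedPath (fun k => y (dyadicTime m k)) (2 ^ m)

lemma continuous_dyadicPath (m : ℕ) : Continuous (dyadicPath m) :=
  (continuous_interpolatedPath (2 ^ m)).comp (continuous_pi fun _ => continuous_eval_const _)

/-- The increment of `y` over the `k`-th dyadic interval of length `2 ^ (-m)`. -/
noncomputable def dyadicIncr (m : ℕ) (y : C(I, ℝ)) (k : ℕ) : ℝ :=
  y (dyadicTime m (k + 1)) - y (dyadicTime m k)

lemma continuous_dyadicIncr (m k : ℕ) : Continuous fun y => dyadicIncr m y k :=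
  (continuous_eval_const _).sub (continuous_eval_const _)

lemma exists_mem_cell {M : ℕ} (hM : 0 < M) {u : ℝ} (hu : 0 ≤ u) (huM : u ≤ M) :
    ∃ k < M, (k : ℝ) ≤ u ∧ u ≤ k + 1 := by
  rcases huM.lt_or_eq with h | h
  · exact ⟨⌊u⌋₊, (Nat.floor_lt hu).2 h, Nat.floor_le hu, (Nat.lt_floor_add_one u).le⟩
  · refine ⟨M - 1, by omega, ?_, ?_⟩ <;> rw [h, Nat.cast_sub hM] <;> push_cast <;> linarith

lemma abs_interpolate_sub_interpolate_le {w : ℕ → ℝ} {M : ℕ} (hM : 0 < M) {D : ℝ}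
    (hD : ∀ k < 2 * M, |w (k + 1) - w k| ≤ D) {u : ℝ} (hu : 0 ≤ u) (huM : u ≤ M) :
    |interpolate w (2 * u) - interpolate (fun k => w (2 * k)) u| ≤ D := by
  obtain ⟨i, hi, h1, h2⟩ := exists_mem_cell hM hu huM
  have hD1 := abs_le.1 (hD (2 * i) (by omega))
  have hD2 := abs_le.1 (hD (2 * i + 1) (by omega))
  rw [interpolate_eq_of_mem h1 h2]
  rcases le_total u (i + 1 / 2) with h | h
  · rw [interpolate_eq_of_mem (k := 2 * i) (by push_cast; linarith) (by push_cast; linarith),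
      show 2 * (i + 1) = 2 * i + 1 + 1 by ring, abs_le]
    push_cast
    set a := w (2 * i + 1) - w (2 * i) with ha
    set b := w (2 * i + 1 + 1) - w (2 * i + 1) with hb
    have hb' : w (2 * i + 1 + 1) - w (2 * i) = a + b := by rw [ha, hb]; ring
    rw [hb']
    constructor <;> nlinarith
  · rw [interpolate_eq_of_mem (k := 2 * i + 1) (by push_cast; linarith) (by push_cast; linarith),
      show 2 * (i + 1) = 2 * i + 1 + 1 by ring, abs_le]
    push_cast
    set a := w (2 * i + 1) - w (2 * i) with ha
    set b := w (2 * i + 1 + 1) - w (2 * i + 1) with hb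
    have hb' : w (2 * i + 1 + 1) - w (2 * i) = a + b := by rw [ha, hb]; ring
    have ha' : w (2 * i + 1) = w (2 * i) + a := by rw [ha]; ring
    rw [hb', ha']
    constructor <;> nlinarith

lemma norm_dyadicPath_succ_sub_le (m : ℕ) (y : C(I, ℝ)) {D : ℝ}
    (hD : ∀ k < 2 ^ (m + 1), |dyadicIncr (m + 1) y k| ≤ D) :
    ‖dyadicPath (m + 1) y - dyadicPath m y‖ ≤ D := by
  have hD0 : 0 ≤ D := (abs_nonneg _).trans (hD 0 (by positivity))
  rw [ContinuousMap.norm_le _ hD0]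
  intro t
  have h := abs_interpolate_sub_interpolate_le (w := fun k => y (dyadicTime (m + 1) k))
    (M := 2 ^ m) (by positivity) (D := D) (fun k hk => hD k (by rw [pow_succ, mul_comm]; exact hk))
    (mul_mem_of_unitInterval (2 ^ m) t).1 (mul_mem_of_unitInterval (2 ^ m) t).2
  simp only [dyadicTime_succ_two_mul] at h
  rw [Real.norm_eq_abs, ContinuousMap.sub_apply]
  have h2 : (2 : ℝ) * (((2 ^ m : ℕ) : ℝ) * t) = ((2 ^ (m + 1) : ℕ) : ℝ) * t := by
    push_cast; ring
  rw [h2] at h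
  exact h

lemma tendsto_dyadicPath (y : C(I, ℝ)) :
    Tendsto (fun m => dyadicPath m y) atTop (𝓝 y) := by
  rw [Metric.tendsto_atTop]
  intro ε hε
  obtain ⟨δ, hδ, hy⟩ := Metric.uniformContinuous_iff.1
    (CompactSpace.uniformContinuous_of_continuous y.continuous) (ε / 2) (half_pos hε)
  obtain ⟨m₀, hm₀⟩ := exists_pow_lt_of_lt_one hδ (by norm_num : (1 / 2 : ℝ) < 1)
  refine ⟨m₀, fun m hm => lt_of_le_of_lt ?_ (half_lt_self hε)⟩
  rw [ContinuousMap.dist_le (half_pos hε).le]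
  intro t
  have h2m : (0 : ℝ) < 2 ^ m := by positivity
  have hδm : (1 : ℝ) / 2 ^ m < δ := by
    rw [← one_div_pow]
    exact (pow_le_pow_of_le_one (by norm_num) (by norm_num) hm).trans_lt hm₀
  obtain ⟨k, hk, h1, h2⟩ := exists_mem_cell (M := 2 ^ m) (by positivity)
    (mul_mem_of_unitInterval (2 ^ m) t).1 (mul_mem_of_unitInterval (2 ^ m) t).2
  push_cast at h1 h2
  have hclose : ∀ j, (j = k ∨ j = k + 1) → |y (dyadicTime m j) - y t| ≤ ε / 2 := by
    intro j hj
    have hjle : j ≤ 2 ^ m := by omega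
    have h3 : dist (dyadicTime m j) t < δ := by
      rw [Subtype.dist_eq, coe_dyadicTime hjle, Real.dist_eq]
      refine lt_of_le_of_lt ?_ hδm
      have h4 : |(j : ℝ) - 2 ^ m * t| ≤ 1 := by
        rw [abs_le]
        rcases hj with rfl | rfl <;> push_cast <;> constructor <;> linarith
      rw [show (j : ℝ) / 2 ^ m - t = ((j : ℝ) - 2 ^ m * t) / 2 ^ m by field_simp, abs_div,
        abs_of_pos h2m]
      exact div_le_div_of_nonneg_right h4 h2m.le
    have h4 := hy h3
    rw [Real.dist_eq] at h4
    exact h4.le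
  have h5 := abs_le.1 (hclose k (Or.inl rfl))
  have h6 := abs_le.1 (hclose (k + 1) (Or.inr rfl))
  change dist (interpolate (fun k => y (dyadicTime m k)) (((2 ^ m : ℕ) : ℝ) * t)) (y t) ≤ _
  push_cast
  rw [interpolate_eq_of_mem h1 h2, Real.dist_eq, abs_le]
  constructor <;> nlinarith

/-! ### Chaining -/

lemma min_add_one_le {a b : ℝ} (ha : 0 ≤ a) (hb : 0 ≤ b) : min (a + b) 1 ≤ min a 1 + min b 1 := by
  rcases le_total a 1 with h | h <;> rcases le_total b 1 with h' | h' <;>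
    rcases le_total (a + b) 1 with h'' | h'' <;> simp [h, h', h''] <;> linarith

/-- The truncated maximum of the increments, in terms of their truncated fourth powers: a maximum
`x > δ` is at most `x ^ 4 / δ ^ 3`. -/
lemma min_norm_dyadicPath_succ_sub_le (m : ℕ) (y : C(I, ℝ)) {δ : ℝ} (hδ : 0 < δ) :
    min ‖dyadicPath (m + 1) y - dyadicPath m y‖ 1 ≤
      δ + ∑ k ∈ Finset.range (2 ^ (m + 1)), truncPow (dyadicIncr (m + 1) y k) / δ ^ 3 := by
  have hS : 0 ≤ ∑ k ∈ Finset.range (2 ^ (m + 1)), truncPow (dyadicIncr (m + 1) y k) / δ ^ 3 :=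
    Finset.sum_nonneg fun k _ => div_nonneg (truncPow_nonneg _) (by positivity)
  obtain ⟨k, hk, hmax⟩ := Finset.exists_max_image (Finset.range (2 ^ (m + 1)))
    (fun k => |dyadicIncr (m + 1) y k|) ⟨0, Finset.mem_range.2 (by positivity)⟩
  have h1 := norm_dyadicPath_succ_sub_le m y fun j hj => hmax j (Finset.mem_range.2 hj)
  have h2 := min_le_min h1 (le_refl (1 : ℝ))
  set x := min |dyadicIncr (m + 1) y k| 1 with hx
  have hx0 : 0 ≤ x := le_min (abs_nonneg _) zero_le_one
  rcases le_total x δ with h | h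
  · linarith
  · have h3 : x ≤ truncPow (dyadicIncr (m + 1) y k) / δ ^ 3 := by
      rw [le_div_iff₀ (by positivity), truncPow, ← hx]
      calc x * δ ^ 3 ≤ x * x ^ 3 := by gcongr
        _ = x ^ 4 := by ring
    have h4 := Finset.single_le_sum (f := fun k => truncPow (dyadicIncr (m + 1) y k) / δ ^ 3)
      (fun j _ => div_nonneg (truncPow_nonneg _) (by positivity)) hk
    linarith

lemma integrable_of_continuous_bound {E : Type*} [TopologicalSpace E] [MeasurableSpace E]
    [OpensMeasurableSpace E] {ν : Measure E} [IsFiniteMeasure ν] {h : E → ℝ}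
    (hh : Continuous h) {C : ℝ} (hC : ∀ x, |h x| ≤ C) : Integrable h ν :=
  Integrable.of_bound hh.measurable.aestronglyMeasurable C (Eventually.of_forall hC)

lemma abs_min_norm_one_le (x : C(I, ℝ)) : |min ‖x‖ 1| ≤ 1 := by
  rw [abs_of_nonneg (le_min (norm_nonneg _) zero_le_one)]
  exact min_le_right _ _

/-- A bound on the fourth moments of the increments controls the distance to the dyadic
interpolations. Only increments of length at most `1 / 4` are needed, since the chain starts from the
level `m + 1` and so only uses dyadic intervals of levels at least `2`. -/
lemma integral_min_norm_sub_dyadicPath_le {ν : Measure C(I, ℝ)} [IsProbabilityMeasure ν] {C : ℝ}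
    (hC : 0 ≤ C) (hinc : ∀ s t : I, s ≤ t → (t : ℝ) - s ≤ 1 / 4 →
      ∫ y, truncPow (y t - y s) ∂ν ≤ C * ((t : ℝ) - s) ^ 2) (m : ℕ) :
    ∫ y, min ‖y - dyadicPath (m + 1) y‖ 1 ∂ν ≤ 10 * (1 + C) * (9 / 10) ^ (m + 1) := by
  have hcont : ∀ m, Continuous fun y : C(I, ℝ) => min ‖y - dyadicPath m y‖ 1 := fun m =>
    ((continuous_id.sub (continuous_dyadicPath m)).norm).min continuous_const
  have hint : ∀ m, Integrable (fun y : C(I, ℝ) => min ‖y - dyadicPath m y‖ 1) ν := fun m =>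
    integrable_of_continuous_bound (hcont m) fun y => abs_min_norm_one_le _
  have hcont' : ∀ m, Continuous fun y : C(I, ℝ) => min ‖dyadicPath (m + 1) y - dyadicPath m y‖ 1 :=
    fun m => (((continuous_dyadicPath (m + 1)).sub (continuous_dyadicPath m)).norm).min
      continuous_const
  have hint' : ∀ m, Integrable (fun y : C(I, ℝ) =>
      min ‖dyadicPath (m + 1) y - dyadicPath m y‖ 1) ν := fun m =>
    integrable_of_continuous_bound (hcont' m) fun y => abs_min_norm_one_le _
  have htr : ∀ m k, Integrable (fun y => truncPow (dyadicIncr m y k)) ν := fun m k =>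
    integrable_of_continuous_bound (continuous_truncPow.comp (continuous_dyadicIncr m k))
      fun y => by
        rw [abs_of_nonneg (truncPow_nonneg _)]
        exact truncPow_le_one _
  -- one step of the chain, with threshold `δ = (9 / 10) ^ j`: the sum of the `2 ^ j` moments is at
  -- most `C 2 ^ (-j) δ ^ (-3)`, which is at most `C δ` because `(9 / 10) ^ 4 ≥ 1 / 2`
  have hstep : ∀ m, ∫ y, min ‖dyadicPath (m + 1 + 1) y - dyadicPath (m + 1) y‖ 1 ∂ν ≤
      (1 + C) * (9 / 10) ^ (m + 1 + 1) := by
    intro m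
    set j := m + 1 + 1 with hj
    set δ : ℝ := (9 / 10) ^ j with hδ
    have hδ0 : 0 < δ := by positivity
    have h2j : (0 : ℝ) < 2 ^ j := by positivity
    have hone : ∀ k ∈ Finset.range (2 ^ j), ∫ y, truncPow (dyadicIncr j y k) / δ ^ 3 ∂ν ≤
        C * (1 / 2 ^ j) ^ 2 / δ ^ 3 := by
      intro k hk
      have hk' : k < 2 ^ j := Finset.mem_range.1 hk
      have hd : (dyadicTime j (k + 1) : ℝ) - dyadicTime j k = 1 / 2 ^ j := by
        rw [coe_dyadicTime (by omega), coe_dyadicTime (by omega)]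
        push_cast
        ring
      rw [integral_div]
      refine div_le_div_of_nonneg_right ?_ (by positivity)
      have h := hinc (dyadicTime j k) (dyadicTime j (k + 1)) ?_ ?_
      · rw [hd] at h
        exact h
      · rw [← Subtype.coe_le_coe, ← sub_nonneg, hd]
        positivity
      · rw [hd, div_le_div_iff_of_pos_left one_pos h2j (by norm_num)]
        calc (4 : ℝ) = 2 ^ 2 := by norm_num
          _ ≤ 2 ^ j := pow_le_pow_right₀ one_le_two (by omega)
    calc ∫ y, min ‖dyadicPath j y - dyadicPath (m + 1) y‖ 1 ∂ν
        ≤ ∫ y, (δ + ∑ k ∈ Finset.range (2 ^ j), truncPow (dyadicIncr j y k) / δ ^ 3) ∂ν := by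
          refine integral_mono (hint' _) ((integrable_const _).add
            (integrable_finsetSum _ fun k _ => (htr j k).div_const _)) fun y => ?_
          exact min_norm_dyadicPath_succ_sub_le (m + 1) y hδ0
      _ = δ + ∑ k ∈ Finset.range (2 ^ j), ∫ y, truncPow (dyadicIncr j y k) / δ ^ 3 ∂ν := by
          rw [integral_add (integrable_const _)
            (integrable_finsetSum _ fun k _ => (htr j k).div_const _),
            integral_finsetSum _ fun k _ => (htr j k).div_const _]
          simp
      _ ≤ δ + ∑ k ∈ Finset.range (2 ^ j), C * (1 / 2 ^ j) ^ 2 / δ ^ 3 :=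
          add_le_add le_rfl (Finset.sum_le_sum hone)
      _ = δ + C * ((1 / 2) ^ j / δ ^ 3) := by
          rw [Finset.sum_const, Finset.card_range, nsmul_eq_mul,
            show (1 / 2 : ℝ) ^ j = 1 / 2 ^ j from one_div_pow 2 j]
          push_cast
          field_simp
      _ ≤ δ + C * δ := by
          refine add_le_add le_rfl (mul_le_mul_of_nonneg_left ?_ hC)
          rw [div_le_iff₀ (by positivity), hδ, ← pow_succ', ← pow_mul, mul_comm j, pow_mul]
          exact pow_le_pow_left₀ (by norm_num) (by norm_num) j
      _ = (1 + C) * (9 / 10) ^ j := by rw [hδ]; ring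
  -- the truncated distances decrease up to a summable error
  set a : ℕ → ℝ := fun m => ∫ y, min ‖y - dyadicPath (m + 1) y‖ 1 ∂ν with ha
  have hrec : ∀ m, a m ≤ a (m + 1) + (1 + C) * (9 / 10) ^ (m + 1 + 1) := by
    intro m
    refine le_trans ?_ (add_le_add le_rfl (hstep m))
    simp only [ha]
    rw [← integral_add (hint _) (hint' _)]
    refine integral_mono (hint _) ((hint _).add (hint' _)) fun y => ?_
    refine le_trans (min_le_min ?_ le_rfl) (min_add_one_le (norm_nonneg _) (norm_nonneg _))
    calc ‖y - dyadicPath (m + 1) y‖ = ‖(y - dyadicPath (m + 1 + 1) y) +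
          (dyadicPath (m + 1 + 1) y - dyadicPath (m + 1) y)‖ := by rw [sub_add_sub_cancel]
      _ ≤ _ := norm_add_le _ _
  have ha0 : Tendsto a atTop (𝓝 0) := by
    have h : Tendsto a atTop (𝓝 (∫ _ : C(I, ℝ), (0 : ℝ) ∂ν)) := by
      refine tendsto_integral_of_dominated_convergence (fun _ => 1)
        (fun m => (hcont (m + 1)).measurable.aestronglyMeasurable) (integrable_const _)
        (fun m => Eventually.of_forall fun y => abs_min_norm_one_le _)
        (Eventually.of_forall fun y => ?_)
      have h1 := ((tendsto_dyadicPath y).const_sub y).norm.min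
        (tendsto_const_nhds (x := (1 : ℝ)))
      rw [sub_self, norm_zero, min_eq_left zero_le_one] at h1
      exact h1.comp (tendsto_add_atTop_nat 1)
    simpa using h
  have hpow : Tendsto (fun m : ℕ => 10 * (1 + C) * (9 / 10 : ℝ) ^ (m + 1)) atTop (𝓝 0) := by
    have := ((tendsto_pow_atTop_nhds_zero_of_lt_one (by norm_num : (0 : ℝ) ≤ 9 / 10)
      (by norm_num)).comp (tendsto_add_atTop_nat 1)).const_mul (10 * (1 + C))
    simpa using this
  have hmono : Monotone fun m => a m - 10 * (1 + C) * (9 / 10 : ℝ) ^ (m + 1) := by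
    refine monotone_nat_of_le_succ fun m => ?_
    have h1 := hrec m
    have h2 : (0 : ℝ) < (1 + C) * (9 / 10) ^ (m + 1) := by positivity
    rw [pow_succ _ (m + 1)] at h1 ⊢
    nlinarith
  have hlim := ha0.sub hpow
  rw [sub_zero] at hlim
  have := hmono.ge_of_tendsto hlim m
  simp only [ha] at this
  linarith

/-! ### Convergence of finite-dimensional distributions -/

/-- The piecewise linear path with the values `x k` at the times `k / 2 ^ m`. -/
noncomputable def dyadicLift (m : ℕ) (x : EuclideanSpace ℝ (Fin (2 ^ m + 1))) : C(I, ℝ) :=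
  interpolatedPath (fun k => if h : k < 2 ^ m + 1 then x ⟨k, h⟩ else 0) (2 ^ m)

lemma continuous_dyadicLift (m : ℕ) : Continuous (dyadicLift m) := by
  refine (continuous_interpolatedPath (2 ^ m)).comp (continuous_pi fun k => ?_)
  by_cases h : k < 2 ^ m + 1
  · simp only [h, dif_pos]
    fun_prop
  · simp only [h, dif_neg, not_false_eq_true]
    fun_prop

/-- The values of a path at the times `k / 2 ^ m`. -/
noncomputable def dyadicEval (m : ℕ) (y : C(I, ℝ)) : EuclideanSpace ℝ (Fin (2 ^ m + 1)) :=
  WithLp.toLp 2 fun k => y (dyadicTime m k)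

lemma continuous_dyadicEval (m : ℕ) : Continuous (dyadicEval m) := by
  have h : Continuous fun (y : C(I, ℝ)) (k : Fin (2 ^ m + 1)) => y (dyadicTime m k) :=
    continuous_pi fun k => continuous_eval_const _
  unfold dyadicEval
  fun_prop

lemma dyadicLift_dyadicEval (m : ℕ) (y : C(I, ℝ)) :
    dyadicLift m (dyadicEval m y) = dyadicPath m y := by
  ext t
  rw [dyadicLift, dyadicPath, interpolatedPath_apply, interpolatedPath_apply]
  have h : ∀ k < 2 ^ m + 1, (if h : k < 2 ^ m + 1 then (dyadicEval m y) ⟨k, h⟩ else 0) =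
      y (dyadicTime m k) := fun k hk => by
    rw [dif_pos hk]
    rfl
  rw [h 0 (by positivity)]
  congr 1
  refine Finset.sum_congr rfl fun k hk => ?_
  have hk' := Finset.mem_range.1 hk
  rw [h k (by omega), h (k + 1) (by omega)]

/-- Convergence of the finite-dimensional distributions, in terms of the dyadic interpolations. -/
lemma tendsto_integral_comp_dyadicPath {μ : ℕ → Measure C(I, ℝ)} [∀ n, IsProbabilityMeasure (μ n)]
    {ρ : Measure C(I, ℝ)} [IsProbabilityMeasure ρ]
    (hfdd : ∀ (d : ℕ) (θ : Fin d → ℝ) (τ : Fin d → I),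
      Tendsto (fun n => ∫ y, expFunctional θ τ y ∂(μ n)) atTop (𝓝 (∫ y, expFunctional θ τ y ∂ρ)))
    (m : ℕ) {h : C(I, ℝ) → ℝ} (hh : Continuous h) {C : ℝ} (hC : ∀ y, |h y| ≤ C) :
    Tendsto (fun n => ∫ y, h (dyadicPath m y) ∂(μ n)) atTop (𝓝 (∫ y, h (dyadicPath m y) ∂ρ)) := by
  have hm := (continuous_dyadicEval m).measurable
  have hchar : ∀ (ν : Measure C(I, ℝ)) (t : EuclideanSpace ℝ (Fin (2 ^ m + 1))),
      charFun (ν.map (dyadicEval m)) t =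
        ∫ y, expFunctional (fun k => t k) (fun k => dyadicTime m k) y ∂ν := by
    intro ν t
    rw [charFun_apply, integral_map hm.aemeasurable (by fun_prop)]
    refine integral_congr_ae (Eventually.of_forall fun y => ?_)
    simp only [expFunctional]
    congr 3
  set μ' : ℕ → ProbabilityMeasure (EuclideanSpace ℝ (Fin (2 ^ m + 1))) := fun n =>
    ⟨(μ n).map (dyadicEval m), Measure.isProbabilityMeasure_map hm.aemeasurable⟩ with hμ'
  set ρ' : ProbabilityMeasure (EuclideanSpace ℝ (Fin (2 ^ m + 1))) :=
    ⟨ρ.map (dyadicEval m), Measure.isProbabilityMeasure_map hm.aemeasurable⟩ with hρ'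
  have hconv : Tendsto μ' atTop (𝓝 ρ') := by
    refine ProbabilityMeasure.tendsto_of_tendsto_charFun fun t => ?_
    simp only [hμ', hρ', ProbabilityMeasure.coe_mk, hchar]
    exact hfdd _ _ _
  have hhc : Continuous fun x => h (dyadicLift m x) := hh.comp (continuous_dyadicLift m)
  have h1 := ProbabilityMeasure.tendsto_iff_forall_integral_tendsto.1 hconv
    (BoundedContinuousFunction.ofNormedAddCommGroup (fun x => h (dyadicLift m x)) hhc C
      fun x => hC _)
  have h2 : ∀ ν : Measure C(I, ℝ), ∫ x, h (dyadicLift m x) ∂(ν.map (dyadicEval m)) =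
      ∫ y, h (dyadicPath m y) ∂ν := by
    intro ν
    rw [integral_map hm.aemeasurable hhc.measurable.aestronglyMeasurable]
    simp only [dyadicLift_dyadicEval]
  simp only [hμ', hρ', ProbabilityMeasure.coe_mk,
    BoundedContinuousFunction.coe_ofNormedAddCommGroup, h2] at h1
  exact h1

/-! ### Weak convergence of a path jointly with its integral -/

lemma norm_integralPath_sub_le (y z : C(I, ℝ)) :
    ‖integralPath y - integralPath z‖ ≤ ‖y - z‖ := by
  rw [← dist_eq_norm, ← dist_eq_norm]
  exact dist_integralPath_le y z

lemma abs_sub_le_mul_min {g : C(I, ℝ) × C(I, ℝ) → ℝ} {L C : ℝ} (hL0 : 0 ≤ L) (hC0 : 0 ≤ C)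
    (hL : ∀ x y, |g x - g y| ≤ L * dist x y) (hC : ∀ x, |g x| ≤ C) (x y : C(I, ℝ) × C(I, ℝ)) :
    |g x - g y| ≤ (L + 2 * C) * min (dist x y) 1 := by
  have h1 := hL x y
  have h2 : |g x - g y| ≤ 2 * C := (abs_sub _ _).trans (by linarith [hC x, hC y])
  have h3 : 0 ≤ dist x y := dist_nonneg
  rcases le_total (dist x y) 1 with h | h
  · rw [min_eq_left h]
    nlinarith
  · rw [min_eq_right h]
    nlinarith

/-- Convergence of the finite-dimensional distributions of the first coordinate, a uniform bound for
the fourth moments of its increments, and a second coordinate that is asymptotically the integral of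
the first, imply weak convergence. -/
theorem tendsto_integral_of_increments {μ : ℕ → Measure (C(I, ℝ) × C(I, ℝ))}
    [∀ n, IsProbabilityMeasure (μ n)] {ρ : Measure C(I, ℝ)} [IsProbabilityMeasure ρ]
    (hfdd : ∀ (d : ℕ) (θ : Fin d → ℝ) (τ : Fin d → I),
      Tendsto (fun n => ∫ w, expFunctional θ τ w.1 ∂(μ n)) atTop (𝓝 (∫ y, expFunctional θ τ y ∂ρ)))
    {C : ℝ} (hC : 0 ≤ C) (hinc : ∀ᶠ n in atTop, ∀ s t : I, s ≤ t → (t : ℝ) - s ≤ 1 / 4 →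
      ∫ w, truncPow (w.1 t - w.1 s) ∂(μ n) ≤ C * ((t : ℝ) - s) ^ 2)
    {r : ℕ → ℝ} (hr : Tendsto r atTop (𝓝 0))
    (hint : ∀ᶠ n in atTop, ∀ᵐ w ∂(μ n), ‖w.2 - integralPath w.1‖ ≤ r n * ‖w.1‖)
    (g : (C(I, ℝ) × C(I, ℝ)) →ᵇ ℝ) :
    Tendsto (fun n => ∫ w, g w ∂(μ n)) atTop (𝓝 (∫ y, g (y, integralPath y) ∂ρ)) := by
  have hpairc : Continuous fun y : C(I, ℝ) => (y, integralPath y) :=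
    continuous_id.prodMk continuous_integralPath
  set μ' : ℕ → ProbabilityMeasure (C(I, ℝ) × C(I, ℝ)) := fun n => ⟨μ n, inferInstance⟩ with hμ'
  set ρ' : ProbabilityMeasure (C(I, ℝ) × C(I, ℝ)) := ⟨ρ.map fun y => (y, integralPath y),
    Measure.isProbabilityMeasure_map hpairc.measurable.aemeasurable⟩ with hρ'
  have hρint : ∀ g : C(I, ℝ) × C(I, ℝ) → ℝ, Continuous g →
      ∫ w, g w ∂(ρ.map fun y => (y, integralPath y)) = ∫ y, g (y, integralPath y) ∂ρ := by
    intro g hg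
    rw [integral_map hpairc.measurable.aemeasurable hg.measurable.aestronglyMeasurable]
  suffices hconv : Tendsto μ' atTop (𝓝 ρ') by
    have h := ProbabilityMeasure.tendsto_iff_forall_integral_tendsto.1 hconv g
    simp only [hμ', hρ', ProbabilityMeasure.coe_mk] at h
    rwa [hρint g g.continuous] at h
  rw [tendsto_iff_forall_lipschitz_integral_tendsto]
  rintro g ⟨M, hM⟩ ⟨K, hK⟩
  simp only [hμ', hρ', ProbabilityMeasure.coe_mk]
  have hgc : Continuous g := hK.continuous
  rw [hρint g hgc]
  -- the constants of the test function
  set L : ℝ := (K : ℝ) with hLdef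
  have hL0 : 0 ≤ L := K.coe_nonneg
  obtain ⟨G, hG0, hG⟩ : ∃ G : ℝ, 0 ≤ G ∧ ∀ x, |g x| ≤ G := by
    refine ⟨|g 0| + |M|, by positivity, fun x => ?_⟩
    have h1 := hM x 0
    rw [Real.dist_eq] at h1
    have h2 : |g x| ≤ |g x - g 0| + |g 0| := by
      have := abs_add_le (g x - g 0) (g 0)
      rwa [sub_add_cancel] at this
    linarith [le_abs_self M]
  set A := L + 2 * G with hA
  have hA0 : 0 ≤ A := by positivity
  have hmin : ∀ x y, |g x - g y| ≤ A * min (dist x y) 1 :=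
    abs_sub_le_mul_min hL0 hG0 (fun x y => by
      have := hK.dist_le_mul x y
      rwa [Real.dist_eq] at this) hG
  set g₁ : C(I, ℝ) → ℝ := fun y => g (y, integralPath y) with hg₁
  have hg₁c : Continuous g₁ := hgc.comp hpairc
  -- the laws of the first coordinate
  set ν : ℕ → Measure C(I, ℝ) := fun n => (μ n).map Prod.fst with hν
  have hνp : ∀ n, IsProbabilityMeasure (ν n) := fun n =>
    Measure.isProbabilityMeasure_map measurable_fst.aemeasurable
  have hνint : ∀ n, ∀ h : C(I, ℝ) → ℝ, Continuous h → ∫ y, h y ∂(ν n) = ∫ w, h w.1 ∂(μ n) := by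
    intro n h hh
    rw [hν, integral_map measurable_fst.aemeasurable hh.measurable.aestronglyMeasurable]
  have hνfdd : ∀ (d : ℕ) (θ : Fin d → ℝ) (τ : Fin d → I),
      Tendsto (fun n => ∫ y, expFunctional θ τ y ∂(ν n)) atTop
        (𝓝 (∫ y, expFunctional θ τ y ∂ρ)) := by
    intro d θ τ
    refine (hfdd d θ τ).congr fun n => ?_
    rw [hν, integral_map measurable_fst.aemeasurable
      (continuous_expFunctional θ τ).measurable.aestronglyMeasurable]
  have hdist : ∀ m, ∀ᶠ n in atTop, ∫ y, min ‖y - dyadicPath (m + 1) y‖ 1 ∂(ν n) ≤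
      10 * (1 + C) * (9 / 10) ^ (m + 1) := by
    intro m
    filter_upwards [hinc] with n hn
    refine integral_min_norm_sub_dyadicPath_le hC (fun s t hst hts => ?_) m
    rw [hνint n (fun y => truncPow (y t - y s)) (continuous_truncPow.comp
      ((continuous_eval_const t).sub (continuous_eval_const s)))]
    exact hn s t hst hts
  have hlipd : ∀ y z : C(I, ℝ), |g₁ y - g₁ z| ≤ A * min ‖y - z‖ 1 := by
    intro y z
    refine (hmin _ _).trans (mul_le_mul_of_nonneg_left (min_le_min ?_ le_rfl) hA0)
    rw [Prod.dist_eq, dist_eq_norm, dist_eq_norm]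
    exact max_le le_rfl (norm_integralPath_sub_le y z)
  have hminc : ∀ m, Continuous fun y : C(I, ℝ) => min ‖y - dyadicPath m y‖ 1 := fun m =>
    ((continuous_id.sub (continuous_dyadicPath m)).norm).min continuous_const
  have hmini : ∀ m n, Integrable (fun y : C(I, ℝ) => min ‖y - dyadicPath m y‖ 1) (ν n) := fun m n =>
    integrable_of_continuous_bound (hminc m) fun y => abs_min_norm_one_le _
  have hg₁G : ∀ y, |g₁ y| ≤ G := fun y => hG _
  rw [Metric.tendsto_nhds]
  intro ε hε
  -- the level of the dyadic approximation
  obtain ⟨m, hm1, hm2⟩ : ∃ m : ℕ, A * (10 * (1 + C) * (9 / 10 : ℝ) ^ (m + 1)) < ε / 8 ∧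
      |∫ y, g₁ (dyadicPath (m + 1) y) ∂ρ - ∫ y, g₁ y ∂ρ| < ε / 8 := by
    have hpow : Tendsto (fun m : ℕ => A * (10 * (1 + C) * (9 / 10 : ℝ) ^ (m + 1))) atTop (𝓝 0) := by
      have := (((tendsto_pow_atTop_nhds_zero_of_lt_one (by norm_num : (0 : ℝ) ≤ 9 / 10)
        (by norm_num)).comp (tendsto_add_atTop_nat 1)).const_mul (10 * (1 + C))).const_mul A
      simpa using this
    have hlim : Tendsto (fun m => ∫ y, g₁ (dyadicPath (m + 1) y) ∂ρ) atTop (𝓝 (∫ y, g₁ y ∂ρ)) := by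
      refine tendsto_integral_of_dominated_convergence (fun _ => G)
        (fun m => (hg₁c.comp (continuous_dyadicPath _)).measurable.aestronglyMeasurable)
        (integrable_const _) (fun m => Eventually.of_forall fun y => hg₁G _)
        (Eventually.of_forall fun y => ?_)
      exact (hg₁c.tendsto y).comp ((tendsto_dyadicPath y).comp (tendsto_add_atTop_nat 1))
    have h1 := hpow.eventually_lt_const (by positivity : (0 : ℝ) < ε / 8)
    have h2 := Metric.tendsto_nhds.1 hlim (ε / 8) (by positivity)
    obtain ⟨m, h1, h2⟩ := (h1.and h2).exists
    exact ⟨m, h1, h2⟩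
  set D := dyadicPath (m + 1) with hD
  have hDc : Continuous D := continuous_dyadicPath _
  -- the truncation level of the supremum
  obtain ⟨R, hR1, hR2⟩ : ∃ R : ℕ, 1 ≤ R ∧ A * ∫ y, min (‖D y‖ / R) 1 ∂ρ < ε / 8 := by
    have hlim : Tendsto (fun R : ℕ => A * ∫ y, min (‖D y‖ / R) 1 ∂ρ) atTop (𝓝 (A * 0)) := by
      refine Tendsto.const_mul A ?_
      suffices h : Tendsto (fun R : ℕ => ∫ y, min (‖D y‖ / R) 1 ∂ρ) atTop
          (𝓝 (∫ _ : C(I, ℝ), (0 : ℝ) ∂ρ)) by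
        rwa [integral_zero] at h
      refine tendsto_integral_of_dominated_convergence (fun _ => 1)
        (fun R => ((hDc.norm.div_const _).min continuous_const).measurable.aestronglyMeasurable)
        (integrable_const _) (fun R => Eventually.of_forall fun y => ?_)
        (Eventually.of_forall fun y => ?_)
      · rw [Real.norm_eq_abs, abs_of_nonneg (le_min (by positivity) zero_le_one)]
        exact min_le_right _ _
      · have h1 : Tendsto (fun R : ℕ => ‖D y‖ / (R : ℝ)) atTop (𝓝 0) :=
          tendsto_natCast_atTop_atTop.const_div_atTop _
        have h2 := h1.min (tendsto_const_nhds (x := (1 : ℝ)))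
        rwa [min_eq_left zero_le_one] at h2
    rw [mul_zero] at hlim
    obtain ⟨R, h1, h2⟩ := ((eventually_ge_atTop 1).and
      (hlim.eventually_lt_const (by positivity : (0 : ℝ) < ε / 8))).exists
    exact ⟨R, h1, h2⟩
  have hR0 : (0 : ℝ) < R := by exact_mod_cast hR1
  have hRc : Continuous fun y : C(I, ℝ) => min (‖y‖ / R) 1 :=
    (continuous_norm.div_const _).min continuous_const
  have hRb : ∀ y : C(I, ℝ), |min (‖y‖ / R) 1| ≤ 1 := fun y => by
    rw [abs_of_nonneg (le_min (by positivity) zero_le_one)]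
    exact min_le_right _ _
  have e1 := tendsto_integral_comp_dyadicPath hνfdd (m + 1) hg₁c hg₁G
  have e2 := (tendsto_integral_comp_dyadicPath hνfdd (m + 1) hRc hRb).const_mul A
  have e3 := e2.eventually_lt_const hR2
  have e4 := Metric.tendsto_nhds.1 e1 (ε / 8) (by positivity)
  have e5 := hr.eventually_lt_const (by positivity : 0 < 1 / (R : ℝ))
  filter_upwards [hdist m, e3, e4, e5, hint] with n h1 h3 h4 h5 h6
  have hwi : ∀ h : C(I, ℝ) × C(I, ℝ) → ℝ, Continuous h → (∃ c, ∀ x, |h x| ≤ c) →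
      Integrable h (μ n) := fun h hh ⟨c, hc⟩ => integrable_of_continuous_bound hh hc
  have hgi : Integrable g (μ n) := hwi g hgc ⟨G, hG⟩
  have hg₁i : Integrable (fun w : C(I, ℝ) × C(I, ℝ) => g₁ w.1) (μ n) :=
    hwi _ (hg₁c.comp continuous_fst) ⟨G, fun w => hg₁G _⟩
  have hg₁ν : Integrable g₁ (ν n) := integrable_of_continuous_bound hg₁c hg₁G
  have hg₁Dν : Integrable (fun y => g₁ (D y)) (ν n) :=
    integrable_of_continuous_bound (hg₁c.comp hDc) fun y => hg₁G _
  -- replace the second coordinate by the integral of the first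
  have s1 : |∫ w, g w ∂(μ n) - ∫ w, g₁ w.1 ∂(μ n)| ≤ ε / 8 + ε / 8 := by
    rw [← integral_sub hgi hg₁i]
    have i1 : Integrable (fun w : C(I, ℝ) × C(I, ℝ) => min ‖w.1 - D w.1‖ 1) (μ n) :=
      hwi _ ((hminc (m + 1)).comp continuous_fst) ⟨1, fun w => abs_min_norm_one_le _⟩
    have i2 : Integrable (fun w : C(I, ℝ) × C(I, ℝ) => min (‖D w.1‖ / R) 1) (μ n) :=
      hwi _ ((hRc.comp hDc).comp continuous_fst) ⟨1, fun w => hRb _⟩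
    have hi1 : Integrable (fun w : C(I, ℝ) × C(I, ℝ) =>
        A * (min ‖w.1 - D w.1‖ 1 + min (‖D w.1‖ / R) 1)) (μ n) := (i1.add i2).const_mul A
    calc |∫ w, (g w - g₁ w.1) ∂(μ n)| ≤ ∫ w, |g w - g₁ w.1| ∂(μ n) := abs_integral_le_integral_abs
      _ ≤ ∫ w, A * (min ‖w.1 - D w.1‖ 1 + min (‖D w.1‖ / R) 1) ∂(μ n) := by
          refine integral_mono_of_nonneg (Eventually.of_forall fun w => abs_nonneg _) hi1 ?_
          filter_upwards [h6] with w hw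
          refine (hmin _ _).trans (mul_le_mul_of_nonneg_left ?_ hA0)
          have hd : dist w (w.1, integralPath w.1) = ‖w.2 - integralPath w.1‖ := by
            rw [Prod.dist_eq, dist_self, dist_eq_norm]
            exact max_eq_right (norm_nonneg _)
          rw [hd]
          refine le_trans (min_le_min (?_ : _ ≤ ‖w.1 - D w.1‖ + ‖D w.1‖ / R) le_rfl)
            (min_add_one_le (norm_nonneg _) (by positivity))
          have hR1' : (1 : ℝ) / R ≤ 1 := by
            rw [div_le_one hR0]
            exact_mod_cast hR1
          calc ‖w.2 - integralPath w.1‖ ≤ r n * ‖w.1‖ := hw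
            _ ≤ 1 / R * ‖w.1‖ := mul_le_mul_of_nonneg_right h5.le (norm_nonneg _)
            _ = 1 / R * ‖(w.1 - D w.1) + D w.1‖ := by rw [sub_add_cancel]
            _ ≤ 1 / R * (‖w.1 - D w.1‖ + ‖D w.1‖) :=
                mul_le_mul_of_nonneg_left (norm_add_le _ _) (by positivity)
            _ = 1 / R * ‖w.1 - D w.1‖ + ‖D w.1‖ / R := by ring
            _ ≤ ‖w.1 - D w.1‖ + ‖D w.1‖ / R :=
                add_le_add (mul_le_of_le_one_left (norm_nonneg _) hR1') le_rfl
      _ = A * ∫ y, min ‖y - D y‖ 1 ∂(ν n) + A * ∫ y, min (‖D y‖ / R) 1 ∂(ν n) := by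
          have u1 : ∫ y, min ‖y - D y‖ 1 ∂(ν n) = ∫ w, min ‖w.1 - D w.1‖ 1 ∂(μ n) :=
            hνint n _ (hminc (m + 1))
          have u2 : ∫ y, min (‖D y‖ / R) 1 ∂(ν n) = ∫ w, min (‖D w.1‖ / R) 1 ∂(μ n) :=
            hνint n _ (hRc.comp hDc)
          rw [u1, u2, integral_const_mul, integral_add i1 i2, mul_add]
      _ ≤ ε / 8 + ε / 8 :=
          add_le_add ((mul_le_mul_of_nonneg_left h1 hA0).trans hm1.le) h3.le
  -- replace the first coordinate by its dyadic interpolation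
  have s2 : |∫ w, g₁ w.1 ∂(μ n) - ∫ y, g₁ (D y) ∂(ν n)| ≤ ε / 8 := by
    rw [← hνint n g₁ hg₁c, ← integral_sub hg₁ν hg₁Dν]
    calc |∫ y, (g₁ y - g₁ (D y)) ∂(ν n)| ≤ ∫ y, |g₁ y - g₁ (D y)| ∂(ν n) :=
          abs_integral_le_integral_abs
      _ ≤ ∫ y, A * min ‖y - D y‖ 1 ∂(ν n) :=
          integral_mono_of_nonneg (Eventually.of_forall fun y => abs_nonneg _)
            ((hmini (m + 1) n).const_mul A) (Eventually.of_forall fun y => hlipd y (D y))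
      _ = A * ∫ y, min ‖y - D y‖ 1 ∂(ν n) := integral_const_mul _ _
      _ ≤ ε / 8 := (mul_le_mul_of_nonneg_left h1 hA0).trans hm1.le
  rw [Real.dist_eq] at h4 ⊢
  have t1 := abs_le.1 s1
  have t2 := abs_le.1 s2
  have t3 := abs_lt.1 h4
  have t4 := abs_lt.1 hm2
  rw [abs_lt]
  constructor <;> linarith [t1.1, t1.2, t2.1, t2.2, t3.1, t3.2, t4.1, t4.2]

/-! ### Uniform properties of the conditional laws of the walk -/

section UniformConditional

variable {f : ℝ → ℝ} [IsProbabilityMeasure (densityLaw f)]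

lemma norm_rescaledEnd_le {sd : ℝ} (hsd : 0 < sd) {N : ℕ} (hN : 0 < N) {R : ℝ} {p : ℝ × ℝ}
    (h1 : |p.1| ≤ R) (h2 : |p.2| ≤ R) :
    ‖rescaledEnd sd (-p.1) 0 N (-p.2, 0)‖ ≤ 2 * R / (sd * √N) := by
  have hNR : (0 : ℝ) < N := by exact_mod_cast hN
  have hA : 0 < sd * √(N : ℝ) := by positivity
  have hR : 0 ≤ R := (abs_nonneg _).trans h1
  rw [rescaledEnd, Prod.norm_def]
  refine max_le ?_ ?_
  · rw [Real.norm_eq_abs, abs_div, abs_of_pos hA]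
    gcongr
    calc |-p.2 - -p.1| ≤ |-p.2| + |-p.1| := abs_sub _ _
      _ ≤ 2 * R := by rw [abs_neg, abs_neg]; linarith
  · have h : (0 - 0 - (N : ℝ) * -p.1) / (sd * √N * N) = p.1 / (sd * √N) := by
      field_simp
      ring
    simp only [h]
    rw [Real.norm_eq_abs, abs_div, abs_of_pos hA]
    gcongr
    linarith

lemma tendsto_rescaledEnd {sd : ℝ} (hsd : 0 < sd) {N : ℕ → ℕ} (hN : Tendsto N atTop atTop) {R : ℝ}
    {p : ℕ → ℝ × ℝ} (h1 : ∀ i, |(p i).1| ≤ R) (h2 : ∀ i, |(p i).2| ≤ R) :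
    Tendsto (fun i => rescaledEnd sd (-(p i).1) 0 (N i) (-(p i).2, 0)) atTop (𝓝 0) := by
  have hlim : Tendsto (fun i => 2 * R / (sd * √(N i : ℝ))) atTop (𝓝 0) :=
    ((Real.tendsto_sqrt_atTop.comp (tendsto_natCast_atTop_atTop.comp hN)).const_mul_atTop
      hsd).const_div_atTop _
  refine squeeze_zero_norm' ?_ hlim
  filter_upwards [hN.eventually_gt_atTop 0] with i hi
  exact norm_rescaledEnd_le hsd hi (h1 i) (h2 i)

lemma expFunctional_of_isEmpty {ι : Type*} [Fintype ι] [IsEmpty ι] (θ : ι → ℝ) (τ : ι → I)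
    (y : C(I, ℝ)) : expFunctional θ τ y = 1 := by
  simp [expFunctional]

/-- The rescaled density of the terminal value converges to a positive limit. -/
lemma tendsto_weightedInt_one (hf : IsStepDensity f) {sd : ℝ}
    (hsd : sd = √(∫ x, x ^ 2 ∂(densityLaw f))) {N : ℕ → ℕ} (hN : Tendsto N atTop atTop)
    {z : ℕ → ℝ × ℝ} (hz : Tendsto z atTop (𝓝 0)) :
    Tendsto (fun i => weightedInt f sd (N i) (fun _ => 1) (z i)) atTop
      (𝓝 ((∫ p : ℝ × ℝ, Real.exp (-endVar p / 2) : ℝ) : ℂ)) := by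
  have h := tendsto_weightedInt_expFunctional hf (fun _ : Fin 0 => 0) (fun _ => 0) hN
    (a := fun _ => 0) (b := 0) (R := 0) (fun i => by simp) hz hsd
  simp only [expFunctional_of_isEmpty, profileVar_zero_left, integral_complex_ofReal] at h
  exact h

/-- The rescaled density of the terminal value is bounded below, uniformly in bounded endpoints. -/
lemma exists_half_le_re_weightedInt (hf : IsStepDensity f) {sd : ℝ}
    (hsd : sd = √(∫ x, x ^ 2 ∂(densityLaw f))) (R : ℝ) :
    ∃ N₀ : ℕ, ∀ N : ℕ, N₀ ≤ N → ∀ p : ℝ × ℝ, |p.1| ≤ R → |p.2| ≤ R →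
      (∫ p : ℝ × ℝ, Real.exp (-endVar p / 2)) / 2 ≤
        (weightedInt f sd N (fun _ => 1) (rescaledEnd sd (-p.1) 0 N (-p.2, 0))).re := by
  have hsd0 : 0 < sd := by rw [hsd]; exact Real.sqrt_pos.2 hf.integral_sq_pos
  by_contra! hcon
  choose N hN p h1 h2 hlt using hcon
  have hNt : Tendsto N atTop atTop := tendsto_atTop_mono hN tendsto_id
  have hlim := (Complex.continuous_re.tendsto _).comp
    (tendsto_weightedInt_one hf hsd hNt (tendsto_rescaledEnd hsd0 hNt h1 h2))
  rw [Complex.ofReal_re] at hlim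
  obtain ⟨i, hi⟩ := (hlim.eventually_const_lt (half_lt_self integral_exp_neg_endVar_pos)).exists
  exact (hlt i).not_gt hi

lemma exists_norm_weightedChar_one_le (hf : IsStepDensity f) {sd : ℝ} (hsd : 0 < sd) :
    ∃ (C : ℝ) (N₀ : ℕ), ∀ N : ℕ, N₀ ≤ N → ∀ p : ℝ × ℝ,
      ‖weightedChar f sd N (fun _ => 1) p‖ ≤ C * (1 + ‖p‖) ^ (-3 : ℝ) := by
  obtain ⟨C, N₀, -, h⟩ := exists_norm_weightedChar_expFunctional_le hf hsd (fun _ : Fin 0 => 0)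
    (fun _ => 0)
  refine ⟨C, N₀, fun N hN p => ?_⟩
  have := h N hN 0 0 p
  simpa only [expFunctional_of_isEmpty] using this

lemma norm_weightedInt_le {sd : ℝ} {N : ℕ} {G : (ℕ → ℝ) → ℂ} {C : ℝ}
    (h : ∀ p, ‖weightedChar f sd N G p‖ ≤ C * (1 + ‖p‖) ^ (-3 : ℝ)) (z : ℝ × ℝ) :
    ‖weightedInt f sd N G z‖ ≤ C * ∫ p : ℝ × ℝ, (1 + ‖p‖) ^ (-3 : ℝ) := by
  rw [weightedInt, ← integral_const_mul]
  refine norm_integral_le_of_norm_le (integrable_bound C) (Eventually.of_forall fun p => ?_)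
  rw [norm_mul, Complex.norm_exp_ofReal_mul_I, one_mul]
  exact h p

/-- For `N` large, uniformly in bounded endpoints, the conditional law of the rescaled walk exists, its
second coordinate is close to the integral of the first, the increments of the first coordinate
satisfy a moment bound, and its finite-dimensional distributions are quotients of Fourier
integrals. -/
theorem exists_walk_isCondLaw (hf : IsStepDensity f) {sd : ℝ}
    (hsd : sd = √(∫ x, x ^ 2 ∂(densityLaw f))) (R : ℝ) :
    ∃ (C : ℝ) (N₀ : ℕ), 0 ≤ C ∧ ∀ N : ℕ, N₀ ≤ N → ∀ p : ℝ × ℝ, |p.1| ≤ R → |p.2| ≤ R →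
      ∃ ν : Measure (C(I, ℝ) × C(I, ℝ)), IsProbabilityMeasure ν ∧
        IsCondLaw (stepsLaw f) (rescaledPair sd (-p.1) 0 N) (endpoint (-p.1) 0 N) (-p.2, 0) ν ∧
        (∀ᵐ w ∂ν, ‖w.2 - integralPath w.1‖ ≤ 3 / N * ‖w.1‖) ∧
        (∀ s t : I, s ≤ t → (t : ℝ) - s ≤ 1 / 4 →
          ∫ w, truncPow (w.1 t - w.1 s) ∂ν ≤ C * ((t : ℝ) - s) ^ 2) ∧
        ∀ (d : ℕ) (θ : Fin d → ℝ) (τ : Fin d → I),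
          Integrable (weightedChar f sd N
            fun x => expFunctional θ τ (rescaledPair sd (-p.1) 0 N x).1) →
          ∫ w, expFunctional θ τ w.1 ∂ν =
            weightedInt f sd N (fun x => expFunctional θ τ (rescaledPair sd (-p.1) 0 N x).1)
                (rescaledEnd sd (-p.1) 0 N (-p.2, 0)) /
              weightedInt f sd N (fun _ => 1) (rescaledEnd sd (-p.1) 0 N (-p.2, 0)) := by
  have hsd0 : 0 < sd := by rw [hsd]; exact Real.sqrt_pos.2 hf.integral_sq_pos
  obtain ⟨N₁, hN₁⟩ := exists_half_le_re_weightedInt hf hsd R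
  obtain ⟨C₂, N₂, hN₂⟩ := exists_norm_weightedChar_one_le hf hsd0
  obtain ⟨C₃, N₃, hC₃, hN₃⟩ := exists_norm_weightedChar_increment_le hf hsd0
  set c := ∫ p : ℝ × ℝ, Real.exp (-endVar p / 2) with hc
  have hc0 : 0 < c := integral_exp_neg_endVar_pos
  set J := ∫ p : ℝ × ℝ, (1 + ‖p‖) ^ (-3 : ℝ) with hJ
  have hJ0 : 0 ≤ J := integral_nonneg fun p => by positivity
  refine ⟨C₃ * J / (c / 2), max (max N₁ N₂) (max N₃ 2), by positivity, fun N hN p hp1 hp2 => ?_⟩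
  obtain ⟨⟨hN1, hN2⟩, hN3, hN4⟩ : (N₁ ≤ N ∧ N₂ ≤ N) ∧ N₃ ≤ N ∧ 2 ≤ N := by
    simpa only [max_le_iff] using hN
  have hN0 : 0 < N := by omega
  have hhalf := hN₁ N hN1 p hp1 hp2
  have hone : Integrable (weightedChar f sd N fun _ => 1) :=
    integrable_weightedChar_of_le continuous_const (C := 1) (fun _ => by simp) (hN₂ N hN2)
  obtain ⟨ν, hν, hcond, hG⟩ := exists_isCondLaw_weightedInt hf hsd0 (-p.1) 0 hN4 hone
    (lt_of_lt_of_le (by positivity) hhalf) (continuous_rescaledPair sd (-p.1) 0 N)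
  refine ⟨ν, hν, hcond, ?_, ?_, ?_⟩
  · -- a bounded functional that vanishes exactly where the inequality holds
    set D : C(I, ℝ) × C(I, ℝ) → ℝ := fun w =>
      min (max (‖w.2 - integralPath w.1‖ - 3 / N * ‖w.1‖) 0) 1 with hD
    have hDc : Continuous D := by
      have := continuous_integralPath
      fun_prop
    have hD0 : ∀ w, 0 ≤ D w := fun w => le_min (le_max_right _ _) zero_le_one
    have hD1 : ∀ w, D w ≤ 1 := fun w => min_le_right _ _
    have hzero : (fun x => ((D (rescaledPair sd (-p.1) 0 N x) : ℝ) : ℂ)) = fun _ => 0 := by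
      funext x
      have h := norm_rescaledPair_snd_sub_integralPath_le hsd0 (-p.1) hN0 x
      rw [hD]
      simp only
      rw [max_eq_right (sub_nonpos.2 h), min_eq_left zero_le_one, Complex.ofReal_zero]
    have hchar : weightedChar f sd N (fun _ => 0) = fun _ => 0 := by
      funext q
      simp [weightedChar]
    have h := hG (fun w => (D w : ℂ)) (by fun_prop) ⟨1, fun w => by
      rw [Complex.norm_real, Real.norm_eq_abs, abs_of_nonneg (hD0 w)]
      exact hD1 w⟩ (by rw [hzero, hchar]; exact integrable_zero _ _ _)
    rw [hzero, integral_complex_ofReal, weightedInt, hchar] at h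
    simp only [mul_zero, integral_zero, zero_div, Complex.ofReal_eq_zero] at h
    have hDi : Integrable D ν := integrable_of_continuous_bound hDc (C := 1) fun w => by
      rw [abs_of_nonneg (hD0 w)]
      exact hD1 w
    filter_upwards [(integral_eq_zero_iff_of_nonneg hD0 hDi).1 h] with w hw
    by_contra! hlt
    have : 0 < D w := lt_min (lt_max_of_lt_left (sub_pos.2 hlt)) one_pos
    exact this.ne' hw
  · intro s t hst hts
    have hTc : Continuous fun w : C(I, ℝ) × C(I, ℝ) => truncPow (w.1 t - w.1 s) :=
      continuous_truncPow.comp (((continuous_eval_const t).comp continuous_fst).sub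
        ((continuous_eval_const s).comp continuous_fst))
    have hT1 : ∀ y, ‖((truncPow y : ℝ) : ℂ)‖ ≤ 1 := fun y => by
      rw [Complex.norm_real, Real.norm_eq_abs, abs_of_nonneg (truncPow_nonneg _)]
      exact truncPow_le_one _
    have hbd := hN₃ N hN3 (-p.1) 0 s t hst hts
    have h := hG (fun w => ((truncPow (w.1 t - w.1 s) : ℝ) : ℂ))
      (Complex.continuous_ofReal.comp hTc) ⟨1, fun w => hT1 _⟩
      (integrable_weightedChar_of_le (Complex.continuous_ofReal.comp
        (hTc.comp (continuous_rescaledPair sd (-p.1) 0 N))) (fun x => hT1 _) hbd)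
    rw [integral_complex_ofReal] at h
    have hn : ∫ w, truncPow (w.1 t - w.1 s) ∂ν =
        ‖((∫ w, truncPow (w.1 t - w.1 s) ∂ν : ℝ) : ℂ)‖ := by
      rw [Complex.norm_real, Real.norm_eq_abs,
        abs_of_nonneg (integral_nonneg fun w => truncPow_nonneg _)]
    rw [hn, h, norm_div]
    calc _ ≤ (C₃ * ((t : ℝ) - s) ^ 2 * J) / (c / 2) :=
          div_le_div₀ (by positivity) (norm_weightedInt_le hbd _) (by positivity)
            (hhalf.trans (Complex.re_le_norm _))
      _ = C₃ * J / (c / 2) * ((t : ℝ) - s) ^ 2 := by ring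
  · intro d θ τ hint
    exact hG (fun w => expFunctional θ τ w.1)
      ((continuous_expFunctional θ τ).comp continuous_fst)
      ⟨1, fun w => (norm_expFunctional θ τ w.1).le⟩ hint

/-- Along every sequence of lengths that tends to infinity and every bounded sequence of endpoints,
the conditional laws converge to the law of the bridge and its integral. -/
theorem tendsto_integral_of_isCondLaw (hf : IsStepDensity f) {sd : ℝ}
    (hsd : sd = √(∫ x, x ^ 2 ∂(densityLaw f))) {W : Measure C(I, ℝ)} [IsProbabilityMeasure W]
    (hW : IsBrownianLaw W) {N : ℕ → ℕ} (hN : Tendsto N atTop atTop) {R : ℝ} {p : ℕ → ℝ × ℝ}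
    (h1 : ∀ i, |(p i).1| ≤ R) (h2 : ∀ i, |(p i).2| ≤ R)
    {μ : ℕ → Measure (C(I, ℝ) × C(I, ℝ))} [∀ i, IsProbabilityMeasure (μ i)]
    (hμ : ∀ i, IsCondLaw (stepsLaw f) (rescaledPair sd (-(p i).1) 0 (N i))
      (endpoint (-(p i).1) 0 (N i)) (-(p i).2, 0) (μ i)) (g : (C(I, ℝ) × C(I, ℝ)) →ᵇ ℝ) :
    Tendsto (fun i => ∫ w, g w ∂(μ i)) atTop
      (𝓝 (∫ w, g w ∂((W.map bridge).map fun y => (y, integralPath y)))) := by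
  have hsd0 : 0 < sd := by rw [hsd]; exact Real.sqrt_pos.2 hf.integral_sq_pos
  obtain ⟨C, N₀, hC, hex⟩ := exists_walk_isCondLaw hf hsd R
  have hpairc : Continuous fun y : C(I, ℝ) => (y, integralPath y) :=
    continuous_id.prodMk continuous_integralPath
  have hbm : Measurable bridge := continuous_bridge.measurable
  have hprob : IsProbabilityMeasure (W.map bridge) :=
    Measure.isProbabilityMeasure_map hbm.aemeasurable
  rw [integral_map hpairc.measurable.aemeasurable g.continuous.measurable.aestronglyMeasurable]
  have hz := tendsto_rescaledEnd hsd0 hN h1 h2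
  have hone := tendsto_weightedInt_one hf hsd hN hz
  have hc0 : ((∫ p : ℝ × ℝ, Real.exp (-endVar p / 2) : ℝ) : ℂ) ≠ 0 :=
    Complex.ofReal_ne_zero.2 integral_exp_neg_endVar_pos.ne'
  refine tendsto_integral_of_increments (fun d θ τ => ?_) hC ?_
    (r := fun i => 3 / (N i : ℝ))
    ((tendsto_natCast_atTop_atTop.comp hN).const_div_atTop _) ?_ g
  · obtain ⟨C', N', -, hN'⟩ := exists_norm_weightedChar_expFunctional_le hf hsd0 θ τ
    have hlim := (tendsto_weightedInt_expFunctional hf θ τ hN (a := fun i => -(p i).1) (b := 0)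
      (R := R) (fun i => by rw [abs_neg]; exact h1 i) hz hsd).div hone hc0
    rw [integral_exp_neg_profileVar, mul_div_cancel_right₀ _ hc0] at hlim
    have hbr : ∫ y, expFunctional θ τ y ∂(W.map bridge) =
        ((Real.exp (-profileVar θ τ (regression θ τ) / 2) : ℝ) : ℂ) := by
      rw [integral_map hbm.aemeasurable
        (continuous_expFunctional θ τ).measurable.aestronglyMeasurable]
      have h := hW.integral_bridge_mul θ τ 0
      simpa [endVar_zero] using h
    rw [hbr]
    refine hlim.congr' ?_
    filter_upwards [hN.eventually_ge_atTop N₀, hN.eventually_ge_atTop N'] with i hi hi'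
    obtain ⟨ν, -, hcond, -, -, hfdd⟩ := hex (N i) hi (p i) (h1 i) (h2 i)
    rw [(hμ i).unique hcond]
    exact (hfdd d θ τ (integrable_weightedChar_of_le
      (continuous_expFunctional_rescaledPair θ τ sd (-(p i).1) 0 (N i))
      (fun x => (norm_expFunctional θ τ _).le) (hN' (N i) hi' _ _))).symm
  · filter_upwards [hN.eventually_ge_atTop N₀] with i hi
    obtain ⟨ν, -, hcond, -, hinc, -⟩ := hex (N i) hi (p i) (h1 i) (h2 i)
    rw [(hμ i).unique hcond]
    exact hinc
  · filter_upwards [hN.eventually_ge_atTop N₀] with i hi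
    obtain ⟨ν, -, hcond, hae, -, -⟩ := hex (N i) hi (p i) (h1 i) (h2 i)
    rw [(hμ i).unique hcond]
    exact hae

end UniformConditional

lemma IsCondLaw.condLaw_eq {Ω E F : Type*} [MeasurableSpace Ω]
    [TopologicalSpace E] [MeasurableSpace E] [TopologicalSpace F] [MeasurableSpace F]
    [HasOuterApproxClosed E] [BorelSpace E] [MeasurableSpace.CountablyGenerated E]
    {P : Measure Ω} [IsProbabilityMeasure P] {X : Ω → E} {T : Ω → F} {t : F} {μ : Measure E}
    (h : IsCondLaw P X T t μ) : condLaw P X T t = μ := by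
  have hex : ∃ μ, IsCondLaw P X T t μ := ⟨μ, h⟩
  rw [condLaw, dif_pos hex]
  exact hex.choose_spec.unique h

end IntegratedWalk

open IntegratedWalk in
theorem proposition4p1
    {V : ℝ → EReal} (hV : IntegratedWalk.IsPotential V)
    -- the i.i.d. steps
    {Ω : Type*} [MeasurableSpace Ω] (P : Measure Ω) [IsProbabilityMeasure P]
    (X : ℕ → Ω → ℝ) (hlaw : ∀ i, HasLaw (X i) (IntegratedWalk.stepLaw V) P)
    (hindep : iIndepFun X P)
    -- the Brownian motion
    {Ω' : Type*} [MeasurableSpace Ω'] (P' : Measure Ω') [IsProbabilityMeasure P']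
    (B : Ω' → C(I, ℝ)) (hB : IntegratedWalk.IsBrownianMotion B P') :
    -- the law of the limit process exists
    IntegratedWalk.IsCondLaw P' (fun ω => (B ω, IntegratedWalk.integralPath (B ω)))
      (fun ω => (B ω 1, IntegratedWalk.integralPath (B ω) 1)) (0, 0)
      (IntegratedWalk.brownianBridgeLaw P' B) ∧
    ∀ K : Set (ℝ × ℝ), IsCompact K →
      -- for large `N` the conditional laws of the walk exist, for all `(a, c) ∈ K`
      (∀ᶠ N : ℕ in atTop, ∀ p ∈ K,
        IntegratedWalk.IsCondLaw P
          (fun ω => IntegratedWalk.rescaledPair (IntegratedWalk.stepSigma V) (-p.1) 0 N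
            fun i => X i ω)
          (fun ω => (IntegratedWalk.walk (-p.1) (fun i => X i ω) N,
            IntegratedWalk.integratedWalk (-p.1) 0 (fun i => X i ω) N)) (-p.2, 0)
          (IntegratedWalk.walkBridgeLaw P X (IntegratedWalk.stepSigma V) (-p.1) 0 N (-p.2) 0)) ∧
      -- weak convergence on `C([0, 1]) × C([0, 1])`, uniformly for `(a, c) ∈ K`
      ∀ g : (C(I, ℝ) × C(I, ℝ)) →ᵇ ℝ,
        TendstoUniformlyOn
          (fun (N : ℕ) (p : ℝ × ℝ) => ∫ w, g w ∂(IntegratedWalk.walkBridgeLaw P X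
            (IntegratedWalk.stepSigma V) (-p.1) 0 N (-p.2) 0))
          (fun _ => ∫ w, g w ∂(IntegratedWalk.brownianBridgeLaw P' B)) atTop K := by
  obtain ⟨f, hf, hfV⟩ := hV.exists_density
  have hfp := hf.isProbabilityMeasure
  have hsd : stepSigma V = √(∫ x, x ^ 2 ∂(densityLaw f)) := by rw [stepSigma, hfV]
  -- the laws of the steps and of the Brownian motion
  have hXm : AEMeasurable (fun ω i => X i ω) P := aemeasurable_pi_iff.2 fun i => (hlaw i).aemeasurable
  have hXlaw : P.map (fun ω i => X i ω) = stepsLaw f := by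
    simp only [hfV] at hlaw
    exact (hindep.hasLaw_infinitePi hlaw hXm).map_eq
  have hBm := hB.aemeasurable
  have hWp : IsProbabilityMeasure (P'.map B) := Measure.isProbabilityMeasure_map hBm
  have hW : IsBrownianLaw (P'.map B) := hB.isBrownianLaw
  have hBcond := IsCondLaw.of_map hBm hW.isCondLaw
  have hBeq : brownianBridgeLaw P' B =
      (((P'.map B).map bridge).map fun y => (y, integralPath y)) := hBcond.condLaw_eq
  refine ⟨hBeq ▸ hBcond, fun K hK => ?_⟩
  obtain ⟨R, hR⟩ := hK.isBounded.exists_norm_le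
  have hR1 : ∀ p ∈ K, |p.1| ≤ R := fun p hp => (norm_fst_le p).trans (hR p hp)
  have hR2 : ∀ p ∈ K, |p.2| ≤ R := fun p hp => (norm_snd_le p).trans (hR p hp)
  obtain ⟨_, N₀, -, hex⟩ := exists_walk_isCondLaw hf hsd R
  have hwalk : ∀ N, N₀ ≤ N → ∀ p ∈ K,
      IsProbabilityMeasure (walkBridgeLaw P X (stepSigma V) (-p.1) 0 N (-p.2) 0) ∧
      IsCondLaw (stepsLaw f) (rescaledPair (stepSigma V) (-p.1) 0 N) (endpoint (-p.1) 0 N)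
        (-p.2, 0) (walkBridgeLaw P X (stepSigma V) (-p.1) 0 N (-p.2) 0) := by
    intro N hN p hp
    obtain ⟨ν, hν, hcond, -⟩ := hex N hN p (hR1 p hp) (hR2 p hp)
    have hcond' := hcond
    rw [← hXlaw] at hcond'
    have h : walkBridgeLaw P X (stepSigma V) (-p.1) 0 N (-p.2) 0 = ν :=
      (IsCondLaw.of_map hXm hcond').condLaw_eq
    rw [h]
    exact ⟨hν, hcond⟩
  refine ⟨?_, fun g => ?_⟩
  · filter_upwards [eventually_ge_atTop N₀] with N hN p hp
    have hcond := (hwalk N hN p hp).2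
    rw [← hXlaw] at hcond
    exact IsCondLaw.of_map hXm hcond
  · -- a failure of uniform convergence yields sequences that contradict the convergence
    rw [Metric.tendstoUniformlyOn_iff]
    by_contra! hcon
    obtain ⟨ε, hε, hcon⟩ := hcon
    rw [Filter.frequently_atTop] at hcon
    have hcon' : ∀ n : ℕ, ∃ N, max n N₀ ≤ N ∧ ∃ p ∈ K,
        ε ≤ dist (∫ w, g w ∂(brownianBridgeLaw P' B))
          (∫ w, g w ∂(walkBridgeLaw P X (stepSigma V) (-p.1) 0 N (-p.2) 0)) :=
      fun n => hcon (max n N₀)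
    choose N hN p hpK hdist using hcon'
    have hNt : Tendsto N atTop atTop :=
      tendsto_atTop_mono (fun n => (le_max_left _ _).trans (hN n)) tendsto_id
    have hw := fun n => hwalk (N n) ((le_max_right _ _).trans (hN n)) (p n) (hpK n)
    have hwp := fun n => (hw n).1
    have hlim := tendsto_integral_of_isCondLaw hf hsd hW hNt (fun n => hR1 _ (hpK n))
      (fun n => hR2 _ (hpK n)) (fun n => (hw n).2) g
    rw [← hBeq] at hlim
    obtain ⟨n, hn⟩ := (Metric.tendsto_nhds.1 hlim ε hε).exists
    rw [dist_comm] at hn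
    exact (hdist n).not_gt hn
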